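/- **Conventions.** A graph is a directed graph $G=(V,E,w)$ on $V=\{1,\dots,n\}$ with integer edge weights $w\ge 0$ in which every vertex has at least one outgoing edge; $W$ is its maximum edge weight. For a vertex $x$, $\mu(x)$ is the minimum of $w(C)/|C|$ over all cycles $C$ (closed walks with $|C|\ge 1$ edges) reachable from $x$. Running times are measured on a random access machine with logarithmic cost: its registers and array cells hold natural numbers, an instruction costs $1$ plus the number of bits of the operands and addresses that it handles, and a multiplication or integer division of numbers with $k$ bits in total costs $O(k\log k\log\log k)$. The algorithm receives $n$, the weight matrix, and the binary digits of the real number $\varepsilon$ (in an array with random access); it returns each $\hat\mu(x)$ as a fraction of two natural numbers. Let $\omega$ be any real number such that $n\times n$ integer matrices can be multiplied with $O(n^\omega)$ ring operations; that is, for every $n\ge1$ there is a straight-line program over $\mathbb Z$ (operations $+,-,\cdot$ and the constant $1$) with $O(n^\omega)$ operations that computes the product, and on input $n$ this program can be written down by the machine in time $O(n^\omega(1+\log n))$. **Theorem.** There is one algorithm (depending only on the given method for matrix multiplication) which, for every graph $G$ with nonnegative integer edge weights and every real $0<\varepsilon\le1$, computes for every vertex $x$ a value $\hat\mu(x)$ with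 $$\mu(x)\le\hat\mu(x)\le(1+\varepsilon)\,\mu(x)$$ in time $$O\!\left(\frac{n^{\omega}}{\varepsilon}\,\log^3\!\Big(\frac{nW}{\varepsilon}\Big)\,\log^2\!\left(\frac{\log\big(\frac{nW}{\varepsilon}\big)}{\varepsilon}\right)\log n\right)=\widetilde O\!\left(\frac{n^{\omega}}{\varepsilon}\log^3\!\Big(\frac{nW}{\varepsilon}\Big)\right).$$ In these bounds $n$ and $W$ are to be replaced by $\max(n,3)$ and $\max(W,1)$; the constants do not depend on $n$, $G$, $W$, $\varepsilon$; and $\widetilde O(T)$ means $O(T\log^k T)$ for some constant $k$. -/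

import Mathlib

/-! ## Weighted directed graphs and the minimum cycle mean -/

namespace CycleMean

/-- A directed graph on the vertices `0, …, n-1` with nonnegative integer edge weights in which
every vertex has an outgoing edge. `wt x y = some w` says that the edge `(x, y)` is present and
has weight `w`; `wt x y = none` says that there is no such edge. -/
structure WGraph (n : ℕ) where
  wt : Fin n → Fin n → Option ℕ
  exists_out : ∀ x, ∃ y w, wt x y = some w

namespace WGraph

variable {n : ℕ}

/-- `G.Path x y k w`: there is a path from `x` to `y` with exactly `k` edges and total weight `w`
(vertices and edges may be repeated). -/
inductive Path (G : WGraph n) : Fin n → Fin n → ℕ → ℕ → Prop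
  | nil (x : Fin n) : Path G x x 0 0
  | cons {x y z : Fin n} {a k b : ℕ} (h : G.wt x y = some a) (p : Path G y z k b) :
      Path G x z (k + 1) (a + b)

/-- The mean weights of the (nonempty) cycles that are reachable from `x`. -/
def cycleMeans (G : WGraph n) (x : Fin n) : Set ℝ :=
  {q | ∃ (y : Fin n) (l v k w : ℕ), G.Path x y l v ∧ 0 < k ∧ G.Path y y k w ∧ q = (w : ℝ) / k}

/-- The minimum mean weight `μ(x)` of a cycle reachable from `x`. -/
noncomputable def mu (G : WGraph n) (x : Fin n) : ℝ := sInf (G.cycleMeans x)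

/-- The maximum edge weight `W`. -/
def maxWeight (G : WGraph n) : ℕ :=
  Finset.univ.sup fun p : Fin n × Fin n => (G.wt p.1 p.2).getD 0

end WGraph

/-! ## Random access machines with logarithmic cost -/

/-- A machine has registers and arrays, all cells of which hold natural numbers. A program
mentions only finitely many registers and arrays. -/
structure State where
  reg : ℕ → ℕ
  arr : ℕ → ℕ → ℕ

/-- Assignment to a register. -/
def State.setReg (s : State) (r v : ℕ) : State :=
  { s with reg := Function.update s.reg r v }

/-- Assignment to the cell `i` of the array `a`. -/
def State.setArr (s : State) (a i v : ℕ) : State :=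
  { s with arr := Function.update s.arr a (Function.update (s.arr a) i v) }

/-- Arithmetic operations; `sub` is truncated subtraction, `div` is division with rounding down
(and with value `0` for the divisor `0`). -/
inductive Op
  | add
  | sub
  | mul
  | div

def Op.eval : Op → ℕ → ℕ → ℕ
  | add, x, y => x + y
  | sub, x, y => x - y
  | mul, x, y => x * y
  | div, x, y => x / y

/-- The bound `k · log k · log log k` for multiplying integers with `k` bits in total (with `1`
added to each logarithm, so that the factors do not vanish for small `k`). -/
def mulCost (k : ℕ) : ℕ := k * (Nat.log 2 k + 1) * (Nat.log 2 (Nat.log 2 k) + 1)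

/-- The cost of an arithmetic operation: linear in the number of bits of the operands for
addition and subtraction, `mulCost` for multiplication and division. -/
def Op.cost : Op → ℕ → ℕ → ℕ
  | add, x, y => 1 + x.size + y.size
  | sub, x, y => 1 + x.size + y.size
  | mul, x, y => 1 + mulCost (x.size + y.size)
  | div, x, y => 1 + mulCost (x.size + y.size)

/-- Programs. -/
inductive Prog
  /-- `r := c` for a constant `c` -/
  | const (r c : ℕ)
  /-- `r := x o y` for registers `x`, `y` -/
  | op (o : Op) (r x y : ℕ)
  /-- `r := a[i]` for an array `a` and a register `i` -/
  | load (r a i : ℕ)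
  /-- `a[i] := r` for an array `a` and registers `i`, `r` -/
  | store (a i r : ℕ)
  /-- first `p`, then `q` -/
  | seq (p q : Prog)
  /-- `p` if the register `r` is zero, `q` otherwise -/
  | ifz (r : ℕ) (p q : Prog)
  /-- repeat `p` as long as the register `r` is nonzero -/
  | loop (r : ℕ) (p : Prog)

/-- `Exec p s s' c`: started in the state `s`, the program `p` halts in the state `s'`, and the
running time is `c`. Every instruction costs `1` plus the number of bits that it handles (operands
and addresses); multiplications and divisions of numbers with `k` bits cost `1 + mulCost k`. -/
inductive Exec : Prog → State → State → ℕ → Prop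
  | const (r c : ℕ) (s : State) :
      Exec (.const r c) s (s.setReg r c) (1 + c.size)
  | op (o : Op) (r x y : ℕ) (s : State) :
      Exec (.op o r x y) s (s.setReg r (o.eval (s.reg x) (s.reg y))) (o.cost (s.reg x) (s.reg y))
  | load (r a i : ℕ) (s : State) :
      Exec (.load r a i) s (s.setReg r (s.arr a (s.reg i)))
        (1 + (s.reg i).size + (s.arr a (s.reg i)).size)
  | store (a i r : ℕ) (s : State) :
      Exec (.store a i r) s (s.setArr a (s.reg i) (s.reg r))
        (1 + (s.reg i).size + (s.reg r).size)
  | seq {p q : Prog} {s s' s'' : State} {c c' : ℕ} :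
      Exec p s s' c → Exec q s' s'' c' → Exec (.seq p q) s s'' (c + c')
  | ifz_zero {r : ℕ} {p q : Prog} {s s' : State} {c : ℕ} :
      s.reg r = 0 → Exec p s s' c → Exec (.ifz r p q) s s' (1 + c)
  | ifz_pos {r : ℕ} {p q : Prog} {s s' : State} {c : ℕ} :
      s.reg r ≠ 0 → Exec q s s' c → Exec (.ifz r p q) s s' (1 + (s.reg r).size + c)
  | loop_zero {r : ℕ} {p : Prog} {s : State} :
      s.reg r = 0 → Exec (.loop r p) s s 1
  | loop_pos {r : ℕ} {p : Prog} {s s' s'' : State} {c c' : ℕ} :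
      s.reg r ≠ 0 → Exec p s s' c → Exec (.loop r p) s' s'' c' →
      Exec (.loop r p) s s'' (1 + (s.reg r).size + c + c')

/-! ## Classic matrix multiplication in `O(n ^ ω)` operations -/

/-- One instruction of a straight-line program: the constant `1`, or an arithmetic operation on
the values number `i` and `j`. -/
inductive Gate
  | one
  | add (i j : ℕ)
  | sub (i j : ℕ)
  | mul (i j : ℕ)

def Gate.eval {R : Type*} [Ring R] (v : ℕ → R) : Gate → R
  | one => 1
  | add i j => v i + v j
  | sub i j => v i - v j
  | mul i j => v i * v j

/-- The gate only uses values with a number below `m`. -/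
def Gate.UsesBelow (m : ℕ) : Gate → Prop
  | one => True
  | add i j => i < m ∧ j < m
  | sub i j => i < m ∧ j < m
  | mul i j => i < m ∧ j < m

/-- A straight-line program on `m` inputs: every gate only uses inputs and earlier results. -/
def WellFormed : ℕ → List Gate → Prop
  | _, [] => True
  | m, g :: gs => g.UsesBelow m ∧ WellFormed (m + 1) gs

/-- Run a straight-line program; `v` holds the `m` values known so far, and the results of the
gates become the values number `m`, `m + 1`, … -/
def runGates {R : Type*} [Ring R] : ℕ → List Gate → (ℕ → R) → (ℕ → R)
  | _, [], v => v
  | m, g :: gs, v => runGates (m + 1) gs (Function.update v m (g.eval v))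

/-- The two input matrices, in row-major order, as the values number `0, …, 2n²-1`. -/
def matrixInputs {R : Type*} [Ring R] {n : ℕ} (A B : Matrix (Fin n) (Fin n) R) (k : ℕ) : R :=
  if h : k < n * n then A (Fin.divNat ⟨k, h⟩) (Fin.modNat ⟨k, h⟩)
  else if h : k - n * n < n * n then B (Fin.divNat ⟨k - n * n, h⟩) (Fin.modNat ⟨k - n * n, h⟩)
  else 0

/-- The straight-line program `gs` multiplies `n × n` integer matrices: its last `n²` values are
the entries of the product, in row-major order. -/
def MultipliesMatrices (n : ℕ) (gs : List Gate) : Prop :=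
  WellFormed (2 * (n * n)) gs ∧
  ∀ (A B : Matrix (Fin n) (Fin n) ℤ) (i j : Fin n),
    runGates (2 * (n * n)) gs (matrixInputs A B) (n * n + gs.length + (i * n + j)) = (A * B) i j

/-- A gate written down as an operation code and two operands. -/
def Gate.code : Gate → ℕ × ℕ × ℕ
  | one => (0, 0, 0)
  | add i j => (1, i, j)
  | sub i j => (2, i, j)
  | mul i j => (3, i, j)

/-- The state `s` holds a description of the straight-line program `gs`: its length in register
`0` and its gates in the array `0`, three cells for each gate. -/
def State.Describes (s : State) (gs : List Gate) : Prop :=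
  s.reg 0 = gs.length ∧
  ∀ (k : ℕ) (g : Gate), gs[k]? = some g →
    (s.arr 0 (3 * k), s.arr 0 (3 * k + 1), s.arr 0 (3 * k + 2)) = g.code

/-- The start state with the single input `n`. -/
def natInput (n : ℕ) : State where
  reg r := if r = 0 then n else 0
  arr _ _ := 0

/-- `n × n` matrices can be multiplied with `O(n ^ ω)` ring operations (additions, subtractions,
multiplications), by straight-line programs that can be written down, from `n`, gate by gate in
time `O(log n)` for each of the `O(n ^ ω)` gates. -/
def MatMulExponent (ω : ℝ) : Prop :=
  ∃ (P : Prog) (S : ℕ → List Gate) (C : ℝ), ∀ n : ℕ, 1 ≤ n →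
    MultipliesMatrices n (S n) ∧
    ((S n).length : ℝ) ≤ C * (n : ℝ) ^ ω ∧
    ∃ (s : State) (c : ℕ), Exec P (natInput n) s c ∧ s.Describes (S n) ∧
      (c : ℝ) ≤ C * (n : ℝ) ^ ω * (1 + Real.log n)

/-! ## Input, output and running time of the approximation algorithm -/

/-- The input `(G, ε)`: the number `n` of vertices in register `0`; in the array `0` the weight
matrix in row-major order, an edge of weight `w` being stored as `w + 1` and a missing edge as `0`;
in the array `1` the binary digits of `ε`, where cell `i` holds the digit of weight `2 ^ (-i)`.
Everything else is `0`. -/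
noncomputable def WGraph.input {n : ℕ} (G : WGraph n) (ε : ℝ) : State where
  reg r := if r = 0 then n else 0
  arr a k :=
    if a = 0 then
      if h : k < n * n then ((G.wt (Fin.divNat ⟨k, h⟩) (Fin.modNat ⟨k, h⟩)).map (· + 1)).getD 0
      else 0
    else if a = 1 then ⌊2 ^ k * ε⌋₊ % 2
    else 0

/-- The output `μ̂(x)`: a fraction with its numerator in the array `0` and its denominator in the
array `1`. -/
noncomputable def State.output (s : State) (x : ℕ) : ℝ := (s.arr 0 x : ℝ) / (s.arr 1 x : ℝ)

/-- `(n ^ ω / ε) · log³(nW/ε)` -/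
noncomputable def mainTerm (ω : ℝ) (n W : ℕ) (ε : ℝ) : ℝ :=
  (n : ℝ) ^ ω / ε * Real.log (n * W / ε) ^ 3

/-- `(n ^ ω / ε) · log³(nW/ε) · log²(log(nW/ε)/ε) · log n` -/
noncomputable def timeBound (ω : ℝ) (n W : ℕ) (ε : ℝ) : ℝ :=
  (n : ℝ) ^ ω / ε * Real.log (n * W / ε) ^ 3 * Real.log (Real.log (n * W / ε) / ε) ^ 2 *
    Real.log n

end CycleMean

/-!
The minimum cycle mean is read off from the lightest paths with a fixed large number `t` of edges. A
path with `t` edges splits into cycles and at most `n` further edges, so its weight is at least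
`(t - n) * μ(x)` (`WGraph.Path.mu_le`); conversely, going to a best cycle and around it gives a path
of weight at most `t * μ(x) + 2 * n * W` (`WGraph.le_of_forall_path`). If `t` is a power of two of
order `n² * U / δ` for a bound `U > W`, then the lightest weight from `x` divided by `t - n` is
within a factor of `1 + δ` of `μ(x)`, even if this weight is only known up to a factor of
`1 + δ / 4` (`WGraph.mu_approx`). There is no additive error: `μ(x)` is either `0` or at least
`1 / n`, and the two cases are told apart by comparing the weight with `4 * n * U`.

The lightest paths with `t = 2 ^ τ` edges are computed by `τ` squarings of the weight matrix in the
min-plus semiring. Each squaring is approximate: for every scale `u = 1, 2, 4, …` the entries are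
rounded up to multiples `a * u`, those with `a ≤ R` are encoded as `B ^ (R - a)`, where `B > n` is a
power of two, and the encoded matrix is squared over the integers. An entry of the product is a sum
of at most `n < B` powers of `B`, so that its logarithm to the base `B` is the largest exponent
(`exists_log_le`), which decodes to the smallest sum of two rounded weights. For every pair of
halves of a lightest path one of the scales costs a factor of at most `1 + 4 / R` (`Approx.square`),
and `R = 32 * τ / δ` makes the total error at most `1 + δ / 4` (`one_add_pow_le`). The parameter `δ`
is the value of the first nonzero binary digit of `ε`, so that `δ ≤ ε < 2 * δ`.

The integer products are evaluated gate by gate with the given straight-line program, modulo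
`N = B ^ (2 ^ L) > B ^ (2 * R)`; since the true entries are below `N`, nothing is lost
(`MultipliesMatrices.square`). All numbers that occur have at most
`H = O(log (n * W / ε) / ε * log n)` bits (`bits_le`), one operation costs `O(H * (log H)²)`, and
there are `O(log (n * W / ε)²)` products with `O(n ^ ω)` gates each. This is the time bound
(`cost_le`). Encoding and decoding of an entry take `L` operations on numbers whose lengths grow
geometrically, so they cost no more than a constant number of operations on numbers below `N`
(`sum_mb_le`).

Programs are verified with a Hoare logic for total correctness with costs (`Spec`). The programs use
the registers and arrays with numbers below `64`; the generator of the straight-line programs is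
moved to those from `64` on (`Exec.shift`).
-/

namespace CycleMean

/-! ### Reasoning about programs -/

/-- Sequential composition of programs. -/
infixr:60 " ;; " => Prog.seq

theorem State.setReg_reg (s : State) (r v k : ℕ) :
    (s.setReg r v).reg k = if k = r then v else s.reg k := by
  simp [State.setReg, Function.update_apply]

theorem State.setReg_arr (s : State) (r v : ℕ) : (s.setReg r v).arr = s.arr := rfl

theorem State.setArr_reg (s : State) (a i v : ℕ) : (s.setArr a i v).reg = s.reg := rfl

theorem State.setArr_arr (s : State) (a i v a' i' : ℕ) :
    (s.setArr a i v).arr a' i' = if a' = a ∧ i' = i then v else s.arr a' i' := by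
  by_cases h : a' = a
  · subst h; simp [State.setArr, Function.update_apply]
  · simp [State.setArr, h]

namespace Prog

/-- Whether the register `k` occurs as the target of an instruction. -/
def writesReg : Prog → ℕ → Bool
  | const r _, k => decide (k = r)
  | op _ r _ _, k => decide (k = r)
  | load r _ _, k => decide (k = r)
  | store _ _ _, _ => false
  | seq p q, k => p.writesReg k || q.writesReg k
  | ifz _ p q, k => p.writesReg k || q.writesReg k
  | loop _ p, k => p.writesReg k

/-- Whether the array `a` occurs as the target of an instruction. -/
def writesArr : Prog → ℕ → Bool
  | const _ _, _ => false
  | op _ _ _ _, _ => false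
  | load _ _ _, _ => false
  | store b _ _, a => decide (a = b)
  | seq p q, a => p.writesArr a || q.writesArr a
  | ifz _ p q, a => p.writesArr a || q.writesArr a
  | loop _ p, a => p.writesArr a

/-- The effect of a program without loops (on programs with loops the value is meaningless). -/
def ev : Prog → State → State
  | const r c, s => s.setReg r c
  | op o r x y, s => s.setReg r (o.eval (s.reg x) (s.reg y))
  | load r a i, s => s.setReg r (s.arr a (s.reg i))
  | store a i r, s => s.setArr a (s.reg i) (s.reg r)
  | seq p q, s => q.ev (p.ev s)
  | ifz r p q, s => if s.reg r = 0 then p.ev s else q.ev s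
  | loop _ _, s => s

/-- The running time of a program without loops (on programs with loops the value is
meaningless). -/
def tm : Prog → State → ℕ
  | const _ c, _ => 1 + c.size
  | op o _ x y, s => o.cost (s.reg x) (s.reg y)
  | load _ a i, s => 1 + (s.reg i).size + (s.arr a (s.reg i)).size
  | store _ i r, s => 1 + (s.reg i).size + (s.reg r).size
  | seq p q, s => p.tm s + q.tm (p.ev s)
  | ifz r p q, s => 1 + (s.reg r).size + (if s.reg r = 0 then p.tm s else q.tm s)
  | loop _ _, _ => 0

/-- The registers whose size is under control after the run, if that is true for those in `l`
before. -/
def known : Prog → List ℕ → List ℕ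
  | const r _, l => r :: l
  | op _ r _ _, l => r :: l
  | load r _ _, l => r :: l
  | store _ _ _, l => l
  | seq p q, l => q.known (p.known l)
  | ifz _ p q, l => (p.known l).filter fun r => (q.known l).contains r
  | loop _ _, l => l

/-- The program has no loops, and it only reads registers that are in `l` or that it has written
before. -/
def check : Prog → List ℕ → Bool
  | const _ _, _ => true
  | op _ _ x y, l => l.contains x && l.contains y
  | load _ _ i, l => l.contains i
  | store _ i r, l => l.contains i && l.contains r
  | seq p q, l => p.check l && q.check (p.known l)
  | ifz r p q, l => l.contains r && p.check l && q.check l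
  | loop _ _, _ => false

/-- The run multiplies the largest bit length by at most `2 ^ p.grow` (see `tm_le_aux`): an
arithmetic operation at most doubles it. -/
def grow : Prog → ℕ
  | const _ c => c.size
  | op _ _ _ _ => 1
  | load _ _ _ => 0
  | store _ _ _ => 0
  | seq p q => p.grow + q.grow
  | ifz _ p q => p.grow + q.grow
  | loop _ _ => 0

/-- The number of instructions. -/
def count : Prog → ℕ
  | seq p q => p.count + q.count
  | ifz _ p q => 1 + p.count + q.count
  | _ => 1

/-- All values that the program loads from arrays have at most `h` bits. -/
def loads : Prog → State → ℕ → Prop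
  | const _ _, _, _ => True
  | op _ _ _ _, _, _ => True
  | load _ a i, s, h => s.arr a (s.reg i) < 2 ^ h
  | store _ _ _, _, _ => True
  | seq p q, s, h => p.loads s h ∧ q.loads (p.ev s) h
  | ifz r p q, s, h => if s.reg r = 0 then p.loads s h else q.loads s h
  | loop _ _, _, _ => True

theorem loads_mono {p : Prog} {s : State} {h h' : ℕ} (hh : h ≤ h') (H : p.loads s h) :
    p.loads s h' := by
  induction p generalizing s with
  | load => exact lt_of_lt_of_le H (Nat.pow_le_pow_right (by norm_num) hh)
  | seq p q ihp ihq => exact ⟨ihp H.1, ihq H.2⟩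
  | ifz r p q ihp ihq =>
    simp only [loads] at H ⊢
    split_ifs at H ⊢
    · exact ihp H
    · exact ihq H
  | _ => trivial

/-- Increase all register and array numbers by `K`. -/
def shift (K : ℕ) : Prog → Prog
  | const r c => const (K + r) c
  | op o r x y => op o (K + r) (K + x) (K + y)
  | load r a i => load (K + r) (K + a) (K + i)
  | store a i r => store (K + a) (K + i) (K + r)
  | seq p q => seq (p.shift K) (q.shift K)
  | ifz r p q => ifz (K + r) (p.shift K) (q.shift K)
  | loop r p => loop (K + r) (p.shift K)

theorem writesReg_shift {K k : ℕ} (hk : k < K) (p : Prog) : (p.shift K).writesReg k = false := by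
  induction p with
  | store => rfl
  | seq p q ihp ihq => simp [shift, writesReg, ihp, ihq]
  | ifz r p q ihp ihq => simp [shift, writesReg, ihp, ihq]
  | loop r p ih => simp [shift, writesReg, ih]
  | _ => simp only [shift, writesReg, decide_eq_false_iff_not]; omega

theorem writesArr_shift {K k : ℕ} (hk : k < K) (p : Prog) : (p.shift K).writesArr k = false := by
  induction p with
  | store => simp only [shift, writesArr, decide_eq_false_iff_not]; omega
  | seq p q ihp ihq => simp [shift, writesArr, ihp, ihq]
  | ifz r p q ihp ihq => simp [shift, writesArr, ihp, ihq]
  | loop r p ih => simp [shift, writesArr, ih]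
  | _ => rfl

end Prog

/-- The registers and arrays that `p` does not write are the same in `s` and `s'`. -/
structure Frame (p : Prog) (s s' : State) : Prop where
  reg : ∀ k, p.writesReg k = false → s'.reg k = s.reg k
  arr : ∀ a, p.writesArr a = false → s'.arr a = s.arr a

theorem Frame.refl (p : Prog) (s : State) : Frame p s s := ⟨fun _ _ => rfl, fun _ _ => rfl⟩

theorem Frame.trans {p : Prog} {s s' s'' : State} (h : Frame p s s') (h' : Frame p s' s'') :
    Frame p s s'' :=
  ⟨fun k hk => (h'.reg k hk).trans (h.reg k hk), fun k hk => (h'.arr k hk).trans (h.arr k hk)⟩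

theorem Exec.frame {p : Prog} {s s' : State} {c : ℕ} (h : Exec p s s' c) : Frame p s s' := by
  induction h with
  | const r c s =>
    refine ⟨fun k hk => ?_, fun a _ => rfl⟩
    simp only [Prog.writesReg, decide_eq_false_iff_not] at hk
    simp [State.setReg_reg, hk]
  | op o r x y s =>
    refine ⟨fun k hk => ?_, fun a _ => rfl⟩
    simp only [Prog.writesReg, decide_eq_false_iff_not] at hk
    simp [State.setReg_reg, hk]
  | load r a i s =>
    refine ⟨fun k hk => ?_, fun a _ => rfl⟩
    simp only [Prog.writesReg, decide_eq_false_iff_not] at hk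
    simp [State.setReg_reg, hk]
  | store a i r s =>
    refine ⟨fun k _ => rfl, fun b hb => ?_⟩
    simp only [Prog.writesArr, decide_eq_false_iff_not] at hb
    ext j
    simp [State.setArr_arr, hb]
  | seq _ _ ih1 ih2 =>
    refine ⟨fun k hk => ?_, fun a ha => ?_⟩
    · simp only [Prog.writesReg, Bool.or_eq_false_iff] at hk
      rw [ih2.reg k hk.2, ih1.reg k hk.1]
    · simp only [Prog.writesArr, Bool.or_eq_false_iff] at ha
      rw [ih2.arr a ha.2, ih1.arr a ha.1]
  | ifz_zero _ _ ih =>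
    refine ⟨fun k hk => ?_, fun a ha => ?_⟩
    · simp only [Prog.writesReg, Bool.or_eq_false_iff] at hk
      exact ih.reg k hk.1
    · simp only [Prog.writesArr, Bool.or_eq_false_iff] at ha
      exact ih.arr a ha.1
  | ifz_pos _ _ ih =>
    refine ⟨fun k hk => ?_, fun a ha => ?_⟩
    · simp only [Prog.writesReg, Bool.or_eq_false_iff] at hk
      exact ih.reg k hk.2
    · simp only [Prog.writesArr, Bool.or_eq_false_iff] at ha
      exact ih.arr a ha.2
  | loop_zero _ => exact Frame.refl _ _
  | loop_pos _ _ _ ih1 ih2 =>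
    exact Frame.trans ⟨fun k hk => ih1.reg k hk, fun k hk => ih1.arr k hk⟩ ih2

/-- A run of `p` can be simulated by the shifted program on any state that holds a shifted copy of
the start state. -/
theorem Exec.shift {p : Prog} {s s' : State} {c : ℕ} (h : Exec p s s' c) (K : ℕ) (S : State)
    (hr : ∀ r, S.reg (K + r) = s.reg r) (ha : ∀ a, S.arr (K + a) = s.arr a) :
    ∃ S', Exec (p.shift K) S S' c ∧ (∀ r, S'.reg (K + r) = s'.reg r) ∧
      ∀ a, S'.arr (K + a) = s'.arr a := by
  induction h generalizing S with
  | const r c s =>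
    refine ⟨_, Exec.const _ _ _, fun k => ?_, ha⟩
    simp [State.setReg_reg, hr]
  | op o r x y s =>
    rw [← hr x, ← hr y]
    refine ⟨_, Exec.op _ _ _ _ _, fun k => ?_, ha⟩
    simp [State.setReg_reg, hr]
  | load r a i s =>
    rw [← hr i, ← ha a]
    refine ⟨_, Exec.load _ _ _ _, fun k => ?_, ha⟩
    simp [State.setReg_reg, hr]
  | store a i r s =>
    rw [← hr i, ← hr r]
    refine ⟨_, Exec.store _ _ _ _, hr, fun b => ?_⟩
    ext j
    simp [State.setArr_arr, ha]
  | seq _ _ ih1 ih2 =>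
    obtain ⟨S1, e1, hr1, ha1⟩ := ih1 S hr ha
    obtain ⟨S2, e2, hr2, ha2⟩ := ih2 S1 hr1 ha1
    exact ⟨S2, e1.seq e2, hr2, ha2⟩
  | ifz_zero h0 _ ih =>
    obtain ⟨S1, e1, hr1, ha1⟩ := ih S hr ha
    exact ⟨S1, Exec.ifz_zero (by rw [hr, h0]) e1, hr1, ha1⟩
  | ifz_pos h0 _ ih =>
    obtain ⟨S1, e1, hr1, ha1⟩ := ih S hr ha
    rw [← hr] at h0 ⊢
    exact ⟨S1, Exec.ifz_pos h0 e1, hr1, ha1⟩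
  | loop_zero h0 => exact ⟨S, Exec.loop_zero (by rw [hr, h0]), hr, ha⟩
  | loop_pos h0 _ _ ih1 ih2 =>
    obtain ⟨S1, e1, hr1, ha1⟩ := ih1 S hr ha
    obtain ⟨S2, e2, hr2, ha2⟩ := ih2 S1 hr1 ha1
    rw [← hr] at h0 ⊢
    exact ⟨S2, Exec.loop_pos h0 e1 e2, hr2, ha2⟩

/-- Started in `s`, the program `p` halts within time `c` in a state that satisfies `Q`. -/
def Spec (p : Prog) (s : State) (c : ℕ) (Q : State → Prop) : Prop :=
  ∃ s' c', Exec p s s' c' ∧ c' ≤ c ∧ Q s'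

namespace Spec

variable {p q : Prog} {s : State} {c c' : ℕ} {Q Q' : State → Prop}

/-- The rule of consequence. The registers and arrays that `p` does not write may be used for the
new postcondition. -/
theorem conseq (h : Spec p s c Q) (hc : c ≤ c') (hQ : ∀ s', Frame p s s' → Q s' → Q' s') :
    Spec p s c' Q' := by
  obtain ⟨s', k, e, hk, hs⟩ := h
  exact ⟨s', k, e, hk.trans hc, hQ s' e.frame hs⟩

theorem mono (h : Spec p s c Q) (hc : c ≤ c') : Spec p s c' Q := h.conseq hc fun _ _ => id

theorem seq (h : Spec p s c Q) (h' : ∀ s', Frame p s s' → Q s' → Spec q s' c' Q') :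
    Spec (p ;; q) s (c + c') Q' := by
  obtain ⟨s', k, e, hk, hs⟩ := h
  obtain ⟨s'', k', e', hk', hs'⟩ := h' s' e.frame hs
  exact ⟨s'', _, e.seq e', add_le_add hk hk', hs'⟩

theorem ifz {r : ℕ} (h0 : s.reg r = 0 → Spec p s c Q) (h1 : s.reg r ≠ 0 → Spec q s c Q) :
    Spec (.ifz r p q) s (1 + (s.reg r).size + c) Q := by
  by_cases h : s.reg r = 0
  · obtain ⟨s', k, e, hk, hs⟩ := h0 h
    exact ⟨s', _, Exec.ifz_zero h e, by omega, hs⟩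
  · obtain ⟨s', k, e, hk, hs⟩ := h1 h
    exact ⟨s', _, Exec.ifz_pos h e, by omega, hs⟩

/-- A loop with an invariant `I` that depends on the number `i` of passes so far; the pass number
`i` costs at most `f i`, and there are at most `m` passes. -/
theorem loop {r m : ℕ} (I : ℕ → State → Prop) (f : ℕ → ℕ) (h0 : I 0 s)
    (hm : ∀ i s', Frame p s s' → I i s' → s'.reg r ≠ 0 → i < m)
    (step : ∀ i s', Frame p s s' → I i s' → s'.reg r ≠ 0 → i < m →
      Spec p s' (f i) (I (i + 1)))
    (g : ℕ → ℕ) (hg : ∀ i s', Frame p s s' → I i s' → s'.reg r ≠ 0 → i < m →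
      1 + (s'.reg r).size ≤ g i) :
    Spec (.loop r p) s (1 + ∑ i ∈ Finset.range m, (f i + g i))
      fun s' => s'.reg r = 0 ∧ ∃ i, I i s' := by
  suffices H : ∀ k i s', i + k = m → Frame p s s' → I i s' →
      Spec (.loop r p) s' (1 + ∑ j ∈ Finset.Ico i m, (f j + g j))
        fun s' => s'.reg r = 0 ∧ ∃ i, I i s' by
    have := H m 0 s (by simp) (Frame.refl _ _) h0
    rwa [Finset.range_eq_Ico]
  intro k
  induction k with
  | zero =>
    intro i s' hi hf hI
    by_cases hr : s'.reg r = 0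
    · exact ⟨s', 1, Exec.loop_zero hr, by omega, hr, i, hI⟩
    · exact absurd (hm i s' hf hI hr) (by omega)
  | succ k ih =>
    intro i s' hi hf hI
    by_cases hr : s'.reg r = 0
    · exact ⟨s', 1, Exec.loop_zero hr, by omega, hr, i, hI⟩
    · have him : i < m := by omega
      obtain ⟨s1, c1, e1, hc1, hI1⟩ := step i s' hf hI hr him
      obtain ⟨s2, c2, e2, hc2, hs2⟩ := ih (i + 1) s1 (by omega) (hf.trans e1.frame) hI1
      refine ⟨s2, _, Exec.loop_pos hr e1 e2, ?_, hs2⟩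
      rw [Finset.sum_eq_sum_Ico_succ_bot him]
      have := hg i s' hf hI hr him
      omega

/-- The loop rule with uniform bounds `d` for the body and `g` for the test. -/
theorem loop_const {r m d g : ℕ} (I : ℕ → State → Prop) (h0 : I 0 s)
    (hm : ∀ i s', Frame p s s' → I i s' → s'.reg r ≠ 0 → i < m ∧ 1 + (s'.reg r).size ≤ g)
    (step : ∀ i s', Frame p s s' → I i s' → s'.reg r ≠ 0 → i < m →
      Spec p s' d fun s'' => I (i + 1) s'') :
    Spec (.loop r p) s (1 + m * (d + g)) fun s' => s'.reg r = 0 ∧ ∃ i, I i s' := by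
  have := Spec.loop (p := p) (s := s) (r := r) (m := m) I (fun _ => d) h0
    (fun i s' a b c => (hm i s' a b c).1)
    step
    (fun _ => g) (fun i s' a b c _ => (hm i s' a b c).2)
  simpa using this

/-- A loop that counts the register `r` down to `0`. The register `o` holds the constant `1`. -/
theorem countdown {r o m d h : ℕ} (J : ℕ → State → Prop) (hr : s.reg r = m) (h0 : J m s)
    (ho : s.reg o = 1) (hro : r ≠ o) (how : p.writesReg o = false) (hrw : p.writesReg r = false)
    (hsz : m.size ≤ h)
    (step : ∀ k s' s'', k < m → Frame (.op .sub r r o ;; p) s s' → J (k + 1) s' →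
      s'' = s'.setReg r k → Spec p s'' d (J k)) :
    Spec (.loop r (.op .sub r r o ;; p)) s (1 + m * (d + (3 + 2 * h)))
      fun s' => s'.reg r = 0 ∧ J 0 s' := by
  -- In the pass number `i` the counter is `m - i`.
  have key := Spec.loop_const (p := .op .sub r r o ;; p) (s := s) (r := r) (m := m)
    (d := (2 + h) + d) (g := 1 + h)
    (fun i s' => s'.reg r + i = m ∧ J (s'.reg r) s') ⟨by simp [hr], by rwa [hr]⟩
    (fun i s' _ hI hne => ⟨by omega, by
      have := Nat.size_le_size (show s'.reg r ≤ m by omega)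
      omega⟩)
    (fun i s' hf hI hne him => by
      obtain ⟨hi, hJ⟩ := hI
      have ho' : s'.reg o = 1 := by
        rw [hf.reg o (by simp [Prog.writesReg, how, hro.symm]), ho]
      refine Spec.seq (Q := fun s'' => s'' = s'.setReg r (s'.reg r - 1))
        ⟨_, _, Exec.op _ _ _ _ _, ?_, ?_⟩ ?_
      · have := Nat.size_le_size (show s'.reg r ≤ m by omega)
        simp only [Op.cost, ho', Nat.size_one]
        omega
      · simp [Op.eval, ho']
      · intro s'' hf' hs''
        have h1 : s'.reg r - 1 + 1 = s'.reg r := by omega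
        refine (step (s'.reg r - 1) s' s'' (by omega) hf (by rwa [h1]) hs'').conseq le_rfl ?_
        intro t ht hJt
        have h2 : t.reg r = s'.reg r - 1 := by
          rw [ht.reg r hrw, hs'']; simp [State.setReg_reg]
        exact ⟨by omega, by rwa [h2]⟩)
  refine key.conseq (by ring_nf; rfl) ?_
  rintro s' - ⟨h, i, hi, hJ⟩
  exact ⟨h, by rwa [h] at hJ⟩

end Spec

/-! ### Running time of programs without loops -/

/-- The bound `h · (log h)²` for the cost of an operation on numbers with `h` bits. -/
def mb (h : ℕ) : ℕ := h * h.size ^ 2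

theorem le_mb (h : ℕ) : h ≤ mb h := by
  rcases Nat.eq_zero_or_pos h with rfl | hp
  · simp
  · have : 0 < h.size := Nat.size_pos.2 hp
    exact Nat.le_mul_of_pos_right _ (by positivity)

theorem size_mul_le (x y : ℕ) : (x * y).size ≤ x.size + y.size := by
  rw [Nat.size_le, pow_add]
  have := Nat.lt_size_self x
  have := Nat.lt_size_self y
  nlinarith [Nat.zero_le x, Nat.zero_le y]

theorem size_add_le (x y : ℕ) : (x + y).size ≤ max x.size y.size + 1 := by
  rw [Nat.size_le, pow_succ]
  have h1 := Nat.lt_size_self x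
  have h2 := Nat.lt_size_self y
  have h3 := Nat.pow_le_pow_right (show 0 < 2 by norm_num) (le_max_left x.size y.size)
  have h4 := Nat.pow_le_pow_right (show 0 < 2 by norm_num) (le_max_right x.size y.size)
  omega

theorem Op.size_eval_le (o : Op) {x y h : ℕ} (hh : 1 ≤ h) (hx : x.size ≤ h) (hy : y.size ≤ h) :
    (o.eval x y).size ≤ 2 * h := by
  cases o with
  | add => have := size_add_le x y; simp only [Op.eval]; omega
  | sub => have := Nat.size_le_size (Nat.sub_le x y); simp only [Op.eval]; omega
  | mul => have := size_mul_le x y; simp only [Op.eval]; omega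
  | div => have := Nat.size_le_size (Nat.div_le_self x y); simp only [Op.eval]; omega

theorem mulCost_mono {k k' : ℕ} (h : k ≤ k') : mulCost k ≤ mulCost k' := by
  unfold mulCost
  have h1 := Nat.log_mono_right (b := 2) h
  have h2 := Nat.log_mono_right (b := 2) h1
  gcongr

theorem Op.cost_le (o : Op) {x y h : ℕ} (hx : x.size ≤ h) (hy : y.size ≤ h) :
    o.cost x y ≤ 1 + 2 * h + mulCost (2 * h) := by
  have := mulCost_mono (show x.size + y.size ≤ 2 * h by omega)
  cases o <;> simp only [Op.cost] <;> omega

theorem log_two_lt_size {k : ℕ} (hk : k ≠ 0) : Nat.log 2 k < k.size := by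
  rw [Nat.lt_size]
  exact Nat.pow_log_le_self 2 hk

/-- One instruction on numbers with `h` bits costs `O(mb h)`. -/
theorem unit_le_mb {h : ℕ} (hh : 1 ≤ h) : 1 + 2 * h + mulCost (2 * h) ≤ 20 * mb h := by
  have hs : 1 ≤ h.size := Nat.size_pos.2 hh
  have h1 : Nat.log 2 (2 * h) + 1 ≤ h.size + 1 := by
    have h2 := log_two_lt_size (show 2 * h ≠ 0 by omega)
    have h3 := size_mul_le 2 h
    have : Nat.size 2 = 2 := by decide
    have h4 : Nat.log 2 (2 * h) = Nat.log 2 h + 1 := by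
      rw [mul_comm]; exact Nat.log_mul_base (by norm_num) (by omega)
    have h5 := log_two_lt_size (show h ≠ 0 by omega)
    omega
  have h2 : Nat.log 2 (Nat.log 2 (2 * h)) + 1 ≤ h.size + 1 := by
    have := Nat.log_le_self 2 (Nat.log 2 (2 * h))
    omega
  have h3 : mulCost (2 * h) ≤ 2 * h * (h.size + 1) * (h.size + 1) := by
    unfold mulCost
    gcongr
  have h4 : 2 * h * (h.size + 1) * (h.size + 1) ≤ 2 * h * (2 * h.size) * (2 * h.size) := by
    gcongr <;> omega
  have h5 : h ≤ mb h := le_mb h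
  have h6 : 2 * h * (2 * h.size) * (2 * h.size) = 8 * mb h := by unfold mb; ring
  omega

theorem mb_mul_le {c h : ℕ} (hc : 1 ≤ c) (hh : 1 ≤ h) : mb (c * h) ≤ 4 * c * c.size ^ 2 * mb h := by
  have h1 : 1 ≤ c.size := Nat.size_pos.2 hc
  have h2 : 1 ≤ h.size := Nat.size_pos.2 hh
  have h3 : (c * h).size ≤ 2 * (c.size * h.size) := by
    have := size_mul_le c h
    nlinarith
  unfold mb
  calc c * h * (c * h).size ^ 2 ≤ c * h * (2 * (c.size * h.size)) ^ 2 := by gcongr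
    _ = _ := by ring

namespace Prog

/-- The running time and the growth of the numbers in a program without loops. -/
theorem tm_le_aux (p : Prog) (l : List ℕ) (s : State) (h : ℕ) (hc : p.check l = true) (hh : 1 ≤ h)
    (hl : ∀ r ∈ l, (s.reg r).size ≤ h) (hld : p.loads s h) :
    p.tm s ≤ p.count * (1 + 2 * (2 ^ p.grow * h) + mulCost (2 * (2 ^ p.grow * h))) ∧
      ∀ r ∈ p.known l, ((p.ev s).reg r).size ≤ 2 ^ p.grow * h := by
  induction p generalizing l s h with
  | const r c =>
    have h1 : c.size ≤ 2 ^ c.size * h := by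
      have : c.size < 2 ^ c.size := Nat.lt_two_pow_self
      nlinarith
    have h2 : h ≤ 2 ^ c.size * h := Nat.le_mul_of_pos_left _ (by positivity)
    refine ⟨by simp only [tm, count, grow]; omega, ?_⟩
    intro k hk
    simp only [ev, State.setReg_reg, grow]
    simp only [known, List.mem_cons] at hk
    split_ifs with hkr
    · exact h1
    · exact (hl k (by tauto)).trans h2
  | op o r x y =>
    simp only [check, Bool.and_eq_true, List.contains_iff_mem] at hc
    have hx := hl x hc.1
    have hy := hl y hc.2
    refine ⟨?_, ?_⟩
    · simp only [tm, count, grow, one_mul]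
      exact o.cost_le (by omega) (by omega)
    · intro k hk
      simp only [ev, State.setReg_reg, grow]
      simp only [known, List.mem_cons] at hk
      split_ifs with hkr
      · simpa using o.size_eval_le hh hx hy
      · have := hl k (by tauto)
        omega
  | load r a i =>
    simp only [check, List.contains_iff_mem] at hc
    simp only [loads, ← Nat.size_le] at hld
    have hi := hl i hc
    refine ⟨by simp only [tm, count, grow]; omega, ?_⟩
    intro k hk
    simp only [ev, State.setReg_reg, grow]
    simp only [known, List.mem_cons] at hk
    split_ifs with hkr
    · simpa using hld
    · simpa using hl k (by tauto)
  | store a i r =>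
    simp only [check, Bool.and_eq_true, List.contains_iff_mem] at hc
    have hi := hl i hc.1
    have hr := hl r hc.2
    refine ⟨by simp only [tm, count, grow]; omega, ?_⟩
    intro k hk
    simpa [ev, State.setArr_reg, grow] using hl k hk
  | seq p q ihp ihq =>
    simp only [check, Bool.and_eq_true] at hc
    simp only [loads] at hld
    obtain ⟨h1, h2⟩ := ihp l s h hc.1 hh hl hld.1
    have hp : h ≤ 2 ^ p.grow * h := Nat.le_mul_of_pos_left _ (by positivity)
    obtain ⟨h3, h4⟩ := ihq (p.known l) (p.ev s) (2 ^ p.grow * h) hc.2 (hh.trans hp) h2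
      (loads_mono hp hld.2)
    have e : 2 ^ q.grow * (2 ^ p.grow * h) = 2 ^ (p.grow + q.grow) * h := by ring
    rw [e] at h3 h4
    refine ⟨?_, h4⟩
    simp only [tm, count, grow]
    have h5 : 2 ^ p.grow * h ≤ 2 ^ (p.grow + q.grow) * h := by
      gcongr
      · norm_num
      · omega
    have h6 := mulCost_mono (show 2 * (2 ^ p.grow * h) ≤ 2 * (2 ^ (p.grow + q.grow) * h) by omega)
    rw [add_mul]
    refine add_le_add (h1.trans ?_) h3
    gcongr
  | ifz r p q ihp ihq =>
    simp only [check, Bool.and_eq_true, List.contains_iff_mem] at hc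
    obtain ⟨⟨hr, hcp⟩, hcq⟩ := hc
    have hr := hl r hr
    have hp : 2 ^ p.grow * h ≤ 2 ^ (p.grow + q.grow) * h := by gcongr <;> omega
    have hq : 2 ^ q.grow * h ≤ 2 ^ (p.grow + q.grow) * h := by gcongr <;> omega
    have hp0 : h ≤ 2 ^ p.grow * h := Nat.le_mul_of_pos_left _ (by positivity)
    have hp1 := mulCost_mono (show 2 * (2 ^ p.grow * h) ≤ 2 * (2 ^ (p.grow + q.grow) * h) by omega)
    have hq1 := mulCost_mono (show 2 * (2 ^ q.grow * h) ≤ 2 * (2 ^ (p.grow + q.grow) * h) by omega)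
    set u := 1 + 2 * (2 ^ (p.grow + q.grow) * h) + mulCost (2 * (2 ^ (p.grow + q.grow) * h)) with hu
    simp only [loads] at hld
    simp only [tm, count, grow, ev, known]
    rw [← hu]
    have h0 : 1 + (s.reg r).size ≤ u := by omega
    by_cases hz : s.reg r = 0
    · simp only [hz, if_true] at hld ⊢
      obtain ⟨h1, h2⟩ := ihp l s h hcp hh hl hld
      refine ⟨?_, fun k hk => (h2 k (List.mem_filter.1 hk).1).trans hp⟩
      have h3 : p.count * (1 + 2 * (2 ^ p.grow * h) + mulCost (2 * (2 ^ p.grow * h)))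
          ≤ p.count * u := by gcongr; omega
      rw [hz] at h0
      have : (1 + p.count + q.count) * u = u + p.count * u + q.count * u := by ring
      have := Nat.zero_le (q.count * u)
      omega
    · simp only [hz, if_false] at hld ⊢
      obtain ⟨h1, h2⟩ := ihq l s h hcq hh hl hld
      refine ⟨?_, fun k hk => (h2 k ?_).trans hq⟩
      · have h3 : q.count * (1 + 2 * (2 ^ q.grow * h) + mulCost (2 * (2 ^ q.grow * h)))
          ≤ q.count * u := by gcongr; omega
        have : (1 + p.count + q.count) * u = u + p.count * u + q.count * u := by ring
        have := Nat.zero_le (p.count * u)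
        omega
      · simpa using (List.mem_filter.1 hk).2
  | loop => simp [check] at hc

theorem exec_ev (p : Prog) (l : List ℕ) (s : State) (hc : p.check l = true) :
    Exec p s (p.ev s) (p.tm s) := by
  induction p generalizing l s with
  | const r c => exact Exec.const _ _ _
  | op o r x y => exact Exec.op _ _ _ _ _
  | load r a i => exact Exec.load _ _ _ _
  | store a i r => exact Exec.store _ _ _ _
  | seq p q ihp ihq =>
    simp only [check, Bool.and_eq_true] at hc
    exact (ihp l s hc.1).seq (ihq _ _ hc.2)
  | ifz r p q ihp ihq =>
    simp only [check, Bool.and_eq_true] at hc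
    simp only [tm, ev]
    by_cases hz : s.reg r = 0
    · simp only [hz, if_true, Nat.size_zero]
      exact Exec.ifz_zero hz (ihp l s hc.1.2)
    · simp only [hz, if_false]
      exact Exec.ifz_pos hz (ihq l s hc.2)
  | loop => simp [check] at hc

/-- The factor in the bound `p.kst * mb h` for the running time of a program `p` without loops on
numbers with `h` bits. It only depends on the text of `p`. -/
def kst (p : Prog) : ℕ := p.count * (20 * (4 * 2 ^ p.grow * (2 ^ p.grow).size ^ 2))

theorem tm_le (p : Prog) (l : List ℕ) (s : State) (h : ℕ) (hc : p.check l = true) (hh : 1 ≤ h)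
    (hl : ∀ r ∈ l, (s.reg r).size ≤ h) (hld : p.loads s h) : p.tm s ≤ p.kst * mb h := by
  refine (tm_le_aux p l s h hc hh hl hld).1.trans ?_
  have h1 : 1 ≤ 2 ^ p.grow := Nat.one_le_two_pow
  have h2 : 1 ≤ 2 ^ p.grow * h := Nat.one_le_iff_ne_zero.2 (by positivity)
  calc _ ≤ p.count * (20 * mb (2 ^ p.grow * h)) := by gcongr; exact unit_le_mb h2
    _ ≤ p.count * (20 * (4 * 2 ^ p.grow * (2 ^ p.grow).size ^ 2 * mb h)) := by
      gcongr; exact mb_mul_le h1 hh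
    _ = _ := by unfold kst; ring

end Prog

/-- The rule for a program without loops. Only the sizes of the registers in `l` and of the loaded
values have to be known. -/
theorem Spec.line {p : Prog} {s : State} {Q : State → Prop} (l : List ℕ) (h : ℕ)
    (hc : p.check l = true) (hh : 1 ≤ h) (hl : ∀ r ∈ l, s.reg r < 2 ^ h) (hld : p.loads s h)
    (hQ : Q (p.ev s)) : Spec p s (p.kst * mb h) Q :=
  ⟨_, _, p.exec_ev l s hc, p.tm_le l s h hc hh (fun r hr => Nat.size_le.2 (hl r hr)) hld, hQ⟩

namespace Spec

variable {p q : Prog} {s : State} {A A' H : ℕ} {Q Q' : State → Prop}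

theorem seqH (h : Spec p s (A * mb H) Q)
    (h' : ∀ s', Frame p s s' → Q s' → Spec q s' (A' * mb H) Q') :
    Spec (p ;; q) s ((A + A') * mb H) Q' := by
  rw [add_mul]
  exact h.seq h'

theorem ifzH {r : ℕ} (hH : 1 ≤ H) (hr : s.reg r < 2 ^ H)
    (h0 : s.reg r = 0 → Spec p s (A * mb H) Q)
    (h1 : s.reg r ≠ 0 → Spec q s (A' * mb H) Q) :
    Spec (.ifz r p q) s ((2 + A + A') * mb H) Q := by
  refine (Spec.ifz (fun h => (h0 h).mono (Nat.le_add_right _ (A' * mb H)))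
    (fun h => (h1 h).mono (Nat.le_add_left _ (A * mb H)))).mono ?_
  have h2 := Nat.size_le.2 hr
  have h3 := le_mb H
  nlinarith

end Spec

/-- Run `p` with the register `r` going down from (the content of) `src` minus one to zero. The
registers `2` and `15` must hold the constants `1` and `0`. -/
def Prog.forDown (r src : ℕ) (p : Prog) : Prog :=
  .op .add r src 15 ;; .loop r (.op .sub r r 2 ;; p)

/-- The rule for a counting loop: `J k` holds before the pass in which the counter drops to
`k - 1`. -/
theorem Spec.forDown {p : Prog} {s : State} {A H r src m : ℕ} (J : ℕ → State → Prop)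
    (hm : s.reg src = m) (h15 : s.reg 15 = 0) (h2 : s.reg 2 = 1) (hr2 : r ≠ 2)
    (hw2 : p.writesReg 2 = false) (hwr : p.writesReg r = false) (hH : 1 ≤ H) (hsz : m < 2 ^ H)
    (h0 : J m (s.setReg r m))
    (step : ∀ k s' s'', k < m → Frame (Prog.forDown r src p) s s' → J (k + 1) s' →
      s'' = s'.setReg r k → Spec p s'' (A * mb H) (J k)) :
    Spec (Prog.forDown r src p) s ((m + 1) * ((A + 11) * mb H))
      fun s' => s'.reg r = 0 ∧ J 0 s' := by
  have hf0 : Frame (Prog.forDown r src p) s (s.setReg r m) := by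
    refine ⟨fun k hk => ?_, fun _ _ => rfl⟩
    simp only [Prog.forDown, Prog.writesReg, Bool.or_eq_false_iff, decide_eq_false_iff_not] at hk
    simp [State.setReg_reg, hk.1]
  refine Spec.mono (Spec.seq (Q := fun s' => s' = s.setReg r m)
    ⟨_, _, Exec.op _ _ _ _ _,
      by simp [Op.cost, hm, h15], by simp [Op.eval, hm, h15]⟩ ?_)
    (c := (1 + m.size + 0) + (1 + m * (A * mb H + (3 + 2 * H)))) ?_
  · rintro s1 hf1 rfl
    refine Spec.countdown (o := 2) (h := H) J (by simp [State.setReg_reg]) h0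
      (by simp [State.setReg_reg, h2, hr2.symm]) hr2 hw2 hwr (Nat.size_le.2 hsz) ?_
    intro k s' s'' hk hf hJ hs''
    refine step k s' s'' hk (hf0.trans ⟨fun j hj => hf.reg j ?_, fun j hj => hf.arr j ?_⟩) hJ hs''
    · simp only [Prog.forDown, Prog.writesReg, Bool.or_eq_false_iff] at hj ⊢
      exact hj.2
    · simp only [Prog.forDown, Prog.writesArr, Bool.or_eq_false_iff] at hj ⊢
      exact hj.2
  · have h1 := Nat.size_le.2 hsz
    have h3 := le_mb H
    have h4 : m * (A * mb H + (3 + 2 * H)) ≤ m * ((A + 11) * mb H) := by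
      gcongr
      nlinarith
    nlinarith [Nat.zero_le (A * mb H)]

theorem State.ite_reg (c : Prop) [Decidable c] (s s' : State) (k : ℕ) :
    (if c then s else s').reg k = if c then s.reg k else s'.reg k := by
  split_ifs <;> rfl

theorem State.ite_arr (c : Prop) [Decidable c] (s s' : State) (a i : ℕ) :
    (if c then s else s').arr a i = if c then s.arr a i else s'.arr a i := by
  split_ifs <;> rfl

attribute [simp] State.setReg_reg State.setReg_arr State.setArr_reg State.setArr_arr State.ite_reg
  State.ite_arr Prog.ev Prog.loads Op.eval

/-! ### Paths and the minimum cycle mean -/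

namespace WGraph

variable {n : ℕ} {G : WGraph n}

theorem Path.append {x y z : Fin n} {k l v w : ℕ} (p : G.Path x y k v) (q : G.Path y z l w) :
    G.Path x z (k + l) (v + w) := by
  induction p with
  | nil => simpa using q
  | @cons x y z a k b h p ih =>
    have := Path.cons h (ih q)
    rw [show k + 1 + l = k + l + 1 by ring, add_assoc a]
    exact this

theorem le_maxWeight {x y : Fin n} {a : ℕ} (h : G.wt x y = some a) : a ≤ G.maxWeight := by
  have := Finset.le_sup (f := fun p : Fin n × Fin n => (G.wt p.1 p.2).getD 0)
    (Finset.mem_univ (x, y))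
  simpa [h, maxWeight] using this

theorem Path.weight_le {x y : Fin n} {k w : ℕ} (p : G.Path x y k w) : w ≤ k * G.maxWeight := by
  induction p with
  | nil => simp
  | cons h p ih =>
    have := le_maxWeight h
    rw [add_mul]
    omega

theorem exists_path (G : WGraph n) (x : Fin n) (k : ℕ) : ∃ y w, G.Path x y k w := by
  induction k generalizing x with
  | zero => exact ⟨x, 0, .nil x⟩
  | succ k ih =>
    obtain ⟨y, a, h⟩ := G.exists_out x
    obtain ⟨z, w, p⟩ := ih y
    exact ⟨z, _, .cons h p⟩

/-- The list of the vertices and of the edge weights of a path; `path_of_fun` is the converse. -/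
theorem Path.exists_fun {x z : Fin n} {t w : ℕ} (p : G.Path x z t w) :
    ∃ (v : ℕ → Fin n) (c : ℕ → ℕ), v 0 = x ∧ v t = z ∧ w = ∑ i ∈ Finset.range t, c i ∧
      ∀ i < t, G.wt (v i) (v (i + 1)) = some (c i) := by
  induction p with
  | nil x => exact ⟨fun _ => x, fun _ => 0, rfl, rfl, by simp, by simp⟩
  | @cons x y z a k b h p ih =>
    obtain ⟨v, c, h0, h1, h2, h3⟩ := ih
    refine ⟨fun i => i.casesOn x v, fun i => i.casesOn a c, rfl, h1, ?_, ?_⟩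
    · rw [Finset.sum_range_succ', h2, add_comm]
      rfl
    · intro i hi
      cases i with
      | zero => simpa [h0] using h
      | succ i => exact h3 i (by omega)

theorem path_of_fun {v : ℕ → Fin n} {c : ℕ → ℕ} {t : ℕ}
    (h : ∀ i < t, G.wt (v i) (v (i + 1)) = some (c i)) (i k : ℕ) (hk : i + k ≤ t) :
    G.Path (v i) (v (i + k)) k (∑ j ∈ Finset.range k, c (i + j)) := by
  induction k generalizing i with
  | zero => exact .nil _
  | succ k ih =>
    have := Path.cons (h i (by omega)) (ih (i + 1) (by omega))
    rw [Finset.sum_range_succ', add_comm]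
    simpa [add_assoc, add_comm, add_left_comm] using this

theorem Path.split {x z : Fin n} {k l w : ℕ} (p : G.Path x z (k + l) w) :
    ∃ y a b, G.Path x y k a ∧ G.Path y z l b ∧ w = a + b := by
  obtain ⟨v, c, rfl, rfl, rfl, h⟩ := p.exists_fun
  refine ⟨v k, _, _, ?_, path_of_fun h k l le_rfl, Finset.sum_range_add _ _ _⟩
  simpa using path_of_fun h 0 k (by omega)

/-- By the pigeonhole principle, a path with at least `n` edges contains a cycle with at most `n`
edges. -/
theorem Path.cut {x z : Fin n} {t w : ℕ} (p : G.Path x z t w) (ht : n ≤ t) :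
    ∃ y l₁ w₁ k wk l₂ w₂, G.Path x y l₁ w₁ ∧ G.Path y y k wk ∧ G.Path y z l₂ w₂ ∧ 0 < k ∧
      k ≤ n ∧ l₁ + k + l₂ = t ∧ w₁ + wk + w₂ = w := by
  obtain ⟨v, c, rfl, rfl, rfl, h⟩ := p.exists_fun
  obtain ⟨i, j, hij, hv⟩ := Fintype.exists_ne_map_eq_of_card_lt
    (fun i : Fin (n + 1) => v i) (by simp)
  wlog hlt : i < j generalizing i j
  · exact this j i hij.symm hv.symm (lt_of_le_of_ne (not_lt.1 hlt) hij.symm)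
  have hi := i.2
  have hj := j.2
  have hlt' : (i : ℕ) < j := hlt
  have h1 := path_of_fun h 0 i (by omega)
  have h2 := path_of_fun h i (j - i) (by omega)
  have h3 := path_of_fun h j (t - j) (by omega)
  simp only [zero_add] at h1
  rw [show (i : ℕ) + (j - i) = j by omega, ← hv] at h2
  rw [show (j : ℕ) + (t - j) = t by omega, ← hv] at h3
  refine ⟨_, _, _, _, _, _, _, h1, h2, h3, by omega, by omega, by omega, ?_⟩
  have e1 : (i : ℕ) + (j - i) = j := by omega
  have e2 : (j : ℕ) + (t - j) = t := by omega
  rw [← Finset.sum_range_add, e1, ← Finset.sum_range_add, e2]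

theorem Path.exists_short {x y : Fin n} {l v : ℕ} (p : G.Path x y l v) :
    ∃ l' v', l' ≤ n ∧ G.Path x y l' v' := by
  induction l using Nat.strong_induction_on generalizing v with
  | _ l ih =>
    by_cases hl : l ≤ n
    · exact ⟨l, v, hl, p⟩
    · obtain ⟨y', l₁, w₁, k, wk, l₂, w₂, h1, -, h3, hk, -, hl', -⟩ := p.cut (by omega)
      exact ih (l₁ + l₂) (by omega) (h1.append h3)

/-- From a cycle one can reach a cycle with at most `n` edges and no larger mean weight. -/
theorem Path.exists_short_cycle {y : Fin n} {k w : ℕ} (p : G.Path y y k w) (hk : 0 < k) :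
    ∃ z l v k' w', G.Path y z l v ∧ G.Path z z k' w' ∧ 0 < k' ∧ k' ≤ n ∧ w' * k ≤ w * k' := by
  induction k using Nat.strong_induction_on generalizing w with
  | _ k ih =>
    by_cases hkn : k ≤ n
    · exact ⟨y, 0, 0, k, w, .nil y, p, hk, hkn, le_rfl⟩
    · obtain ⟨z, l₁, w₁, kc, wc, l₂, w₂, h1, h2, h3, hkc, hkcn, hl, hw⟩ := p.cut (by omega)
      -- Either the short cycle is at least as good, or removing it improves the mean weight.
      by_cases hc : wc * k ≤ w * kc
      · exact ⟨z, l₁, w₁, kc, wc, h1, h2, hkc, hkcn, hc⟩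
      · obtain ⟨z', l, v, k', w', h4, h5, h6, h7, h8⟩ :=
          ih (l₁ + l₂) (by omega) (h1.append h3) (by omega)
        refine ⟨z', l, v, k', w', h4, h5, h6, h7, ?_⟩
        push Not at hc
        have hr : (w₁ + w₂) * k ≤ w * (l₁ + l₂) := by nlinarith
        have h9 : (w' * k) * (l₁ + l₂) ≤ (w * k') * (l₁ + l₂) := by
          calc (w' * k) * (l₁ + l₂) = (w' * (l₁ + l₂)) * k := by ring
            _ ≤ ((w₁ + w₂) * k') * k := by gcongr
            _ = ((w₁ + w₂) * k) * k' := by ring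
            _ ≤ (w * (l₁ + l₂)) * k' := by gcongr
            _ = _ := by ring
        exact Nat.le_of_mul_le_mul_right h9 (by omega)

theorem Path.repeat {y : Fin n} {k w : ℕ} (p : G.Path y y k w) (a : ℕ) :
    G.Path y y (a * k) (a * w) := by
  induction a with
  | zero => simpa using Path.nil y
  | succ a ih =>
    rw [add_mul, add_mul, one_mul, one_mul]
    exact ih.append p

/-- Going to a cycle with mean weight `w / k` and then around it gives light paths of every
length. -/
theorem exists_light_path {x y : Fin n} {l v k w : ℕ} (p : G.Path x y l v) (c : G.Path y y k w)
    (hk : 0 < k) (t : ℕ) :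
    ∃ z w', G.Path x z t w' ∧ w' * k ≤ t * w + 2 * n * G.maxWeight * k := by
  obtain ⟨z, l₁, v₁, k', w', h1, h2, h3, h4, h5⟩ := c.exists_short_cycle hk
  obtain ⟨l₂, v₂, h6, h7⟩ := (p.append h1).exists_short
  set M := G.maxWeight
  by_cases htl : t ≤ l₂
  · obtain ⟨u, w₀, q⟩ := G.exists_path x t
    refine ⟨u, w₀, q, ?_⟩
    have h8 : w₀ ≤ n * M := q.weight_le.trans (Nat.mul_le_mul_right _ (htl.trans h6))
    have := Nat.mul_le_mul_right k h8
    nlinarith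
  · -- Go to the cycle, around it `a` times, and `r` edges further.
    set a := (t - l₂) / k'
    set r := (t - l₂) % k'
    have har : l₂ + a * k' + r = t := by
      have := Nat.div_add_mod (t - l₂) k'
      have : k' * a + r = t - l₂ := this
      rw [mul_comm a]
      omega
    have hr : r < k' := Nat.mod_lt _ h3
    obtain ⟨u, w₀, q⟩ := G.exists_path z r
    refine ⟨u, v₂ + a * w' + w₀, har ▸ (h7.append (h2.repeat a)).append q, ?_⟩
    have h8 : v₂ ≤ n * M := h7.weight_le.trans (Nat.mul_le_mul_right _ h6)
    have h9 : w₀ ≤ n * M := q.weight_le.trans (Nat.mul_le_mul_right _ (by omega))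
    have h10 : a * w' * k ≤ t * w := by
      calc a * w' * k = a * (w' * k) := by ring
        _ ≤ a * (w * k') := by gcongr
        _ = (a * k') * w := by ring
        _ ≤ t * w := by gcongr; omega
    have := Nat.mul_le_mul_right k (Nat.add_le_add h8 h9)
    nlinarith

theorem mu_nonneg (G : WGraph n) (x : Fin n) : 0 ≤ G.mu x := by
  refine Real.sInf_nonneg ?_
  rintro q ⟨y, l, v, k, w, -, -, -, rfl⟩
  positivity

theorem cycleMeans_bddBelow (G : WGraph n) (x : Fin n) : BddBelow (G.cycleMeans x) := by
  refine ⟨0, ?_⟩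
  rintro q ⟨y, l, v, k, w, -, -, -, rfl⟩
  positivity

theorem cycleMeans_nonempty (G : WGraph n) (x : Fin n) : (G.cycleMeans x).Nonempty := by
  obtain ⟨y, w, p⟩ := G.exists_path x n
  obtain ⟨z, l₁, w₁, k, wk, l₂, w₂, h1, h2, -, hk, -⟩ := p.cut le_rfl
  exact ⟨_, z, l₁, w₁, k, wk, h1, hk, h2, rfl⟩

theorem mu_mul_le {x y : Fin n} {l v k w : ℕ} (p : G.Path x y l v) (c : G.Path y y k w)
    (hk : 0 < k) : k * G.mu x ≤ w := by
  have h := csInf_le (G.cycleMeans_bddBelow x) ⟨y, l, v, k, w, p, hk, c, rfl⟩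
  have hk' : (0 : ℝ) < k := by exact_mod_cast hk
  rw [le_div_iff₀ hk'] at h
  rw [mul_comm]
  exact h

/-- A path with `t` edges splits into cycles and at most `n` further edges, and the mean weight of
each of the cycles is at least `μ(x)`. -/
theorem Path.mu_le {x y : Fin n} {t w : ℕ} (p : G.Path x y t w) :
    ((t : ℝ) - n) * G.mu x ≤ w := by
  induction t using Nat.strong_induction_on generalizing w with
  | _ t ih =>
    by_cases ht : t < n
    · have h1 : ((t : ℝ) - n) ≤ 0 := by
        have : (t : ℝ) < n := by exact_mod_cast ht
        linarith
      exact (mul_nonpos_of_nonpos_of_nonneg h1 (G.mu_nonneg x)).trans (by positivity)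
    · obtain ⟨z, l₁, w₁, k, wk, l₂, w₂, h1, h2, h3, hk, -, hl, hw⟩ := p.cut (by omega)
      have h4 := ih (l₁ + l₂) (by omega) (h1.append h3)
      have h5 := mu_mul_le h1 h2 hk
      rw [← hl, ← hw]
      push_cast at h4 ⊢
      linarith

/-- If `m` is at most `f` times the weight of every path with `t` edges from `x`, then it is at most
`f` times the weight of a path that goes around a best cycle. -/
theorem le_of_forall_path {x : Fin n} {t : ℕ} {m f : ℝ} (ht : 0 < t) (hf : 0 < f)
    (h : ∀ y w, G.Path x y t w → m ≤ f * w) :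
    m ≤ f * (t * G.mu x + 2 * n * G.maxWeight) := by
  have ht' : (0 : ℝ) < t := by exact_mod_cast ht
  suffices H : (m / f - 2 * n * G.maxWeight) / t ≤ G.mu x by
    rw [div_le_iff₀ ht', sub_le_iff_le_add, div_le_iff₀ hf] at H
    linarith
  refine le_csInf (G.cycleMeans_nonempty x) ?_
  rintro q ⟨y, l, v, k, w, p, hk, c, rfl⟩
  obtain ⟨z, w', p', hw'⟩ := exists_light_path p c hk t
  have hk' : (0 : ℝ) < k := by exact_mod_cast hk
  have h1 : (w' : ℝ) * k ≤ t * w + 2 * n * G.maxWeight * k := by exact_mod_cast hw'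
  have h2 : m / f ≤ w' := by
    rw [div_le_iff₀ hf, mul_comm]
    exact h z w' p'
  rw [div_le_div_iff₀ ht' hk']
  nlinarith

/-- A cycle with positive weight that is no longer than `n` has mean weight at least `1 / n`. -/
theorem mu_eq_zero_or (G : WGraph n) (x : Fin n) : G.mu x = 0 ∨ 1 ≤ n * G.mu x := by
  by_cases h0 : G.mu x = 0
  · exact Or.inl h0
  · right
    have hpos : 0 < G.mu x := lt_of_le_of_ne (G.mu_nonneg x) (Ne.symm h0)
    have hn : (0 : ℝ) < n := by exact_mod_cast x.pos
    suffices H : (1 : ℝ) / n ≤ G.mu x by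
      rw [div_le_iff₀ hn] at H
      linarith
    refine le_csInf (G.cycleMeans_nonempty x) ?_
    rintro q ⟨y, l, v, k, w, p, hk, c, rfl⟩
    obtain ⟨z, l₁, v₁, k', w', h1, h2, h3, h4, h5⟩ := c.exists_short_cycle hk
    have h6 := mu_mul_le (p.append h1) h2 h3
    have h7 : 1 ≤ w' := by
      by_contra hw
      have : w' = 0 := by omega
      subst this
      have : (0 : ℝ) < k' * G.mu x := mul_pos (by exact_mod_cast h3) hpos
      push_cast at h6
      linarith
    have hk' : (0 : ℝ) < k := by exact_mod_cast hk
    rw [div_le_div_iff₀ hn hk', one_mul]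
    have : 1 * k ≤ w * n := by
      calc 1 * k ≤ w' * k := by gcongr
        _ ≤ w * k' := h5
        _ ≤ w * n := by gcongr
    rw [one_mul] at this
    exact_mod_cast this

/-- Approximating the lightest path with `t` edges within a factor of `1 + δ / 4` yields an
approximation of the minimum cycle mean within a factor of `1 + δ`, if `t` is large enough. If the
lightest path is so light that it cannot consist of cycles of positive weight, the minimum cycle
mean is `0`. -/
theorem mu_approx {x : Fin n} {t m U : ℕ} {f δ : ℝ} (hδ : 0 < δ) (hδ' : δ ≤ 1)
    (hf : f ≤ 1 + δ / 4) (hf0 : 0 < f) (hU : G.maxWeight + 1 ≤ U)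
    (ht : 64 * n ^ 2 * U ≤ t * δ) (hm : ∃ y w, G.Path x y t w ∧ w ≤ m)
    (hm' : ∀ y w, G.Path x y t w → (m : ℝ) ≤ f * w) :
    G.mu x ≤ ((if m ≤ 4 * n * U then 0 else m : ℕ) : ℝ) / ((t - n : ℕ) : ℝ) ∧
    ((if m ≤ 4 * n * U then 0 else m : ℕ) : ℝ) / ((t - n : ℕ) : ℝ) ≤ (1 + δ) * G.mu x := by
  have hn1 : 1 ≤ n := x.pos
  have hn : (1 : ℝ) ≤ n := by exact_mod_cast hn1
  have hU1 : (G.maxWeight : ℝ) + 1 ≤ U := by exact_mod_cast hU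
  have hW : (0 : ℝ) ≤ G.maxWeight := by positivity
  have hnn : (n : ℝ) ≤ (n : ℝ) ^ 2 := by nlinarith
  have hnU : (n : ℝ) ^ 2 ≤ (n : ℝ) ^ 2 * U := by nlinarith [sq_nonneg (n : ℝ)]
  have hnW : (n : ℝ) ^ 2 * G.maxWeight ≤ (n : ℝ) ^ 2 * U := by gcongr; linarith
  have ht0 : (0 : ℝ) ≤ t := by positivity
  have htd : (t : ℝ) * δ ≤ t := by nlinarith
  have ht1 : 64 * (n : ℝ) ≤ t := by linarith
  have hnt : n < t := by
    have : (n : ℝ) < t := by linarith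
    exact_mod_cast this
  have hcast : ((t - n : ℕ) : ℝ) = t - n := by push_cast [hnt.le]; ring
  rw [hcast]
  have htn : (0 : ℝ) < (t : ℝ) - n := by linarith
  obtain ⟨y, w, p, hw⟩ := hm
  have hlow : ((t : ℝ) - n) * G.mu x ≤ m := p.mu_le.trans (by exact_mod_cast hw)
  have hup := le_of_forall_path (by omega) hf0 hm'
  have hmu := G.mu_nonneg x
  -- If `μ(x) = 0`, then `m ≤ 4nU`; otherwise `μ(x) ≥ 1 / n` and `m` is larger than that.
  rcases G.mu_eq_zero_or x with h0 | h1
  · rw [h0] at hup ⊢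
    have : (m : ℝ) ≤ 4 * n * U := by
      have h2 : f * (2 * n * G.maxWeight) ≤ 2 * (2 * n * G.maxWeight) := by
        gcongr
        linarith
      have h3 : (n : ℝ) * G.maxWeight ≤ n * U := by gcongr; linarith
      simp only [mul_zero, zero_add] at hup
      linarith
    have : m ≤ 4 * n * U := by exact_mod_cast this
    simp [this]
  · have hnot : ¬ m ≤ 4 * n * U := by
      intro hle
      have hle' : (m : ℝ) ≤ 4 * n * U := by exact_mod_cast hle
      have h2 : ((t : ℝ) - n) ≤ n * m := by nlinarith
      have h3 : (n : ℝ) * m ≤ 4 * (n ^ 2 * U) := by nlinarith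
      nlinarith
    rw [if_neg hnot]
    refine ⟨?_, ?_⟩
    · rw [le_div_iff₀ htn]
      linarith
    · rw [div_le_iff₀ htn]
      have h2 : 2 * n * (G.maxWeight : ℝ) ≤ 2 * (n ^ 2 * U) * G.mu x := by
        calc 2 * n * (G.maxWeight : ℝ) ≤ 2 * n * (G.maxWeight : ℝ) * (n * G.mu x) :=
              le_mul_of_one_le_right (by positivity) h1
          _ = 2 * (n ^ 2 * G.maxWeight) * G.mu x := by ring
          _ ≤ _ := by gcongr
      have h3 : 2 * n * (G.maxWeight : ℝ) ≤ t * δ / 32 * G.mu x := by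
        refine h2.trans ?_
        gcongr
        linarith
      have h4 : (m : ℝ) ≤ (1 + δ / 4) * (t * (1 + δ / 32) * G.mu x) := by
        refine hup.trans ?_
        gcongr
        linarith
      have h5 : (1 + δ / 4) * (t * (1 + δ / 32)) ≤ (1 + δ) * (t - n) := by
        have h6 : (1 + δ) * n ≤ (1 + δ) * (t * δ / 64) := by gcongr; linarith
        nlinarith [mul_nonneg ht0 hδ.le, mul_nonneg (mul_nonneg ht0 hδ.le) (sub_nonneg.2 hδ')]
      calc (m : ℝ) ≤ (1 + δ / 4) * (t * (1 + δ / 32) * G.mu x) := h4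
        _ = ((1 + δ / 4) * (t * (1 + δ / 32))) * G.mu x := by ring
        _ ≤ ((1 + δ) * (t - n)) * G.mu x := by gcongr
        _ = _ := by ring

end WGraph

/-! ### Straight-line programs modulo a number -/

theorem runGates_append {R : Type*} [Ring R] (gs : List Gate) (g : Gate) (m : ℕ) (v : ℕ → R) :
    runGates m (gs ++ [g]) v =
      Function.update (runGates m gs v) (m + gs.length) (g.eval (runGates m gs v)) := by
  induction gs generalizing m v with
  | nil => rfl
  | cons g' gs ih =>
    simp only [List.cons_append, runGates, List.length_cons]
    rw [ih, show m + 1 + gs.length = m + (gs.length + 1) by ring]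

theorem runGates_of_lt {R : Type*} [Ring R] (gs : List Gate) {m k : ℕ} (hk : k < m) (v : ℕ → R) :
    runGates m gs v k = v k := by
  induction gs generalizing m v with
  | nil => rfl
  | cons g gs ih =>
    rw [runGates, ih (by omega), Function.update_of_ne (by omega)]

theorem WellFormed.usesBelow {gs : List Gate} {m k : ℕ} {g : Gate} (h : WellFormed m gs)
    (hg : gs[k]? = some g) : g.UsesBelow (m + k) := by
  induction gs generalizing m k with
  | nil => simp at hg
  | cons g' gs ih =>
    cases k with
    | zero => simp only [List.getElem?_cons_zero, Option.some.injEq] at hg; exact hg ▸ h.1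
    | succ k =>
      have := ih h.2 (by simpa using hg)
      rwa [show m + 1 + k = m + (k + 1) by ring] at this

/-- The value of a gate on numbers below `N`, with the result reduced modulo `N`. -/
def Gate.evalMod (N : ℕ) (V : ℕ → ℕ) : Gate → ℕ
  | one => 1 % N
  | add i j => (V i + V j) % N
  | sub i j => (V i + (N - V j)) % N
  | mul i j => V i * V j % N

/-- Evaluation modulo `N` agrees with the evaluation over the integers modulo `N`. -/
theorem Gate.evalMod_modEq {N m : ℕ} {V : ℕ → ℕ} {v : ℕ → ℤ} (g : Gate) (hg : g.UsesBelow m)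
    (hV : ∀ i < m, V i < N) (h : ∀ i < m, (V i : ℤ) ≡ v i [ZMOD N]) :
    (g.evalMod N V : ℤ) ≡ g.eval v [ZMOD N] := by
  cases g with
  | one => simpa [evalMod, eval] using Int.mod_modEq 1 N
  | add i j =>
    simp only [evalMod, eval]
    push_cast
    exact (Int.mod_modEq _ _).trans ((h i hg.1).add (h j hg.2))
  | sub i j =>
    simp only [evalMod, eval]
    push_cast [(hV j hg.2).le]
    refine (Int.mod_modEq _ _).trans ?_
    have h1 : (N : ℤ) - V j ≡ 0 - v j [ZMOD N] :=
      Int.ModEq.sub (by simp [Int.ModEq]) (h j hg.2)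
    simpa [sub_eq_add_neg] using (h i hg.1).add h1
  | mul i j =>
    simp only [evalMod, eval]
    push_cast
    exact (Int.mod_modEq _ _).trans ((h i hg.1).mul (h j hg.2))

/-- The entry number `idx` of the square of the `n × n` matrix with the entries `F`, in row-major
order. -/
def squareEntry (n : ℕ) (F : ℕ → ℕ) (idx : ℕ) : ℕ :=
  ∑ z ∈ Finset.range n, F (idx / n * n + z) * F (z * n + idx % n)

/-- The integer matrix with the entries `F`, in row-major order. -/
def flatMatrix (n : ℕ) (F : ℕ → ℕ) : Matrix (Fin n) (Fin n) ℤ := fun x y => F (x * n + y)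

theorem matrixInputs_flat {n : ℕ} (F : ℕ → ℕ) {k : ℕ} (hk : k < n * n) :
    matrixInputs (flatMatrix n F) (flatMatrix n F) k = F k ∧
    matrixInputs (flatMatrix n F) (flatMatrix n F) (n * n + k) = F k := by
  have h : k / n * n + k % n = k := Nat.div_add_mod' k n
  constructor
  · simp [matrixInputs, hk, flatMatrix, Fin.coe_divNat, Fin.coe_modNat, h]
  · simp [matrixInputs, hk, flatMatrix, Fin.coe_divNat, Fin.coe_modNat, h]

theorem flatMatrix_sq {n : ℕ} (F : ℕ → ℕ) (x y : Fin n) :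
    (flatMatrix n F * flatMatrix n F) x y = squareEntry n F (x * n + y) := by
  have hn : 0 < n := x.pos
  have h1 : ((x : ℕ) * n + y) / n = x := by
    rw [mul_comm, Nat.mul_add_div hn, Nat.div_eq_of_lt y.2, add_zero]
  have h2 : ((x : ℕ) * n + y) % n = y := by
    rw [mul_comm, Nat.mul_add_mod, Nat.mod_eq_of_lt y.2]
  rw [Matrix.mul_apply, squareEntry, h1, h2, Finset.sum_range]
  push_cast
  rfl

/-- If the gates are evaluated modulo `N` and the entries of the square are below `N`, then the
last values are these entries. -/
theorem MultipliesMatrices.square {n N : ℕ} {gs : List Gate} (h : MultipliesMatrices n gs)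
    {F V : ℕ → ℕ}
    (hV : ∀ i < 2 * (n * n) + gs.length, V i < N ∧
      (V i : ℤ) ≡ runGates (2 * (n * n)) gs (matrixInputs (flatMatrix n F) (flatMatrix n F)) i
        [ZMOD N])
    {idx : ℕ} (hidx : idx < n * n) (hN : squareEntry n F idx < N) :
    V (n * n + gs.length + idx) = squareEntry n F idx := by
  have hn : 0 < n := Nat.pos_of_ne_zero fun h0 => by simp [h0] at hidx
  have h0 : idx / n * n + idx % n = idx := Nat.div_add_mod' idx n
  obtain ⟨h1, h2⟩ := hV (n * n + gs.length + idx) (by omega)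
  have h3 := h.2 (flatMatrix n F) (flatMatrix n F) ⟨idx / n, Nat.div_lt_of_lt_mul hidx⟩
    ⟨idx % n, Nat.mod_lt _ hn⟩
  rw [flatMatrix_sq] at h3
  simp only [h0] at h3
  rw [h3] at h2
  have h4 := Nat.modEq_of_dvd (Int.modEq_iff_dvd.1 h2)
  rwa [Nat.ModEq, Nat.mod_eq_of_lt h1, Nat.mod_eq_of_lt hN] at h4

/-- With fewer than `n²` gates the first of the last `n²` values would be an input, but the first
entry of the product of `0` and the matrix of ones is not `1`, which that input is. -/
theorem MultipliesMatrices.le_length {n : ℕ} {gs : List Gate} (h : MultipliesMatrices n gs)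
    (hn : 0 < n) : n * n ≤ gs.length := by
  by_contra hlt
  push Not at hlt
  have h1 := h.2 0 (Matrix.of fun _ _ => 1) ⟨0, hn⟩ ⟨0, hn⟩
  rw [runGates_of_lt _ (by simp; omega)] at h1
  simp [matrixInputs, hlt] at h1

/-! ### Min-plus products with rounded entries -/

/-- The encoding of a matrix entry `d` (a number plus one, or `0` for infinity): rounded up to a
multiple `a` of `u`, it becomes the power `B ^ (R - a)`. Entries with `a > R` are dropped. -/
def pack (R B u d : ℕ) : ℕ :=
  if d = 0 then 0 else if (d - 1 + u - 1) / u ≤ R then B ^ (R - (d - 1 + u - 1) / u) else 0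

/-- The entry of the min-plus square that is decoded from the product of the encoded matrices. -/
def scaleVal (n R B u : ℕ) (D : ℕ → ℕ) (idx : ℕ) : ℕ :=
  if squareEntry n (fun i => pack R B u (D i)) idx = 0 then 0
  else (2 * R - Nat.log B (squareEntry n (fun i => pack R B u (D i)) idx)) * u + 1

theorem pack_le {R B u d : ℕ} (hB : 1 ≤ B) : pack R B u d ≤ B ^ R := by
  unfold pack
  split_ifs
  · simp
  · exact Nat.pow_le_pow_right hB (Nat.sub_le _ _)
  · simp

/-- The entries of the product are below the modulus. -/
theorem squareEntry_lt {n R B u p : ℕ} {D : ℕ → ℕ} (hB : n < B) (hp : 2 * R < p) (idx : ℕ) :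
    squareEntry n (fun i => pack R B u (D i)) idx < B ^ p := by
  have hB1 : 1 ≤ B := by omega
  calc squareEntry n (fun i => pack R B u (D i)) idx
      ≤ ∑ _z ∈ Finset.range n, B ^ R * B ^ R := by
        refine Finset.sum_le_sum fun z _ => ?_
        exact Nat.mul_le_mul (pack_le hB1) (pack_le hB1)
    _ = n * B ^ (2 * R) := by simp [← pow_add, two_mul]
    _ < B * B ^ (2 * R) := by
        have : 0 < B ^ (2 * R) := by positivity
        gcongr
    _ = B ^ (2 * R + 1) := by ring
    _ ≤ B ^ p := Nat.pow_le_pow_right hB1 hp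

theorem scaleVal_le (n R B u : ℕ) (D : ℕ → ℕ) (idx : ℕ) :
    scaleVal n R B u D idx ≤ 2 * R * u + 1 := by
  unfold scaleVal
  split_ifs
  · simp
  · gcongr
    exact Nat.sub_le _ _

/-- The logarithm of a sum of at most `B - 1` powers of `B` is the largest exponent. -/
theorem exists_log_le {n B : ℕ} (hB : n < B) (g e : ℕ → ℕ)
    (hg : ∀ z < n, g z ≠ 0 → g z = B ^ e z) (hV : ∑ z ∈ Finset.range n, g z ≠ 0) :
    ∃ z < n, g z ≠ 0 ∧ Nat.log B (∑ z ∈ Finset.range n, g z) ≤ e z := by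
  by_contra hcon
  push Not at hcon
  have hn : n ≠ 0 := by rintro rfl; simp at hV
  have hB1 : 1 < B := by omega
  set L := Nat.log B (∑ z ∈ Finset.range n, g z) with hL
  have h1 : B ^ L ≤ ∑ z ∈ Finset.range n, g z := Nat.pow_log_le_self B hV
  obtain ⟨z, hz, hgz⟩ := Finset.exists_ne_zero_of_sum_ne_zero hV
  have h2 := hcon z (Finset.mem_range.1 hz) hgz
  have h3 : ∑ z ∈ Finset.range n, g z ≤ n * B ^ (L - 1) := by
    calc ∑ z ∈ Finset.range n, g z ≤ ∑ _z ∈ Finset.range n, B ^ (L - 1) := by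
          refine Finset.sum_le_sum fun z hz => ?_
          by_cases h0 : g z = 0
          · simp [h0]
          · rw [hg z (Finset.mem_range.1 hz) h0]
            have := hcon z (Finset.mem_range.1 hz) h0
            exact Nat.pow_le_pow_right (by omega) (by omega)
      _ = _ := by simp
  have h4 : B ^ L = B * B ^ (L - 1) := by
    rw [← pow_succ', show L - 1 + 1 = L by omega]
  have h5 : 0 < B ^ (L - 1) := by positivity
  have h6 : n * B ^ (L - 1) < B * B ^ (L - 1) := by gcongr
  omega

/-- `D` holds upper bounds for the weights of paths with exactly `t` edges (plus one, and `0` if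
there is no such path) that are exact up to a factor `f`. -/
structure Approx {n : ℕ} (G : WGraph n) (t : ℕ) (f : ℝ) (D : ℕ → ℕ) : Prop where
  sound : ∀ x y : Fin n, D (x * n + y) ≠ 0 → ∃ w, G.Path x y t w ∧ w + 1 ≤ D (x * n + y)
  complete : ∀ (x y : Fin n) (w : ℕ), G.Path x y t w →
    D (x * n + y) ≠ 0 ∧ ((D (x * n + y) - 1 : ℕ) : ℝ) ≤ f * w

theorem le_roundUp {d u : ℕ} (hu : 0 < u) : d ≤ (d + u - 1) / u * u := by
  have := Nat.div_add_mod (d + u - 1) u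
  have := Nat.mod_lt (d + u - 1) hu
  rw [mul_comm ((d + u - 1) / u)]
  omega

theorem roundUp_le {d u : ℕ} : (d + u - 1) / u * u ≤ d + u - 1 := Nat.div_mul_le_self _ _

theorem pack_ne_zero {R B u d : ℕ} (h : pack R B u d ≠ 0) :
    d ≠ 0 ∧ (d - 1 + u - 1) / u ≤ R ∧ pack R B u d = B ^ (R - (d - 1 + u - 1) / u) := by
  unfold pack at *
  split_ifs at * <;> simp_all

theorem squareEntry_fin {n : ℕ} (F : ℕ → ℕ) (x y : Fin n) :
    squareEntry n F (x * n + y) = ∑ z ∈ Finset.range n, F (x * n + z) * F (z * n + y) := by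
  have hn : 0 < n := x.pos
  have h1 : ((x : ℕ) * n + y) / n = x := by
    rw [mul_comm, Nat.mul_add_div hn, Nat.div_eq_of_lt y.2, add_zero]
  have h2 : ((x : ℕ) * n + y) % n = y := by
    rw [mul_comm, Nat.mul_add_mod, Nat.mod_eq_of_lt y.2]
  rw [squareEntry, h1, h2]

/-- A decoded entry is at least the weight of some pair of entries. -/
theorem scaleVal_sound {n R B u : ℕ} {D : ℕ → ℕ} (hB : n < B) (hu : 0 < u) (x y : Fin n)
    (h : scaleVal n R B u D (x * n + y) ≠ 0) :
    ∃ z : Fin n, D (x * n + z) ≠ 0 ∧ D (z * n + y) ≠ 0 ∧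
      (D (x * n + z) - 1) + (D (z * n + y) - 1) + 1 ≤ scaleVal n R B u D (x * n + y) := by
  unfold scaleVal at h ⊢
  split_ifs at h ⊢ with h0
  · exact absurd rfl h
  rw [squareEntry_fin] at h0 ⊢
  obtain ⟨z, hz, hg, hlog⟩ := exists_log_le hB _
    (fun z => (R - (D (x * n + z) - 1 + u - 1) / u) + (R - (D (z * n + y) - 1 + u - 1) / u))
    (fun z _ hg => by
      obtain ⟨-, -, h1⟩ := pack_ne_zero (left_ne_zero_of_mul hg)
      obtain ⟨-, -, h2⟩ := pack_ne_zero (right_ne_zero_of_mul hg)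
      simp only [h1, h2, pow_add]) h0
  obtain ⟨h1, h2, -⟩ := pack_ne_zero (left_ne_zero_of_mul hg)
  obtain ⟨h3, h4, -⟩ := pack_ne_zero (right_ne_zero_of_mul hg)
  refine ⟨⟨z, hz⟩, h1, h3, ?_⟩
  have h5 := le_roundUp (d := D (x * n + z) - 1) hu
  have h6 := le_roundUp (d := D (z * n + y) - 1) hu
  simp only at hlog ⊢
  set a := (D (x * n + z) - 1 + u - 1) / u
  set b := (D (z * n + y) - 1 + u - 1) / u
  have h7 : (a + b) * u ≤ (2 * R - Nat.log B (∑ z ∈ Finset.range n,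
      pack R B u (D (x * n + z)) * pack R B u (D (z * n + y)))) * u := by
    gcongr
    omega
  rw [add_mul] at h7
  omega

/-- A decoded entry is at most the rounded weight of every pair of entries that are not dropped. -/
theorem scaleVal_complete {n R B u : ℕ} {D : ℕ → ℕ} (hB : n < B) (x y z : Fin n)
    (h1 : D (x * n + z) ≠ 0) (h2 : D (z * n + y) ≠ 0)
    (ha : (D (x * n + z) - 1 + u - 1) / u ≤ R) (hb : (D (z * n + y) - 1 + u - 1) / u ≤ R) :
    scaleVal n R B u D (x * n + y) ≠ 0 ∧ scaleVal n R B u D (x * n + y) ≤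
      ((D (x * n + z) - 1 + u - 1) / u + (D (z * n + y) - 1 + u - 1) / u) * u + 1 := by
  have hle : B ^ ((R - (D (x * n + z) - 1 + u - 1) / u) + (R - (D (z * n + y) - 1 + u - 1) / u)) ≤
      squareEntry n (fun i => pack R B u (D i)) (x * n + y) := by
    rw [squareEntry_fin]
    refine le_trans (le_of_eq ?_)
      (Finset.single_le_sum (f := fun z => pack R B u (D (x * n + z)) * pack R B u (D (z * n + y)))
        (fun _ _ => Nat.zero_le _) (Finset.mem_range.2 z.2))
    simp [pack, h1, h2, ha, hb, pow_add]
  have hpos : 0 < squareEntry n (fun i => pack R B u (D i)) (x * n + y) :=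
    lt_of_lt_of_le (Nat.pow_pos (by omega)) hle
  have hlog := Nat.le_log_of_pow_le (by have := x.pos; omega) hle
  unfold scaleVal
  rw [if_neg hpos.ne']
  refine ⟨by omega, Nat.add_le_add_right (Nat.mul_le_mul_right _ ?_) _⟩
  set a := (D (x * n + z) - 1 + u - 1) / u
  set b := (D (z * n + y) - 1 + u - 1) / u
  clear_value a b
  omega

/-- A path with `2t` edges is split in the middle. Both halves are at most `R` times the smallest
scale `u` that is large enough for them, so that rounding costs a factor of at most `1 + 4 / R`. -/
theorem Approx.square {n R B t k : ℕ} {G : WGraph n} {f : ℝ} {D D' : ℕ → ℕ} (h : Approx G t f D)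
    (hB : n < B) (hR : 2 ≤ R) (hf : 0 ≤ f) (hk : f * (2 * t * G.maxWeight) ≤ 2 ^ k)
    (h₁ : ∀ idx < n * n, D' idx ≠ 0 → ∃ r, D' idx = scaleVal n R B (2 ^ r) D idx)
    (h₂ : ∀ r ≤ k, ∀ idx < n * n, scaleVal n R B (2 ^ r) D idx ≠ 0 →
      D' idx ≠ 0 ∧ D' idx ≤ scaleVal n R B (2 ^ r) D idx) :
    Approx G (2 * t) (f * (1 + 4 / R)) D' := by
  have hidx : ∀ x y : Fin n, (x : ℕ) * n + y < n * n := fun x y => by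
    have h1 := Nat.mul_le_mul_right n (show (x : ℕ) + 1 ≤ n from x.2)
    have h2 := y.2
    rw [add_mul] at h1
    omega
  constructor
  · intro x y hne
    obtain ⟨r, hr⟩ := h₁ _ (hidx x y) hne
    rw [hr] at hne ⊢
    obtain ⟨z, hz1, hz2, hz⟩ := scaleVal_sound hB (by positivity) x y hne
    obtain ⟨w₁, p₁, hw₁⟩ := h.sound x z hz1
    obtain ⟨w₂, p₂, hw₂⟩ := h.sound z y hz2
    refine ⟨w₁ + w₂, two_mul t ▸ p₁.append p₂, by omega⟩
  · intro x y w p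
    rw [two_mul] at p
    obtain ⟨z, w₁, w₂, p₁, p₂, rfl⟩ := p.split
    obtain ⟨hz1, hd1⟩ := h.complete x z w₁ p₁
    obtain ⟨hz2, hd2⟩ := h.complete z y w₂ p₂
    set d₁ := D (x * n + z) - 1
    set d₂ := D (z * n + y) - 1
    -- The scale `2 ^ r` is the smallest one at which neither half is dropped.
    have hex : ∃ r, d₁ + d₂ ≤ R * 2 ^ r := by
      refine ⟨d₁ + d₂, ?_⟩
      have : d₁ + d₂ < 2 ^ (d₁ + d₂) := Nat.lt_two_pow_self
      nlinarith
    classical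
    set r := Nat.find hex
    have hr : d₁ + d₂ ≤ R * 2 ^ r := Nat.find_spec hex
    have hmin : r = 0 ∨ R * 2 ^ r < 2 * (d₁ + d₂) := by
      rcases Nat.eq_zero_or_pos r with h0 | h0
      · exact Or.inl h0
      · right
        have h1 := Nat.find_min hex (show r - 1 < r by omega)
        have h2 : 2 ^ r = 2 * 2 ^ (r - 1) := by
          rw [← pow_succ', show r - 1 + 1 = r by omega]
        rw [h2]
        push Not at h1
        nlinarith
    have hu : 0 < 2 ^ r := by positivity
    have hround : ∀ d, d ≤ R * 2 ^ r → (d + 2 ^ r - 1) / 2 ^ r ≤ R := by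
      intro d hd
      rw [Nat.div_le_iff_le_mul_add_pred hu]
      rw [mul_comm] at hd
      omega
    obtain ⟨hs1, hs2⟩ := scaleVal_complete (D := D) hB x y z hz1 hz2
      (hround d₁ (by omega)) (hround d₂ (by omega))
    have hsum : ((d₁ + d₂ : ℕ) : ℝ) ≤ f * ((w₁ + w₂ : ℕ) : ℝ) := by
      push_cast
      linarith
    have hrk : r ≤ k := by
      rcases hmin with h0 | h0
      · omega
      · have h1 : 2 ^ r ≤ d₁ + d₂ := by nlinarith
        have h2 : ((w₁ + w₂ : ℕ) : ℝ) ≤ 2 * t * G.maxWeight := by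
          have := (p₁.append p₂).weight_le
          rw [← two_mul] at this
          exact_mod_cast this
        have h3 : ((2 ^ r : ℕ) : ℝ) ≤ ((2 ^ k : ℕ) : ℝ) := by
          push_cast
          calc (2 : ℝ) ^ r ≤ ((d₁ + d₂ : ℕ) : ℝ) := by exact_mod_cast h1
            _ ≤ f * ((w₁ + w₂ : ℕ) : ℝ) := hsum
            _ ≤ f * (2 * t * G.maxWeight) := by gcongr
            _ ≤ 2 ^ k := hk
        exact (Nat.pow_le_pow_iff_right (a := 2) (by norm_num)).1 (by exact_mod_cast h3)
    obtain ⟨hne, hle⟩ := h₂ r hrk _ (hidx x y) hs1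
    refine ⟨hne, ?_⟩
    have hD : D' (x * n + y) - 1 ≤ (d₁ + 2 ^ r - 1) + (d₂ + 2 ^ r - 1) := by
      have e1 := roundUp_le (d := d₁) (u := 2 ^ r)
      have e2 := roundUp_le (d := d₂) (u := 2 ^ r)
      have e3 : D' (x * n + y) ≤
          ((d₁ + 2 ^ r - 1) / 2 ^ r + (d₂ + 2 ^ r - 1) / 2 ^ r) * 2 ^ r + 1 := hle.trans hs2
      rw [add_mul] at e3
      omega
    have hRpos : (0 : ℝ) < R := by exact_mod_cast (by omega : 0 < R)
    have hfin : ((D' (x * n + y) - 1 : ℕ) : ℝ) ≤ ((d₁ + d₂ : ℕ) : ℝ) * (1 + 4 / R) := by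
      rcases hmin with h0 | h0
      · rw [h0] at hD
        have h1 : D' (x * n + y) - 1 ≤ d₁ + d₂ := by omega
        calc ((D' (x * n + y) - 1 : ℕ) : ℝ) ≤ ((d₁ + d₂ : ℕ) : ℝ) := by exact_mod_cast h1
          _ ≤ _ := le_mul_of_one_le_right (by positivity) (by
            have : 0 ≤ 4 / (R : ℝ) := by positivity
            linarith)
      · have h1 : D' (x * n + y) - 1 ≤ d₁ + d₂ + 2 * 2 ^ r := by omega
        have h2 : ((D' (x * n + y) - 1 : ℕ) : ℝ) ≤ ((d₁ + d₂ : ℕ) : ℝ) + 2 * 2 ^ r := by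
          exact_mod_cast h1
        have h3 : (R : ℝ) * 2 ^ r ≤ 2 * ((d₁ + d₂ : ℕ) : ℝ) := by exact_mod_cast h0.le
        have h4 : (2 : ℝ) ^ r ≤ 2 * ((d₁ + d₂ : ℕ) : ℝ) / R := by
          rw [le_div_iff₀ hRpos]
          linarith
        calc ((D' (x * n + y) - 1 : ℕ) : ℝ) ≤ ((d₁ + d₂ : ℕ) : ℝ) + 2 * 2 ^ r := h2
          _ ≤ ((d₁ + d₂ : ℕ) : ℝ) + 2 * (2 * ((d₁ + d₂ : ℕ) : ℝ) / R) := by gcongr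
          _ = _ := by ring
    calc ((D' (x * n + y) - 1 : ℕ) : ℝ) ≤ ((d₁ + d₂ : ℕ) : ℝ) * (1 + 4 / R) := hfin
      _ ≤ (f * ((w₁ + w₂ : ℕ) : ℝ)) * (1 + 4 / R) := by gcongr
      _ = _ := by ring

/-- The rounding errors of `k` squarings add up. -/
theorem one_add_pow_le {k R : ℕ} {δ : ℝ} (hδ : 0 < δ) (hδ' : δ ≤ 1) (hR : 32 * k ≤ R * δ) :
    (1 + 4 / (R : ℝ)) ^ k ≤ 1 + δ / 4 := by
  rcases Nat.eq_zero_or_pos k with rfl | hk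
  · simp; linarith
  have hk' : (1 : ℝ) ≤ k := by exact_mod_cast hk
  have hRpos : (0 : ℝ) < R := by
    by_contra h
    push Not at h
    nlinarith
  have h1 : 1 + 4 / (R : ℝ) ≤ Real.exp (4 / R) := by
    rw [add_comm]
    exact Real.add_one_le_exp _
  have h2 : (k : ℝ) * (4 / R) ≤ δ / 8 := by
    rw [mul_div_assoc', div_le_iff₀ hRpos]
    linarith
  calc (1 + 4 / (R : ℝ)) ^ k ≤ Real.exp (4 / R) ^ k := by gcongr
    _ = Real.exp (k * (4 / R)) := (Real.exp_nat_mul _ _).symm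
    _ ≤ Real.exp (δ / 8) := Real.exp_le_exp.2 h2
    _ ≤ 1 / (1 - δ / 8) := Real.exp_bound_div_one_sub_of_interval (by linarith) (by linarith)
    _ ≤ 1 + δ / 4 := by
      rw [div_le_iff₀ (by linarith)]
      nlinarith

/-! ### The constants of the algorithm -/

/-- The numbers that the algorithm computes once: the number `n` of vertices, the straight-line
program `gs`, the largest rounded entry `R`, the base `B` of the encoding and the number `L` of
repeated squarings with `B ^ (2 ^ L)` as the modulus, a number `U` above the largest weight, and the
path length `t = 2 ^ τ`. -/
structure Consts where
  n : ℕ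
  gs : List Gate
  R : ℕ
  B : ℕ
  L : ℕ
  U : ℕ
  t : ℕ
  τ : ℕ

namespace Consts

/-- The relations between the constants; `b` and `H` bound the number of bits of `B` and of all
numbers that occur. -/
structure Good (K : Consts) (b H : ℕ) : Prop where
  n_pos : 1 ≤ K.n
  mult : MultipliesMatrices K.n K.gs
  n_lt : K.n < K.B
  B_le : K.B ≤ 2 ^ b
  b_pos : 1 ≤ b
  two_le_R : 2 ≤ K.R
  R_lt : 2 * K.R < 2 ^ K.L
  t_eq : K.t = 2 ^ K.τ
  thr_le : 4 * K.n * K.U ≤ K.t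
  le_H : b * 2 ^ K.L + 1 ≤ H
  index_lt : 2 * (K.n * K.n) + 3 * K.gs.length + 3 < 2 ^ H
  entry_lt : 4 * K.R * K.t ^ 2 + 2 < 2 ^ H

/-- The state holds the constants in the registers below `16`, the table of the powers `B ^ (2 ^ i)`
in the array `5`, and the straight-line program in the array `64`. -/
structure Holds (K : Consts) (s : State) : Prop where
  r0 : s.reg 0 = K.n
  r1 : s.reg 1 = K.n * K.n
  r2 : s.reg 2 = 1
  r3 : s.reg 3 = K.R
  r4 : s.reg 4 = K.B ^ 2 ^ K.L
  r5 : s.reg 5 = K.L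
  r6 : s.reg 6 = 2 * K.R
  r7 : s.reg 7 = K.gs.length
  r8 : s.reg 8 = K.t
  r9 : s.reg 9 = 2
  r10 : s.reg 10 = 4 * K.n * K.U
  r11 : s.reg 11 = K.B
  r12 : s.reg 12 = 2 * (K.n * K.n)
  r13 : s.reg 13 = K.n * K.n + K.gs.length
  r14 : s.reg 14 = K.τ
  r15 : s.reg 15 = 0
  powers : ∀ i ≤ K.L, s.arr 5 i = K.B ^ 2 ^ i
  gates : ∀ (k : ℕ) (g : Gate), K.gs[k]? = some g →
    (s.arr 64 (3 * k), s.arr 64 (3 * k + 1), s.arr 64 (3 * k + 2)) = g.code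

theorem Holds.frame {K : Consts} {p : Prog} {s s' : State} (h : K.Holds s) (hf : Frame p s s')
    (hr : ∀ k < 16, p.writesReg k = false) (h5 : p.writesArr 5 = false)
    (h64 : p.writesArr 64 = false) : K.Holds s' := by
  have e : ∀ k < 16, s'.reg k = s.reg k := fun k hk => hf.reg k (hr k hk)
  have e5 := hf.arr 5 h5
  have e64 := hf.arr 64 h64
  refine ⟨?_, ?_, ?_, ?_, ?_, ?_, ?_, ?_, ?_, ?_, ?_, ?_, ?_, ?_, ?_, ?_, ?_, ?_⟩
  · rw [e _ (by norm_num), h.r0]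
  · rw [e _ (by norm_num), h.r1]
  · rw [e _ (by norm_num), h.r2]
  · rw [e _ (by norm_num), h.r3]
  · rw [e _ (by norm_num), h.r4]
  · rw [e _ (by norm_num), h.r5]
  · rw [e _ (by norm_num), h.r6]
  · rw [e _ (by norm_num), h.r7]
  · rw [e _ (by norm_num), h.r8]
  · rw [e _ (by norm_num), h.r9]
  · rw [e _ (by norm_num), h.r10]
  · rw [e _ (by norm_num), h.r11]
  · rw [e _ (by norm_num), h.r12]
  · rw [e _ (by norm_num), h.r13]
  · rw [e _ (by norm_num), h.r14]
  · rw [e _ (by norm_num), h.r15]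
  · rw [e5]; exact h.powers
  · rw [e64]; exact h.gates

/-- An upper bound for the entries of the matrices: a decoded entry is at most `2 * R * u + 1`, and
the scales are at most `2 * t ^ 2`. -/
def maxEntry (K : Consts) : ℕ := 4 * K.R * K.t ^ 2 + 1

namespace Good

variable {K : Consts} {b H : ℕ}

theorem two_pow_L_lt (h : K.Good b H) : 2 ^ K.L < 2 ^ H := by
  have h1 := h.le_H
  have h2 := Nat.mul_le_mul_right (2 ^ K.L) h.b_pos
  have : 2 ^ K.L < H := by omega
  exact this.trans Nat.lt_two_pow_self

theorem L_lt (h : K.Good b H) : K.L < 2 ^ H := Nat.lt_two_pow_self.trans h.two_pow_L_lt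

theorem N_lt (h : K.Good b H) : K.B ^ 2 ^ K.L < 2 ^ H := by
  calc K.B ^ 2 ^ K.L ≤ (2 ^ b) ^ 2 ^ K.L := Nat.pow_le_pow_left h.B_le _
    _ = 2 ^ (b * 2 ^ K.L) := by rw [pow_mul]
    _ < 2 ^ H := Nat.pow_lt_pow_right (by norm_num) h.le_H

theorem B_lt (h : K.Good b H) : K.B < 2 ^ H :=
  (Nat.le_self_pow (by positivity) _).trans_lt h.N_lt

theorem one_lt_B (h : K.Good b H) : 1 < K.B := h.n_pos.trans_lt h.n_lt

theorem t_lt (h : K.Good b H) : 2 * (K.t * K.t) ≤ K.maxEntry ∧ K.t ≤ K.maxEntry ∧ K.R < 2 ^ H := by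
  have h1 := h.two_le_R
  have h2 := h.two_pow_L_lt
  have h3 := h.R_lt
  unfold maxEntry
  refine ⟨by nlinarith [Nat.zero_le (K.t * K.t)], ?_, by omega⟩
  have : K.t ≤ K.t * K.t := Nat.le_mul_self _
  nlinarith [Nat.zero_le (K.t * K.t)]

theorem maxEntry_lt (h : K.Good b H) : K.maxEntry + 1 < 2 ^ H := h.entry_lt

theorem τ_lt (h : K.Good b H) : K.τ < 2 ^ H := by
  have h1 : K.τ < K.t := by rw [h.t_eq]; exact Nat.lt_two_pow_self
  have h2 := h.t_lt.2.1
  have h3 := h.maxEntry_lt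
  omega

theorem H_pos (h : K.Good b H) : 3 ≤ H := by
  have h1 := h.le_H
  have h2 := Nat.mul_le_mul_right (2 ^ K.L) h.b_pos
  have h3 := h.two_le_R
  have h4 := h.R_lt
  omega

end Good

end Consts

/-! ### Encoding and decoding of an entry -/

/-- The sum of the costs of operations on numbers whose length grows geometrically is a constant
multiple of the cost of the last one. -/
theorem sum_mb_le {b L H : ℕ} (hb : 1 ≤ b) (hH : b * 2 ^ L ≤ H) (c : ℕ) :
    1 + ∑ i ∈ Finset.range L, (c * mb (b * 2 ^ (i + 1) + L + 3) + (1 + L)) ≤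
      (300 * c + 5) * mb H := by
  have hLH : 2 ^ L ≤ H := by nlinarith
  have hH1 : 1 ≤ H := Nat.one_le_two_pow.trans hLH
  have hL1 : L < 2 ^ L := Nat.lt_two_pow_self
  have hLL : L * (L + 3) ≤ 6 * 2 ^ L := by
    clear hH hLH hL1
    induction L with
    | zero => simp
    | succ L ih =>
      rw [pow_succ]
      have : L + 2 ≤ 2 * 2 ^ L := by
        have : L < 2 ^ L := Nat.lt_two_pow_self
        have := @Nat.one_le_two_pow L
        omega
      nlinarith
  have hsz : (6 * H).size ≤ 4 * H.size := by
    have h1 := size_mul_le 6 H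
    have h2 : Nat.size 6 = 3 := by decide
    have h3 : 1 ≤ H.size := Nat.size_pos.2 hH1
    omega
  have hgeo : ∑ i ∈ Finset.range L, b * 2 ^ (i + 1) ≤ 2 * H := by
    have h1 : ∑ i ∈ Finset.range L, b * 2 ^ (i + 1) = 2 * (b * ∑ i ∈ Finset.range L, 2 ^ i) := by
      rw [Finset.mul_sum, Finset.mul_sum]
      exact Finset.sum_congr rfl fun i _ => by ring
    rw [h1, Nat.geomSum_eq (le_refl 2)]
    have : b * ((2 ^ L - 1) / (2 - 1)) ≤ b * 2 ^ L := by
      gcongr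
      simp
    omega
  have hterm : ∀ i ∈ Finset.range L, mb (b * 2 ^ (i + 1) + L + 3) ≤
      (b * 2 ^ (i + 1) + (L + 3)) * (16 * H.size ^ 2) := by
    intro i hi
    have hi' : i + 1 ≤ L := Finset.mem_range.1 hi
    have h1 : b * 2 ^ (i + 1) ≤ b * 2 ^ L := by gcongr; norm_num
    have h2 : (b * 2 ^ (i + 1) + L + 3).size ≤ 4 * H.size :=
      (Nat.size_le_size (by nlinarith)).trans hsz
    calc mb (b * 2 ^ (i + 1) + L + 3) ≤ (b * 2 ^ (i + 1) + L + 3) * (4 * H.size) ^ 2 := by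
          unfold mb; gcongr
      _ = _ := by ring
  have hsum : ∑ i ∈ Finset.range L, mb (b * 2 ^ (i + 1) + L + 3) ≤ 300 * mb H := by
    calc _ ≤ ∑ i ∈ Finset.range L, (b * 2 ^ (i + 1) + (L + 3)) * (16 * H.size ^ 2) :=
          Finset.sum_le_sum hterm
      _ = (∑ i ∈ Finset.range L, b * 2 ^ (i + 1) + L * (L + 3)) * (16 * H.size ^ 2) := by
          rw [← Finset.sum_mul, Finset.sum_add_distrib]; simp
      _ ≤ (2 * H + 6 * H) * (16 * H.size ^ 2) := by 
          refine Nat.mul_le_mul_right _ ?_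
          have := Nat.mul_le_mul_left 6 hLH
          omega
      _ ≤ 300 * mb H := by unfold mb; nlinarith [Nat.zero_le (H * H.size ^ 2)]
  rw [Finset.sum_add_distrib, ← Finset.mul_sum]
  simp only [Finset.sum_const, Finset.card_range, smul_eq_mul]
  have h1 := Nat.mul_le_mul_left c hsum
  have h2 : L * (1 + L) + 1 ≤ 5 * mb H := by
    have : L * (1 + L) + 1 ≤ 5 * 2 ^ L := by
      clear hH hLH hL1 hLL hsz hgeo hterm hsum h1
      induction L with
      | zero => simp
      | succ L ih =>
        rw [pow_succ]
        have : 2 * L + 2 ≤ 5 * 2 ^ L := by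
          have : L < 2 ^ L := Nat.lt_two_pow_self
          omega
        nlinarith
    have := le_mb H
    omega
  nlinarith

/-- One step of the computation of a power: register `21` holds the exponent that remains, `20` the
result and `22` the repeated square of the base. -/
def powBody : Prog :=
  .op .div 23 21 9 ;; .op .add 24 23 23 ;; .op .sub 24 21 24 ;;
  .ifz 24 (.const 24 0) (.op .mul 20 20 22) ;; .op .mul 22 22 22 ;; .op .add 21 23 15

/-- Square-and-multiply. The numbers in the pass `i` have about `b * 2 ^ i` bits, so the last pass
dominates the cost. -/
theorem powLoop_spec {K : Consts} {b H : ℕ} (h : K.Good b H) {s : State} (hs : K.Holds s) {k : ℕ}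
    (hk : k < 2 ^ K.L) (h21 : s.reg 21 = k) (h20 : s.reg 20 = 1) (h22 : s.reg 22 = K.B) :
    Spec (.loop 21 powBody) s ((300 * powBody.kst + 5) * mb H) fun s' => s'.reg 20 = K.B ^ k := by
  have hB := h.one_lt_B
  have hsz : ∀ i, k / 2 ^ i ≠ 0 → i < K.L := fun i hi => by
    have h1 : 2 ^ i ≤ k := by
      by_contra hc
      exact hi (Nat.div_eq_of_lt (by omega))
    exact (Nat.pow_lt_pow_iff_right (a := 2) (by norm_num)).1 (h1.trans_lt hk)
  -- After `i` passes the lowest `i` binary digits of the exponent are used up.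
  refine (Spec.loop (m := K.L)
    (fun i s' => s'.reg 21 = k / 2 ^ i ∧ s'.reg 20 = K.B ^ (k % 2 ^ i) ∧ s'.reg 22 = K.B ^ 2 ^ i)
    (fun i => powBody.kst * mb (b * 2 ^ (i + 1) + K.L + 3)) ?_ ?_ ?_ (fun _ => 1 + K.L) ?_).conseq
    (sum_mb_le h.b_pos (by have := h.le_H; omega) _) ?_
  · simp [h21, h20, h22, Nat.mod_one]
  · rintro i s' - ⟨e, -⟩ hne
    exact hsz i (by rwa [← e])
  · rintro i s' hf ⟨e1, e2, e3⟩ hne hi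
    have e9 : s'.reg 9 = 2 := by rw [hf.reg 9 rfl, hs.r9]
    have e15 : s'.reg 15 = 0 := by rw [hf.reg 15 rfl, hs.r15]
    have hpow : K.B ^ 2 ^ i < 2 ^ (b * 2 ^ (i + 1) + K.L + 3) := by
      calc K.B ^ 2 ^ i ≤ (2 ^ b) ^ 2 ^ i := Nat.pow_le_pow_left h.B_le _
        _ = 2 ^ (b * 2 ^ i) := by rw [pow_mul]
        _ < _ := Nat.pow_lt_pow_right (by norm_num) (by
          have : b * 2 ^ i ≤ b * 2 ^ (i + 1) := by gcongr <;> omega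
          omega)
    have hmod : K.B ^ (k % 2 ^ i) ≤ K.B ^ 2 ^ i :=
      Nat.pow_le_pow_right (by omega) (Nat.mod_lt _ (by positivity)).le
    have hdiv : k / 2 ^ i < 2 ^ (b * 2 ^ (i + 1) + K.L + 3) := by
      calc k / 2 ^ i ≤ k := Nat.div_le_self _ _
        _ < 2 ^ K.L := hk
        _ ≤ _ := Nat.pow_le_pow_right (by norm_num) (by omega)
    have htwo : 2 < 2 ^ (b * 2 ^ (i + 1) + K.L + 3) := by
      calc 2 < 2 ^ 3 := by norm_num
        _ ≤ _ := Nat.pow_le_pow_right (by norm_num) (by omega)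
    refine Spec.line [21, 20, 22, 9, 15] _ rfl (by omega) ?_ ?_ ?_
    · simp only [List.forall_mem_cons, e1, e2, e3, e9, e15]
      exact ⟨hdiv, by omega, hpow, htwo, by omega, by simp⟩
    · simp [powBody]
    · have h1 : k / 2 ^ (i + 1) = k / 2 ^ i / 2 := by rw [pow_succ, Nat.div_div_eq_div_mul]
      have h2 := Nat.div_add_mod (k / 2 ^ i) 2
      have h3 : k % 2 ^ (i + 1) = k % 2 ^ i + 2 ^ i * (k / 2 ^ i % 2) := by
        rw [pow_succ, Nat.mod_mul]
      by_cases hif : k / 2 ^ i - (k / 2 ^ i / 2 + k / 2 ^ i / 2) = 0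
      · simp only [powBody, Prog.ev]
        simp [e1, e2, e3, e9, e15, hif]
        refine ⟨h1.symm, ?_, by rw [pow_succ, pow_mul, sq]⟩
        rw [h3, show k / 2 ^ i % 2 = 0 by omega, mul_zero, add_zero]
      · simp only [powBody, Prog.ev]
        simp [e1, e2, e3, e9, e15, hif]
        refine ⟨h1.symm, ?_, by rw [pow_succ, pow_mul, sq]⟩
        rw [h3, show k / 2 ^ i % 2 = 1 by omega, mul_one, pow_add]
  · rintro i s' hf ⟨e, -⟩ hne hi
    rw [e]
    have := Nat.size_le.2 (show k / 2 ^ i < 2 ^ K.L from (Nat.div_le_self _ _).trans_lt hk)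
    simpa using this
  · rintro s' - ⟨h0, i, e1, e2, -⟩
    rw [e2, Nat.mod_eq_of_lt]
    rw [e1, Nat.div_eq_zero_iff] at h0
    rcases h0 with h0 | h0
    · exact absurd h0 (by positivity)
    · exact h0

/-- One step of the computation of a logarithm: register `21` counts down the table of the powers
`B ^ (2 ^ i)`, `20` holds the number and `22` the leading bits of its logarithm. -/
def logBody : Prog :=
  .op .sub 21 21 2 ;; .load 23 5 21 ;; .op .add 22 22 22 ;; .op .sub 24 23 20 ;;
  .ifz 24 (.op .div 20 20 23 ;; .op .add 22 22 2) (.const 24 0)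

theorem log_div_pow {B V p : ℕ} (hB : 1 < B) (h : B ^ p ≤ V) :
    Nat.log B (V / B ^ p) + p = Nat.log B V := by
  induction p generalizing V with
  | zero => simp
  | succ p ih =>
    have h1 : B ^ p ≤ V / B := by
      rw [Nat.le_div_iff_mul_le (by omega)]
      rwa [pow_succ] at h
    have h2 : B ≤ V := (Nat.le_self_pow (by omega) B).trans h
    rw [pow_succ', ← Nat.div_div_eq_div_mul, ← add_assoc, ih h1, Nat.log_div_base]
    have := Nat.log_pos hB h2
    omega

/-- The logarithm is found digit by digit from the top. The numbers in the last but `i`-th pass have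
about `b * 2 ^ i` bits, so the first pass dominates the cost. -/
theorem logLoop_spec {K : Consts} {b H : ℕ} (h : K.Good b H) {s : State} (hs : K.Holds s) {V : ℕ}
    (hV : V < K.B ^ 2 ^ K.L) (hV0 : V ≠ 0) (h21 : s.reg 21 = K.L) (h20 : s.reg 20 = V)
    (h22 : s.reg 22 = 0) :
    Spec (.loop 21 logBody) s ((300 * logBody.kst + 5) * mb H)
      fun s' => s'.reg 22 = Nat.log K.B V := by
  have hB := h.one_lt_B
  have hlog : Nat.log K.B V < 2 ^ K.L := Nat.log_lt_of_lt_pow hV0 hV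
  -- The number in register `20` is always below the power that was used last.
  refine (Spec.loop (m := K.L)
    (fun i s' => s'.reg 21 + i = K.L ∧ s'.reg 20 ≠ 0 ∧ s'.reg 20 < K.B ^ 2 ^ s'.reg 21 ∧
      s'.reg 22 * 2 ^ s'.reg 21 + Nat.log K.B (s'.reg 20) = Nat.log K.B V)
    (fun i => logBody.kst * mb (b * 2 ^ (K.L - 1 - i + 1) + K.L + 3)) ?_ ?_ ?_
    (fun _ => 1 + K.L) ?_).conseq ?_ ?_
  · simp [h21, h20, h22, hV, hV0]
  · rintro i s' - ⟨e, -⟩ hne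
    omega
  · rintro i s' hf ⟨e1, e2, e3, e4⟩ hne hi
    obtain ⟨j, hj⟩ : ∃ j, s'.reg 21 = j + 1 := ⟨s'.reg 21 - 1, by omega⟩
    rw [hj] at e1 e3 e4
    rw [show K.L - 1 - i = j by omega]
    have h2 : s'.reg 2 = 1 := by rw [hf.reg 2 rfl, hs.r2]
    have h5 : s'.arr 5 j = K.B ^ 2 ^ j := by rw [hf.arr 5 rfl, hs.powers j (by omega)]
    have hpow : K.B ^ 2 ^ (j + 1) < 2 ^ (b * 2 ^ (j + 1) + K.L + 3) := by
      calc K.B ^ 2 ^ (j + 1) ≤ (2 ^ b) ^ 2 ^ (j + 1) := Nat.pow_le_pow_left h.B_le _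
        _ = 2 ^ (b * 2 ^ (j + 1)) := by rw [pow_mul]
        _ < _ := Nat.pow_lt_pow_right (by norm_num) (by omega)
    have hpow' : K.B ^ 2 ^ j ≤ K.B ^ 2 ^ (j + 1) :=
      Nat.pow_le_pow_right (by omega) (Nat.pow_le_pow_right (by norm_num) (by omega))
    have hL : 2 ^ K.L ≤ 2 ^ (b * 2 ^ (j + 1) + K.L + 3) :=
      Nat.pow_le_pow_right (by norm_num) (by omega)
    have hLL : K.L < 2 ^ K.L := Nat.lt_two_pow_self
    have he : s'.reg 22 ≤ Nat.log K.B V := by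
      have : s'.reg 22 ≤ s'.reg 22 * 2 ^ (j + 1) := Nat.le_mul_of_pos_right _ (by positivity)
      omega
    refine Spec.line [21, 20, 22, 2] _ rfl (by omega) ?_ ?_ ?_
    · simp only [List.forall_mem_cons, hj, h2]
      exact ⟨by omega, by omega, by omega, by omega, by simp⟩
    · simp [logBody, hj, h2, h5]
      omega
    · by_cases hif : K.B ^ 2 ^ j - s'.reg 20 = 0
      · simp only [logBody, Prog.ev]
        simp [hj, h2, h5, hif]
        have h6 := log_div_pow hB (p := 2 ^ j) (V := s'.reg 20) (by omega)
        refine ⟨by omega, ⟨by omega, by omega⟩, ?_, ?_⟩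
        · rw [Nat.div_lt_iff_lt_mul (by positivity), ← pow_add, ← two_mul, ← pow_succ']
          exact e3
        · rw [pow_succ] at e4
          rw [← e4, ← h6]
          ring
      · simp only [logBody, Prog.ev]
        simp [hj, h2, h5, hif]
        refine ⟨by omega, e2, by omega, ?_⟩
        rw [← e4]
        ring
  · rintro i s' hf ⟨e, -⟩ hne hi
    have h1 := Nat.size_le_size (show s'.reg 21 ≤ K.L by omega)
    have h2 : K.L.size ≤ K.L := Nat.size_le.2 Nat.lt_two_pow_self
    omega
  · have h1 := Finset.sum_range_reflect
      (fun i => logBody.kst * mb (b * 2 ^ (i + 1) + K.L + 3) + (1 + K.L)) K.L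
    rw [h1]
    exact sum_mb_le h.b_pos (by have := h.le_H; omega) _
  · rintro s' - ⟨h0, i, -, e2, e3, e4⟩
    rw [h0] at e3 e4
    rw [Nat.log_of_lt (by simpa using e3)] at e4
    simpa using e4

/-! ### One scale of the min-plus product -/

/-- Round the entry in register `19` up to a multiple of the scale. -/
def packRound : Prog :=
  .op .sub 19 19 2 ;; .op .add 19 19 18 ;; .op .sub 19 19 2 ;; .op .div 19 19 18 ;;
  .op .sub 21 19 3

/-- Prepare the computation of the power of `B`. -/
def packInit : Prog := .op .sub 21 3 19 ;; .const 20 1 ;; .op .add 22 11 15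

/-- Write the encoded entry into both input matrices of the straight-line program. -/
def packStore : Prog := .store 4 17 20 ;; .op .add 23 17 1 ;; .store 4 23 20

/-- Encode the entry number `17` of the array `2` with the scale in register `18`. -/
def packBody : Prog :=
  .load 19 2 17 ;;
  .ifz 19 (.const 20 0)
    (packRound ;; .ifz 21 (packInit ;; .loop 21 powBody) (.const 20 0)) ;; packStore

theorem packBody_spec : ∃ A : ℕ, ∀ {K : Consts} {b H : ℕ} (_ : K.Good b H) {s : State}
    (_ : K.Holds s) {u : ℕ} (_ : 0 < u) (_ : u ≤ K.maxEntry) (_ : s.reg 18 = u)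
    (_ : s.reg 17 < K.n * K.n) (_ : s.arr 2 (s.reg 17) ≤ K.maxEntry),
    Spec packBody s (A * mb H) fun s' => ∀ i, s'.arr 4 i =
      if i = s.reg 17 ∨ i = s.reg 17 + K.n * K.n then pack K.R K.B u (s.arr 2 (s.reg 17))
      else s.arr 4 i := by
  refine ⟨(Prog.kst (.load 19 2 17)) + ((2 + (Prog.kst (.const 20 0)) + (packRound.kst +
    (2 + (packInit.kst + (300 * powBody.kst + 5)) + (Prog.kst (.const 20 0))))) + packStore.kst),
    ?_⟩
  intro K b H h s hs u hu0 hu h18 h17 hd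
  have hH := h.H_pos
  have hM := h.maxEntry_lt
  have hR := h.t_lt.2.2
  have hB := h.B_lt
  have hidx := h.index_lt
  have hN := h.N_lt
  set d := s.arr 2 (s.reg 17) with hd_def
  refine (Spec.line (Q := fun s' => s'.reg 19 = d) [17] H rfl (by omega) ?_ ?_ ?_).seqH
    fun s1 hf1 h1 => Spec.seqH
    (Q := fun s' => s'.reg 20 = pack K.R K.B u d) (Spec.ifzH (by omega) ?_ ?_ ?_)
    fun s2 hf2 h2 => Spec.line [17, 20, 1] H rfl (by omega) ?_ ?_ ?_
  · simp; omega
  · simp; omega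
  · simp [hd_def]
  · rw [h1]; omega
  · intro h0
    refine Spec.line [] H rfl (by omega) ?_ ?_ ?_
    · simp
    · simp
    · rw [h1] at h0
      simp [pack, h0]
  · intro h0
    rw [h1] at h0
    have e2 : s1.reg 2 = 1 := by rw [hf1.reg 2 rfl, hs.r2]
    have e3 : s1.reg 3 = K.R := by rw [hf1.reg 3 rfl, hs.r3]
    have e18 : s1.reg 18 = u := by rw [hf1.reg 18 rfl, h18]
    set a := (d - 1 + u - 1) / u with ha
    refine Spec.seqH (Q := fun s' => s'.reg 19 = a ∧ s'.reg 21 = a - K.R)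
      (Spec.line [19, 2, 18, 3] H rfl (by omega) ?_ ?_ ?_)
      fun s2 hf2 h2 => Spec.ifzH (by omega) ?_ ?_ ?_
    · simp [h1, e2, e3, e18]; omega
    · simp [packRound]
    · simp [packRound, h1, e2, e3, e18, ha]
    · rw [h2.2]
      have h3 : a ≤ d := by
        rw [ha, Nat.div_le_iff_le_mul_add_pred hu0]
        have : d - 1 ≤ u * d := (Nat.sub_le _ _).trans (Nat.le_mul_of_pos_left _ hu0)
        omega
      omega
    · intro hz
      rw [h2.2] at hz
      have g3 : s2.reg 3 = K.R := by rw [hf2.reg 3 rfl, e3]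
      have g11 : s2.reg 11 = K.B := by rw [hf2.reg 11 rfl, hf1.reg 11 rfl, hs.r11]
      have g15 : s2.reg 15 = 0 := by rw [hf2.reg 15 rfl, hf1.reg 15 rfl, hs.r15]
      refine Spec.seqH (Q := fun s' => s'.reg 21 = K.R - a ∧ s'.reg 20 = 1 ∧
        s'.reg 22 = K.B) (Spec.line [3, 19, 11, 15] H rfl (by omega) ?_ ?_ ?_)
        fun s3 hf3 h3 => (powLoop_spec h (k := K.R - a) ?_ ?_ h3.1 h3.2.1 h3.2.2).conseq
          le_rfl ?_
      · simp [h2.1, g3, g11, g15]; omega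
      · simp [packInit]
      · simp [packInit, h2.1, g3, g11, g15]
      · exact ((hs.frame hf1 (by decide) rfl rfl).frame hf2 (by decide) rfl rfl).frame hf3
          (by decide) rfl rfl
      · have := h.R_lt; omega
      · intro s4 _ h4
        rw [h4, pack, if_neg h0, if_pos (by omega)]
    · intro hz
      rw [h2.2] at hz
      refine Spec.line [] H rfl (by omega) ?_ ?_ ?_
      · simp
      · simp
      · simp [pack, h0]; omega
  · have g17 : s2.reg 17 = s.reg 17 := by rw [hf2.reg 17 rfl, hf1.reg 17 rfl]
    have g1 : s2.reg 1 = K.n * K.n := by rw [hf2.reg 1 rfl, hf1.reg 1 rfl, hs.r1]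
    have hp : pack K.R K.B u d < 2 ^ H := by
      refine (pack_le h.one_lt_B.le).trans_lt (lt_of_le_of_lt ?_ hN)
      exact Nat.pow_le_pow_right h.one_lt_B.le (by have := h.R_lt; omega)
    simp [h2, g17, g1]; omega
  · simp [packStore]
  · have g17 : s2.reg 17 = s.reg 17 := by rw [hf2.reg 17 rfl, hf1.reg 17 rfl]
    have g1 : s2.reg 1 = K.n * K.n := by rw [hf2.reg 1 rfl, hf1.reg 1 rfl, hs.r1]
    have g4 : s2.arr 4 = s.arr 4 := by rw [hf2.arr 4 rfl, hf1.arr 4 rfl]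
    intro i
    simp only [packStore, Prog.ev]
    simp [h2, g17, g1, g4]
    split_ifs <;> first | rfl | omega

namespace Consts

/-- The modulus. -/
def N (K : Consts) : ℕ := K.B ^ 2 ^ K.L

/-- The number of entries of the matrix plus the number of gates (plus one); the number of steps for
one matrix product is a constant multiple of it. -/
def work (K : Consts) : ℕ := K.n * K.n + K.gs.length + 1

/-- The encoded matrix. -/
def packed (K : Consts) (u : ℕ) (D : ℕ → ℕ) (i : ℕ) : ℕ := pack K.R K.B u (D i)

theorem Good.packed_lt {K : Consts} {b H : ℕ} (h : K.Good b H) (u : ℕ) (D : ℕ → ℕ) (i : ℕ) :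
    K.packed u D i < K.N := by
  have h1 := h.one_lt_B
  refine (pack_le h1.le).trans_lt (Nat.pow_lt_pow_right h1 ?_)
  have := h.R_lt
  omega

end Consts

/-- Encode the matrix in array `2` into the two input matrices in array `4`. -/
def packLoop : Prog := .forDown 17 1 packBody

theorem packLoop_spec : ∃ A : ℕ, ∀ {K : Consts} {b H : ℕ} (_ : K.Good b H) {s : State}
    (_ : K.Holds s) {u : ℕ} (_ : 0 < u) (_ : u ≤ K.maxEntry) (_ : s.reg 18 = u)
    (_ : ∀ i < K.n * K.n, s.arr 2 i ≤ K.maxEntry) (_ : ∀ i, s.arr 4 i < K.N),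
    Spec packLoop s (K.work * (A * mb H)) fun s' => (∀ i, s'.arr 4 i < K.N) ∧
      ∀ i < K.n * K.n, s'.arr 4 i = K.packed u (s.arr 2) i ∧
        s'.arr 4 (K.n * K.n + i) = K.packed u (s.arr 2) i := by
  obtain ⟨A, hA⟩ := packBody_spec
  refine ⟨A + 11, ?_⟩
  intro K b H h s hs u hu0 hu h18 hd hV
  have hidx := h.index_lt
  refine (Spec.forDown (A := A) (m := K.n * K.n) (H := H) (r := 17) (src := 1)
    (fun k s' => (∀ i, s'.arr 4 i < K.N) ∧ ∀ i < K.n * K.n, k ≤ i →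
      s'.arr 4 i = K.packed u (s.arr 2) i ∧ s'.arr 4 (K.n * K.n + i) = K.packed u (s.arr 2) i)
    hs.r1 hs.r15 hs.r2 (by norm_num) rfl rfl (by have := h.H_pos; omega) (by omega)
    ⟨hV, fun i hi hi' => by omega⟩ ?_).conseq ?_ ?_
  · rintro k s' s'' hk hf ⟨hJ1, hJ2⟩ rfl
    have hs' : K.Holds (s'.setReg 17 k) :=
      (hs.frame hf (by decide) rfl rfl).frame (p := .const 17 k) (Exec.const _ _ _).frame
        (by intro k hk; simp [Prog.writesReg]; omega) rfl rfl
    have e2 : s'.arr 2 = s.arr 2 := hf.arr 2 rfl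
    refine (hA h hs' hu0 hu (by simp [hf.reg 18 rfl, h18]) (by simpa using hk)
      (by simpa [e2] using hd k hk)).conseq le_rfl ?_
    intro t _ ht
    simp [e2] at ht
    refine ⟨fun i => ?_, fun i hi hki => ?_⟩
    · rw [ht]
      split_ifs
      · exact h.packed_lt u (s.arr 2) k
      · exact hJ1 i
    · rcases Nat.eq_or_lt_of_le hki with rfl | hlt
      · refine ⟨by rw [ht, if_pos (by omega)]; rfl, by rw [ht, if_pos (by omega)]; rfl⟩
      · rw [ht, ht, if_neg (by omega), if_neg (by omega)]
        exact hJ2 i hi hlt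
  · gcongr
    unfold Consts.work
    omega
  · rintro t - ⟨-, h1, h2⟩
    exact ⟨h1, fun i hi => h2 i hi (Nat.zero_le _)⟩

/-- Evaluate one gate modulo `N`: register `19` points to the code of the gate and `20` to the cell
of the result. -/
def gateBody : Prog :=
  .load 21 64 19 ;; .op .add 19 19 2 ;; .load 22 64 19 ;; .op .add 19 19 2 ;; .load 23 64 19 ;;
  .op .add 19 19 2 ;; .load 24 4 22 ;; .load 25 4 23 ;;
  .ifz 21 (.const 26 1) (.op .sub 21 21 2 ;;
    .ifz 21 (.op .add 26 24 25) (.op .sub 21 21 2 ;;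
      .ifz 21 (.op .sub 26 4 25 ;; .op .add 26 24 26) (.op .mul 26 24 25))) ;;
  .op .div 27 26 4 ;; .op .mul 27 27 4 ;; .op .sub 26 26 27 ;; .store 4 20 26 ;; .op .add 20 20 2

theorem gateBody_spec {K : Consts} {b H : ℕ} (h : K.Good b H) {s : State} (hs : K.Holds s) {k : ℕ}
    {g : Gate} (hg : K.gs[k]? = some g) (h19 : s.reg 19 = 3 * k)
    (h20 : s.reg 20 = 2 * (K.n * K.n) + k) (hV : ∀ i, s.arr 4 i < K.N) :
    Spec gateBody s (gateBody.kst * mb H) fun s' => s'.reg 19 = 3 * (k + 1) ∧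
      s'.reg 20 = 2 * (K.n * K.n) + (k + 1) ∧ ∀ i, s'.arr 4 i =
        if i = 2 * (K.n * K.n) + k then g.evalMod K.N (s.arr 4) else s.arr 4 i := by
  have hH := h.H_pos
  have hidx := h.index_lt
  have hN : K.N < 2 ^ H := h.N_lt
  have hk : k < K.gs.length := (List.getElem?_eq_some_iff.1 hg).1
  have hcode := hs.gates k g hg
  have huse := h.mult.1.usesBelow hg
  have hH8 : 2 ^ 3 ≤ 2 ^ H := Nat.pow_le_pow_right (by norm_num) hH
  have e2 := hs.r2
  have e4 : s.reg 4 = K.N := hs.r4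
  have hV' : ∀ i, s.arr 4 i < 2 ^ H := fun i => (hV i).trans hN
  have hmod : ∀ x, x - x / K.N * K.N = x % K.N := fun x => by
    rw [Nat.mod_def, mul_comm]
  refine Spec.line [19, 2, 4, 20] H rfl (by omega) ?_ ?_ ?_
  · simp [h19, h20, e2, e4]; omega
  · cases g <;> simp only [Gate.code, Prod.mk.injEq, Gate.UsesBelow] at hcode huse <;>
      obtain ⟨c1, c2, c3⟩ := hcode <;>
      simp only [gateBody, Prog.ev, Prog.loads] <;>
      simp [h19, e2, c1, c2, c3, add_assoc, hV'] <;> omega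
  · cases g <;> simp only [Gate.code, Prod.mk.injEq, Gate.UsesBelow] at hcode huse <;>
      obtain ⟨c1, c2, c3⟩ := hcode <;>
      simp only [gateBody, Prog.ev] <;>
      simp [h19, h20, e2, e4, c1, c2, c3, add_assoc, Gate.evalMod, hmod] <;> omega

/-- Evaluate the straight-line program on the inputs in array `4`; the results of the gates are
appended to them. -/
def gateLoop : Prog := (.const 19 0 ;; .op .add 20 12 15) ;; .forDown 17 7 gateBody

theorem gateLoop_spec : ∃ A : ℕ, ∀ {K : Consts} {b H : ℕ} (_ : K.Good b H) {s : State}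
    (_ : K.Holds s) {F : ℕ → ℕ} (_ : ∀ i, s.arr 4 i < K.N)
    (_ : ∀ i < K.n * K.n, s.arr 4 i = F i ∧ s.arr 4 (K.n * K.n + i) = F i),
    Spec gateLoop s (K.work * (A * mb H)) fun s' => (∀ i, s'.arr 4 i < K.N) ∧
      ∀ idx < K.n * K.n, squareEntry K.n F idx < K.N →
        s'.arr 4 (K.n * K.n + K.gs.length + idx) = squareEntry K.n F idx := by
  refine ⟨Prog.kst (.const 19 0 ;; .op .add 20 12 15) + (gateBody.kst + 11), ?_⟩
  intro K b H h s hs F hV hF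
  have hidx := h.index_lt
  have hH := h.H_pos
  have hw : 1 ≤ K.work := by unfold Consts.work; omega
  have hN0 : 0 < K.N := lt_of_le_of_lt (Nat.zero_le _) (hV 0)
  set v : ℕ → ℤ := matrixInputs (flatMatrix K.n F) (flatMatrix K.n F) with hv
  have hinit : ∀ i < 2 * (K.n * K.n), (s.arr 4 i : ℤ) = v i := by
    intro i hi
    by_cases hi' : i < K.n * K.n
    · rw [hv, (matrixInputs_flat F hi').1, (hF i hi').1]
    · obtain ⟨j, rfl⟩ : ∃ j, i = K.n * K.n + j := ⟨i - K.n * K.n, by omega⟩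
      rw [hv, (matrixInputs_flat F (by omega)).2, (hF j (by omega)).2]
  refine (Spec.seq (Q := fun s' => s'.reg 19 = 0 ∧ s'.reg 20 = 2 * (K.n * K.n))
    (Spec.line [12, 15] H rfl (by omega) ?_ ?_ ?_) fun s1 hf1 h1 =>
    Spec.forDown (A := gateBody.kst) (m := K.gs.length) (H := H) (r := 17) (src := 7)
    (fun r s' => s'.reg 19 = 3 * (K.gs.length - r) ∧
      s'.reg 20 = 2 * (K.n * K.n) + (K.gs.length - r) ∧ (∀ i, s'.arr 4 i < K.N) ∧
      ∀ i < 2 * (K.n * K.n) + (K.gs.length - r), (s'.arr 4 i : ℤ) ≡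
        runGates (2 * (K.n * K.n)) (K.gs.take (K.gs.length - r)) v i [ZMOD K.N])
    (by rw [hf1.reg 7 rfl, hs.r7]) (by rw [hf1.reg 15 rfl, hs.r15])
    (by rw [hf1.reg 2 rfl, hs.r2]) (by norm_num) rfl rfl (by omega) (by omega) ?_ ?_).conseq ?_ ?_
  · simp [hs.r12, hs.r15]; omega
  · simp
  · simp [hs.r12, hs.r15]
  · have e4 : s1.arr 4 = s.arr 4 := hf1.arr 4 rfl
    refine ⟨by simp [h1.1], by simp [h1.2], fun i => by simpa [e4] using hV i, fun i hi => ?_⟩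
    simp only [Nat.sub_self, List.take_zero, add_zero] at hi ⊢
    rw [State.setReg_arr, e4, hinit i hi]
    rfl
  · rintro r s' s'' hr hf ⟨j1, j2, j3, j4⟩ rfl
    have hs' : K.Holds (s'.setReg 17 r) :=
      ((hs.frame hf1 (by decide) rfl rfl).frame hf (by decide) rfl rfl).frame (p := .const 17 r)
        (Exec.const _ _ _).frame (by intro k hk; simp [Prog.writesReg]; omega) rfl rfl
    set k := K.gs.length - (r + 1) with hk
    have hk1 : K.gs.length - r = k + 1 := by omega
    have hkl : k < K.gs.length := by omega
    have hg : K.gs[k]? = some K.gs[k] := List.getElem?_eq_getElem hkl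
    refine (gateBody_spec h hs' hg (by simpa using j1) (by simpa using j2)
      (by simpa using j3)).conseq le_rfl ?_
    rintro t - ⟨t1, t2, t3⟩
    have hev := Gate.evalMod_modEq (N := K.N) (V := s'.arr 4)
      (v := runGates (2 * (K.n * K.n)) (K.gs.take k) v) K.gs[k] (h.mult.1.usesBelow hg)
      (fun i _ => j3 i) j4
    have htake : K.gs.take (k + 1) = K.gs.take k ++ [K.gs[k]] := by
      rw [List.take_succ_eq_append_getElem hkl]
    have hlen : (K.gs.take k).length = k := by simp; omega
    rw [hk1]
    refine ⟨t1, t2, fun i => ?_, fun i hi => ?_⟩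
    · rw [t3]
      split_ifs
      · cases K.gs[k] <;> exact Nat.mod_lt _ hN0
      · exact j3 i
    · rw [t3, htake, runGates_append, hlen]
      by_cases hik : i = 2 * (K.n * K.n) + k
      · rw [if_pos hik, hik, Function.update_self]
        exact hev
      · rw [if_neg hik, Function.update_of_ne hik]
        exact j4 i (by omega)
  · unfold Consts.work at *
    have : (K.gs.length + 1) * ((gateBody.kst + 11) * mb H) ≤
      (K.n * K.n + K.gs.length + 1) * ((gateBody.kst + 11) * mb H) := by gcongr; omega
    exact (add_le_add (Nat.le_mul_of_pos_left _ hw) this).trans (le_of_eq (by ring))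
  · rintro t - ⟨-, -, -, h3, h4⟩
    refine ⟨h3, fun idx hi hlt => h.mult.square (fun i hi' => ⟨h3 i, ?_⟩) hi hlt⟩
    have := h4 i (by omega)
    simpa using this

/-- The smaller one of `e` and `v`, where `0` stands for infinity. -/
def improve (e v : ℕ) : ℕ := if v = 0 then e else if e = 0 ∨ v < e then v else e

/-- Decode the exponent in register `22` and improve the entry number `17` of the result. -/
def unpackStore : Prog :=
  .op .sub 22 6 22 ;; .op .mul 22 22 18 ;; .op .add 22 22 2 ;; .load 23 3 17 ;;
  .ifz 23 (.store 3 17 22) (.op .sub 24 23 22 ;; .ifz 24 (.const 24 0) (.store 3 17 22))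

/-- Decode the entry number `17` of the product and improve the entry of the result in array
`3`. -/
def unpackBody : Prog :=
  (.op .add 19 17 13 ;; .load 20 4 19) ;;
  .ifz 20 (.const 24 0) ((.op .add 21 5 15 ;; .const 22 0) ;; .loop 21 logBody ;; unpackStore)

theorem unpackBody_spec : ∃ A : ℕ, ∀ {K : Consts} {b H : ℕ} (_ : K.Good b H) {s : State}
    (_ : K.Holds s) {u : ℕ} {D : ℕ → ℕ} (_ : u ≤ 2 * K.t ^ 2) (_ : s.reg 18 = u)
    (_ : s.reg 17 < K.n * K.n)
    (_ : s.arr 4 (K.n * K.n + K.gs.length + s.reg 17) = squareEntry K.n (K.packed u D) (s.reg 17))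
    (_ : s.arr 3 (s.reg 17) ≤ K.maxEntry),
    Spec unpackBody s (A * mb H) fun s' => ∀ i, s'.arr 3 i =
      if i = s.reg 17 then improve (s.arr 3 i) (scaleVal K.n K.R K.B u D i) else s.arr 3 i := by
  refine ⟨Prog.kst (.op .add 19 17 13 ;; .load 20 4 19) + (2 + Prog.kst (.const 24 0) +
    (Prog.kst (.op .add 21 5 15 ;; .const 22 0) + ((300 * logBody.kst + 5) + unpackStore.kst))), ?_⟩
  intro K b H h s hs u D hu h18 h17 hV hE
  have hH := h.H_pos
  have hM := h.maxEntry_lt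
  have hR := h.t_lt.2.2
  have hidx := h.index_lt
  have hsq : squareEntry K.n (K.packed u D) (s.reg 17) < K.B ^ 2 ^ K.L :=
    squareEntry_lt h.n_lt h.R_lt _
  have hN := h.N_lt
  have hRR := h.R_lt
  have hLp := h.two_pow_L_lt
  have hL := h.L_lt
  set V := squareEntry K.n (K.packed u D) (s.reg 17) with hVdef
  have hval : scaleVal K.n K.R K.B u D (s.reg 17) =
    if V = 0 then 0 else (2 * K.R - Nat.log K.B V) * u + 1 := rfl
  have huM : 2 * K.R * u + 1 ≤ K.maxEntry := by
    unfold Consts.maxEntry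
    have := Nat.mul_le_mul_left (2 * K.R) hu
    nlinarith
  have hle := scaleVal_le K.n K.R K.B u D (s.reg 17)
  have huH : u < 2 ^ H := by
    have : 1 * u ≤ 2 * K.R * u := Nat.mul_le_mul_right _ (by have := h.two_le_R; omega)
    omega
  refine Spec.seqH (Q := fun s' => s'.reg 20 = V)
    (Spec.line [17, 13] H rfl (by omega) ?_ ?_ ?_) fun s1 hf1 h1 =>
    Spec.ifzH (by omega) ?_ ?_ ?_
  · simp [hs.r13]; omega
  · simp [hs.r13]
    rw [add_comm (s.reg 17), hV]
    omega
  · simp [hs.r13]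
    rw [add_comm (s.reg 17), hV]
  · rw [h1]; omega
  · intro h0
    rw [h1] at h0
    refine Spec.line [] H rfl (by omega) (by simp) (by simp) ?_
    intro i
    have e3 : s1.arr 3 = s.arr 3 := hf1.arr 3 rfl
    simp only [Prog.ev, State.setReg_arr, e3]
    split_ifs with hi
    · rw [hi, hval, if_pos h0]; rfl
    · rfl
  · intro h0
    rw [h1] at h0
    have hs1 := hs.frame hf1 (by decide) rfl rfl
    refine Spec.seqH (Q := fun s' => s'.reg 21 = K.L ∧ s'.reg 22 = 0 ∧ s'.reg 20 = V)
      (Spec.line [5, 15] H rfl (by omega) ?_ ?_ ?_) fun s2 hf2 h2 =>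
      Spec.seqH (logLoop_spec h (hs1.frame hf2 (by decide) rfl rfl) hsq h0 h2.1 h2.2.2 h2.2.1)
      fun s3 hf3 h3 => ?_
    · simp [hs1.r5, hs1.r15]; omega
    · simp
    · simp [hs1.r5, hs1.r15, h1]
    · have hs3 := (hs1.frame hf2 (by decide) rfl rfl).frame hf3 (by decide) rfl rfl
      have e18 : s3.reg 18 = u := by rw [hf3.reg 18 rfl, hf2.reg 18 rfl, hf1.reg 18 rfl, h18]
      have e17 : s3.reg 17 = s.reg 17 := by
        rw [hf3.reg 17 rfl, hf2.reg 17 rfl, hf1.reg 17 rfl]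
      have e3 : s3.arr 3 = s.arr 3 := by rw [hf3.arr 3 rfl, hf2.arr 3 rfl, hf1.arr 3 rfl]
      have hlog : Nat.log K.B V < 2 ^ K.L := Nat.log_lt_of_lt_pow h0 hsq
      refine Spec.line [6, 22, 18, 2, 17] H rfl (by omega) ?_ ?_ ?_
      · simp [hs3.r6, hs3.r2, h3, e18, e17]; omega
      · simp only [unpackStore, Prog.ev, Prog.loads]
        simp [e17, e3]
        omega
      · intro i
        rw [if_neg h0] at hval
        set val := (2 * K.R - Nat.log K.B V) * u + 1 with hvaldef
        by_cases hz : s.arr 3 (s.reg 17) = 0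
        · simp only [unpackStore, Prog.ev]
          simp [hs3.r6, hs3.r2, h3, e18, e17, e3, hz, ← hvaldef]
          split_ifs with hi
          · rw [hi, hval, improve, if_neg (by omega), if_pos (Or.inl hz)]
          · rfl
        · by_cases hz' : s.arr 3 (s.reg 17) - val = 0
          · simp only [unpackStore, Prog.ev]
            simp [hs3.r6, hs3.r2, h3, e18, e17, e3, hz, hz', ← hvaldef]
            intro hi
            rw [hi, hval, improve, if_neg (by omega), if_neg (by omega)]
          · simp only [unpackStore, Prog.ev]
            simp [hs3.r6, hs3.r2, h3, e18, e17, e3, hz, hz', ← hvaldef]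
            split_ifs with hi
            · rw [hi, hval, improve, if_neg (by omega), if_pos (by omega)]
            · rfl

theorem improve_cases (e v : ℕ) : improve e v = e ∨ (improve e v = v ∧ v ≠ 0) := by
  unfold improve
  split_ifs <;> simp_all

theorem improve_le_right {e v : ℕ} (hv : v ≠ 0) : improve e v ≠ 0 ∧ improve e v ≤ v := by
  unfold improve
  split_ifs <;> omega

theorem improve_le_left {e v : ℕ} (he : e ≠ 0) : improve e v ≠ 0 ∧ improve e v ≤ e := by
  unfold improve
  split_ifs <;> omega

theorem Consts.Holds.setReg {K : Consts} {s : State} (hs : K.Holds s) {r : ℕ} (hr : 16 ≤ r)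
    (v : ℕ) : K.Holds (s.setReg r v) :=
  hs.frame (p := .const r v) (Exec.const _ _ _).frame
    (by intro k hk; simp [Prog.writesReg]; omega) rfl rfl

/-- Decode the product and take the minimum with the result so far. -/
def unpackLoop : Prog := .forDown 17 1 unpackBody

theorem unpackLoop_spec : ∃ A : ℕ, ∀ {K : Consts} {b H : ℕ} (_ : K.Good b H) {s : State}
    (_ : K.Holds s) {u : ℕ} {D : ℕ → ℕ} (_ : u ≤ 2 * K.t ^ 2) (_ : s.reg 18 = u)
    (_ : ∀ i < K.n * K.n,
      s.arr 4 (K.n * K.n + K.gs.length + i) = squareEntry K.n (K.packed u D) i)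
    (_ : ∀ i < K.n * K.n, s.arr 3 i ≤ K.maxEntry),
    Spec unpackLoop s (K.work * (A * mb H)) fun s' =>
      ∀ i < K.n * K.n, s'.arr 3 i = improve (s.arr 3 i) (scaleVal K.n K.R K.B u D i) := by
  obtain ⟨A, hA⟩ := unpackBody_spec
  refine ⟨A + 11, ?_⟩
  intro K b H h s hs u D hu h18 hV hE
  have hidx := h.index_lt
  refine (Spec.forDown (A := A) (m := K.n * K.n) (H := H) (r := 17) (src := 1)
    (fun k s' => ∀ i < K.n * K.n, s'.arr 3 i =
      if k ≤ i then improve (s.arr 3 i) (scaleVal K.n K.R K.B u D i) else s.arr 3 i)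
    hs.r1 hs.r15 hs.r2 (by norm_num) rfl rfl (by have := h.H_pos; omega) (by omega)
    (fun i hi => by rw [if_neg (by omega)]; rfl) ?_).conseq ?_ ?_
  · rintro k s' s'' hk hf hJ rfl
    have hs' : K.Holds (s'.setReg 17 k) :=
      (hs.frame hf (by decide) rfl rfl).setReg (by norm_num) k
    have e4 : s'.arr 4 = s.arr 4 := hf.arr 4 rfl
    have e3 : s'.arr 3 k = s.arr 3 k := by rw [hJ k hk, if_neg (by omega)]
    refine (hA h hs' (D := D) hu (by simp [hf.reg 18 rfl, h18]) (by simpa using hk)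
      (by simpa [e4] using hV k hk) (by simpa [e3] using hE k hk)).conseq le_rfl ?_
    intro t _ ht i hi
    simp at ht
    rw [ht i]
    by_cases hik : i = k
    · rw [if_pos hik, if_pos (by omega), hik, e3]
    · rw [if_neg hik, hJ i hi]
      by_cases hki : k ≤ i
      · rw [if_pos hki, if_pos (by omega)]
      · rw [if_neg hki, if_neg (by omega)]
  · gcongr
    unfold Consts.work
    omega
  · rintro t - ⟨-, h1⟩ i hi
    rw [h1 i hi, if_pos (Nat.zero_le _)]

/-- Improve the result in array `3` by the entries of the min-plus square at one scale. -/
def scaleProg : Prog := packLoop ;; gateLoop ;; unpackLoop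

theorem scaleProg_spec : ∃ A : ℕ, ∀ {K : Consts} {b H : ℕ} (_ : K.Good b H) {s : State}
    (_ : K.Holds s) {u : ℕ} (_ : 0 < u) (_ : u ≤ 2 * K.t ^ 2) (_ : s.reg 18 = u)
    (_ : ∀ i < K.n * K.n, s.arr 2 i ≤ K.maxEntry) (_ : ∀ i, s.arr 4 i < K.N)
    (_ : ∀ i < K.n * K.n, s.arr 3 i ≤ K.maxEntry),
    Spec scaleProg s (K.work * (A * mb H)) fun s' => (∀ i, s'.arr 4 i < K.N) ∧
      ∀ i < K.n * K.n,
        s'.arr 3 i = improve (s.arr 3 i) (scaleVal K.n K.R K.B u (s.arr 2) i) := by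
  obtain ⟨A₁, h₁⟩ := packLoop_spec
  obtain ⟨A₂, h₂⟩ := gateLoop_spec
  obtain ⟨A₃, h₃⟩ := unpackLoop_spec
  refine ⟨A₁ + (A₂ + A₃), ?_⟩
  intro K b H h s hs u hu0 hu h18 hD hV hE
  have huM : u ≤ K.maxEntry := by
    have := h.t_lt.1
    rw [← sq] at this
    omega
  refine Spec.mono (Spec.seq (h₁ h hs hu0 huM h18 hD hV) fun s1 hf1 hQ1 =>
    Spec.seq (h₂ h (hs.frame hf1 (by decide) rfl rfl) hQ1.1 hQ1.2) fun s2 hf2 hQ2 =>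
    (h₃ h ((hs.frame hf1 (by decide) rfl rfl).frame hf2 (by decide) rfl rfl) (u := u)
      (D := s.arr 2) hu ?_ ?_ ?_).conseq le_rfl ?_) (le_of_eq (by ring))
  · rw [hf2.reg 18 rfl, hf1.reg 18 rfl, h18]
  · exact fun i hi => hQ2.2 i hi (squareEntry_lt h.n_lt h.R_lt _)
  · rwa [hf2.arr 3 rfl, hf1.arr 3 rfl]
  · intro s3 hf3 hQ3
    rw [hf3.arr 4 rfl]
    refine ⟨hQ2.1, fun i hi => ?_⟩
    rw [hQ3 i hi, hf2.arr 3 rfl, hf1.arr 3 rfl]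

/-! ### Squaring a matrix -/

/-- Fill the array `3` with zeros. -/
def clearLoop : Prog := .forDown 17 1 (.store 3 17 15)

/-- Go through the scales from `2 * t ^ 2` to `1`. -/
def scaleLoop : Prog := .loop 18 (scaleProg ;; .op .div 18 18 9)

/-- Copy the array `3` into the array `2`. -/
def copyLoop : Prog := .forDown 17 1 (.load 19 3 17 ;; .store 2 17 19)

/-- Replace the matrix in array `2` by an approximation of its min-plus square. -/
def levelProg : Prog :=
  clearLoop ;; (.op .mul 18 8 8 ;; .op .add 18 18 18) ;; scaleLoop ;; copyLoop

theorem clearLoop_spec {K : Consts} {b H : ℕ} (h : K.Good b H) {s : State} (hs : K.Holds s) :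
    Spec clearLoop s (K.work * ((Prog.kst (.store 3 17 15) + 11) * mb H)) fun s' =>
      ∀ i < K.n * K.n, s'.arr 3 i = 0 := by
  have hidx := h.index_lt
  have hH := h.H_pos
  refine (Spec.forDown (A := Prog.kst (.store 3 17 15)) (m := K.n * K.n) (H := H) (r := 17)
    (src := 1) (fun k s' => ∀ i < K.n * K.n, k ≤ i → s'.arr 3 i = 0)
    hs.r1 hs.r15 hs.r2 (by norm_num) rfl rfl (by omega) (by omega)
    (fun i hi hi' => by omega) ?_).conseq ?_ ?_
  · rintro k s' s'' hk hf hJ rfl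
    have e15 : s'.reg 15 = 0 := by rw [hf.reg 15 rfl, hs.r15]
    refine Spec.line [17, 15] H rfl (by omega) ?_ ?_ ?_
    · simp [e15]; omega
    · simp
    · intro i hi hki
      simp [e15]
      intro hne
      exact hJ i hi (by omega)
  · gcongr
    unfold Consts.work
    omega
  · rintro t - ⟨-, h1⟩ i hi
    exact h1 i hi (Nat.zero_le _)

theorem copyLoop_spec {K : Consts} {b H : ℕ} (h : K.Good b H) {s : State} (hs : K.Holds s)
    (hE : ∀ i < K.n * K.n, s.arr 3 i ≤ K.maxEntry) :
    Spec copyLoop s (K.work * ((Prog.kst (.load 19 3 17 ;; .store 2 17 19) + 11) * mb H)) fun s' =>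
      ∀ i < K.n * K.n, s'.arr 2 i = s.arr 3 i := by
  have hidx := h.index_lt
  have hH := h.H_pos
  have hM := h.maxEntry_lt
  refine (Spec.forDown (A := Prog.kst (.load 19 3 17 ;; .store 2 17 19)) (m := K.n * K.n)
    (H := H) (r := 17) (src := 1) (fun k s' => ∀ i < K.n * K.n, k ≤ i → s'.arr 2 i = s.arr 3 i)
    hs.r1 hs.r15 hs.r2 (by norm_num) rfl rfl (by omega) (by omega)
    (fun i hi hi' => by omega) ?_).conseq ?_ ?_
  · rintro k s' s'' hk hf hJ rfl
    have e3 : s'.arr 3 = s.arr 3 := hf.arr 3 rfl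
    have := hE k hk
    refine Spec.line [17] H rfl (by omega) ?_ ?_ ?_
    · simp; omega
    · simp [e3]; omega
    · intro i hi hki
      simp [e3]
      split_ifs with hne
      · rw [hne]
      · exact hJ i hi (by omega)
  · gcongr
    unfold Consts.work
    omega
  · rintro t - ⟨-, h1⟩ i hi
    exact h1 i hi (Nat.zero_le _)

theorem scaleVal_le_maxEntry {K : Consts} {u : ℕ} (hu : u ≤ 2 * K.t ^ 2) (D : ℕ → ℕ) (i : ℕ) :
    scaleVal K.n K.R K.B u D i ≤ K.maxEntry := by
  refine (scaleVal_le K.n K.R K.B u D i).trans ?_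
  unfold Consts.maxEntry
  have := Nat.mul_le_mul_left (2 * K.R) hu
  nlinarith

/-- The result holds, for every entry, the minimum over all scales: it is one of the values that are
decoded at the scales, and at most each of them. The powers `2 ^ r` with `T - r < i` have been
treated after `i` passes, where `2 ^ T = 2 * t ^ 2`. -/
theorem scaleLoop_spec : ∃ A : ℕ, ∀ {K : Consts} {b H : ℕ} (_ : K.Good b H) {s : State}
    (_ : K.Holds s) (_ : s.reg 18 = 2 ^ (2 * K.τ + 1))
    (_ : ∀ i < K.n * K.n, s.arr 2 i ≤ K.maxEntry) (_ : ∀ i, s.arr 4 i < K.N)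
    (_ : ∀ i < K.n * K.n, s.arr 3 i = 0),
    Spec scaleLoop s ((K.τ + 1) * (K.work * (A * mb H))) fun s' => (∀ i, s'.arr 4 i < K.N) ∧
      ∀ idx < K.n * K.n, s'.arr 3 idx ≤ K.maxEntry ∧
        (s'.arr 3 idx ≠ 0 → ∃ r, s'.arr 3 idx = scaleVal K.n K.R K.B (2 ^ r) (s.arr 2) idx) ∧
        ∀ r ≤ 2 * K.τ + 1, scaleVal K.n K.R K.B (2 ^ r) (s.arr 2) idx ≠ 0 →
          s'.arr 3 idx ≠ 0 ∧
            s'.arr 3 idx ≤ scaleVal K.n K.R K.B (2 ^ r) (s.arr 2) idx := by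
  obtain ⟨A, hA⟩ := scaleProg_spec
  refine ⟨2 * (A + Prog.kst (.op .div 18 18 9)) + 5, ?_⟩
  intro K b H h s hs h18 hD hV hE
  have hH := h.H_pos
  have hM := h.maxEntry_lt
  have hH8 : 2 ^ 3 ≤ 2 ^ H := Nat.pow_le_pow_right (by norm_num) hH
  set D := s.arr 2 with hDdef
  set T := 2 * K.τ + 1 with hT
  have ht2 : 2 ^ T = 2 * K.t ^ 2 := by
    rw [h.t_eq, hT, pow_succ, pow_mul, ← pow_mul, mul_comm 2 K.τ, pow_mul]; ring
  have htM : 2 ^ T ≤ K.maxEntry := by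
    have := h.t_lt.1
    rw [← sq] at this
    omega
  have hi_le : ∀ i, 2 ^ T / 2 ^ i ≠ 0 → i ≤ T := fun i hi => by
    by_contra hc
    exact hi (Nat.div_eq_of_lt (Nat.pow_lt_pow_right (by norm_num) (by omega)))
  refine (Spec.loop_const (m := T + 1) (g := 1 + H)
    (d := K.work * (A * mb H) + Prog.kst (.op .div 18 18 9) * mb H)
    (fun i s' => s'.reg 18 = 2 ^ T / 2 ^ i ∧ (∀ i, s'.arr 4 i < K.N) ∧
      ∀ idx < K.n * K.n, s'.arr 3 idx ≤ K.maxEntry ∧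
        (s'.arr 3 idx ≠ 0 → ∃ r, s'.arr 3 idx = scaleVal K.n K.R K.B (2 ^ r) D idx) ∧
        ∀ r ≤ T, T < r + i → scaleVal K.n K.R K.B (2 ^ r) D idx ≠ 0 →
          s'.arr 3 idx ≠ 0 ∧ s'.arr 3 idx ≤ scaleVal K.n K.R K.B (2 ^ r) D idx)
    ?_ ?_ ?_).conseq ?_ ?_
  · refine ⟨by simp [h18], hV, fun idx hidx => ?_⟩
    rw [hE idx hidx]
    exact ⟨Nat.zero_le _, fun h0 => absurd rfl h0, fun r hr hr' => by omega⟩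
  · rintro i s' - ⟨e1, -⟩ hne
    refine ⟨by have := hi_le i (by rwa [← e1]); omega, ?_⟩
    have : (s'.reg 18).size ≤ H := by
      rw [Nat.size_le, e1]
      have := Nat.div_le_self (2 ^ T) (2 ^ i)
      omega
    omega
  · rintro i s' hf ⟨e1, j1, j2⟩ hne hi
    have e2 : s'.arr 2 = D := hf.arr 2 rfl
    have hdiv : 2 ^ T / 2 ^ i = 2 ^ (T - i) := Nat.pow_div (by omega) (by norm_num)
    have hs' := hs.frame hf (by decide) rfl rfl
    have hu : 2 ^ (T - i) ≤ 2 ^ T := Nat.pow_le_pow_right (by norm_num) (by omega)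
    refine Spec.seq (hA h hs' (u := 2 ^ (T - i)) (by positivity) (by omega) (by rw [e1, hdiv])
      (by rwa [e2]) j1 (fun idx hidx => (j2 idx hidx).1)) fun s1 hf1 ⟨q1, q2⟩ =>
      Spec.line [18, 9] H rfl (by omega) ?_ ?_ ?_
    · have g18 : s1.reg 18 = 2 ^ (T - i) := by rw [hf1.reg 18 rfl, e1, hdiv]
      have g9 : s1.reg 9 = 2 := by rw [hf1.reg 9 rfl, hs'.r9]
      simp [g18, g9]; omega
    · simp
    · have g18 : s1.reg 18 = 2 ^ T / 2 ^ i := by rw [hf1.reg 18 rfl, e1]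
      have g9 : s1.reg 9 = 2 := by rw [hf1.reg 9 rfl, hs'.r9]
      refine ⟨by simp [g18, g9, pow_succ, Nat.div_div_eq_div_mul], q1, fun idx hidx => ?_⟩
      obtain ⟨k1, k2, k3⟩ := j2 idx hidx
      have q3 := q2 idx hidx
      rw [e2] at q3
      simp only [Prog.ev, State.setReg_arr, q3]
      have hsv := scaleVal_le_maxEntry (K := K) (u := 2 ^ (T - i)) (by omega) D idx
      refine ⟨?_, ?_, fun r hr hri hne' => ?_⟩
      · rcases improve_cases (s'.arr 3 idx) (scaleVal K.n K.R K.B (2 ^ (T - i)) D idx)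
          with e | ⟨e, -⟩ <;> rw [e] <;> assumption
      · intro h0
        rcases improve_cases (s'.arr 3 idx) (scaleVal K.n K.R K.B (2 ^ (T - i)) D idx)
          with e | ⟨e, -⟩
        · rw [e] at h0 ⊢
          exact k2 h0
        · exact ⟨_, e⟩
      · rcases Nat.lt_or_ge T (r + i) with hlt | hge
        · obtain ⟨m1, m2⟩ := k3 r hr hlt hne'
          have m3 := improve_le_left (v := scaleVal K.n K.R K.B (2 ^ (T - i)) D idx) m1
          exact ⟨m3.1, m3.2.trans m2⟩
        · have : r = T - i := by omega
          subst this
          exact improve_le_right hne'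
  · have hw : 1 ≤ K.work := by unfold Consts.work; omega
    have h2 := le_mb H
    set k := Prog.kst (.op .div 18 18 9)
    have h3 : mb H ≤ K.work * mb H := Nat.le_mul_of_pos_left _ hw
    have h4 : k * mb H ≤ K.work * (k * mb H) := Nat.le_mul_of_pos_left _ hw
    have h5 : K.work * (A * mb H) + k * mb H + (1 + H) ≤
        K.work * (A * mb H) + K.work * (k * mb H) + 2 * (K.work * mb H) := by omega
    calc 1 + (T + 1) * (K.work * (A * mb H) + k * mb H + (1 + H))
        ≤ (K.work * mb H) + (2 * (K.τ + 1)) * (K.work * (A * mb H) + K.work * (k * mb H) +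
          2 * (K.work * mb H)) := by
          exact add_le_add (by omega) (Nat.mul_le_mul (show T + 1 ≤ 2 * (K.τ + 1) by omega) h5)
      _ ≤ (K.τ + 1) * (K.work * mb H) + (2 * (K.τ + 1)) * (K.work * (A * mb H) +
          K.work * (k * mb H) + 2 * (K.work * mb H)) := by
          exact Nat.add_le_add_right (Nat.le_mul_of_pos_left _ (by omega)) _
      _ = _ := by ring
  · rintro t - ⟨h0, i, e1, j1, j2⟩
    refine ⟨j1, fun idx hidx => ⟨(j2 idx hidx).1, (j2 idx hidx).2.1, fun r hr => ?_⟩⟩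
    refine (j2 idx hidx).2.2 r hr ?_
    rw [h0] at e1
    by_contra hc
    have : 2 ^ T / 2 ^ i = 2 ^ (T - i) := Nat.pow_div (by omega) (by norm_num)
    have : 0 < 2 ^ (T - i) := by positivity
    omega

theorem levelProg_spec : ∃ A : ℕ, ∀ {K : Consts} {b H : ℕ} (_ : K.Good b H) {s : State}
    (_ : K.Holds s) (_ : ∀ i < K.n * K.n, s.arr 2 i ≤ K.maxEntry) (_ : ∀ i, s.arr 4 i < K.N),
    Spec levelProg s ((A * (K.τ + 1) * K.work) * mb H) fun s' => (∀ i, s'.arr 4 i < K.N) ∧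
      ∀ idx < K.n * K.n, s'.arr 2 idx ≤ K.maxEntry ∧
        (s'.arr 2 idx ≠ 0 → ∃ r, s'.arr 2 idx = scaleVal K.n K.R K.B (2 ^ r) (s.arr 2) idx) ∧
        ∀ r ≤ 2 * K.τ + 1, scaleVal K.n K.R K.B (2 ^ r) (s.arr 2) idx ≠ 0 →
          s'.arr 2 idx ≠ 0 ∧
            s'.arr 2 idx ≤ scaleVal K.n K.R K.B (2 ^ r) (s.arr 2) idx := by
  obtain ⟨A, hA⟩ := scaleLoop_spec
  set k₁ := Prog.kst (.store 3 17 15) + 11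
  set k₂ := Prog.kst (.op .mul 18 8 8 ;; .op .add 18 18 18) with hk₂
  set k₃ := Prog.kst (.load 19 3 17 ;; .store 2 17 19) + 11
  refine ⟨k₁ + (k₂ + (A + k₃)), ?_⟩
  intro K b H h s hs hD hV
  have hH := h.H_pos
  have hM := h.maxEntry_lt
  have ht := h.t_lt
  refine Spec.mono (Spec.seq (clearLoop_spec h hs) fun s1 hf1 hQ1 =>
    Spec.seq (Q := fun s' => s'.reg 18 = 2 ^ (2 * K.τ + 1))
    (Spec.line [8] H rfl (by omega) ?_ ?_ ?_) fun s2 hf2 hQ2 =>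
    Spec.seq (hA h ((hs.frame hf1 (by decide) rfl rfl).frame hf2 (by decide) rfl rfl) hQ2 ?_ ?_ ?_)
    fun s3 hf3 hQ3 => (copyLoop_spec h (((hs.frame hf1 (by decide) rfl rfl).frame hf2
      (by decide) rfl rfl).frame hf3 (by decide) rfl rfl) fun i hi => (hQ3.2 i hi).1).conseq
      le_rfl ?_) ?_
  · simp [hf1.reg 8 rfl, hs.r8]; omega
  · simp
  · simp [hf1.reg 8 rfl, hs.r8]
    rw [h.t_eq]
    ring
  · rwa [hf2.arr 2 rfl, hf1.arr 2 rfl]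
  · rwa [hf2.arr 4 rfl, hf1.arr 4 rfl]
  · rwa [hf2.arr 3 rfl]
  · intro s4 hf4 hQ4
    rw [hf4.arr 4 rfl]
    refine ⟨hQ3.1, fun idx hidx => ?_⟩
    rw [hQ4 idx hidx]
    have := hQ3.2 idx hidx
    rwa [hf2.arr 2 rfl, hf1.arr 2 rfl] at this
  · have hw : 1 ≤ K.work := by unfold Consts.work; omega
    have h1 : K.work * (k₁ * mb H) ≤ (K.τ + 1) * (K.work * (k₁ * mb H)) :=
      Nat.le_mul_of_pos_left _ (by omega)
    have h2 : K.work * (k₃ * mb H) ≤ (K.τ + 1) * (K.work * (k₃ * mb H)) :=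
      Nat.le_mul_of_pos_left _ (by omega)
    have h3 : k₂ * mb H ≤ (K.τ + 1) * (K.work * (k₂ * mb H)) :=
      (Nat.le_mul_of_pos_left _ hw).trans (Nat.le_mul_of_pos_left _ (by omega))
    refine (add_le_add h1 (add_le_add h3 (add_le_add le_rfl h2))).trans (le_of_eq ?_)
    ring

/-- The main part of the algorithm: `τ` approximate squarings. -/
def mainLoop : Prog := .forDown 16 14 levelProg

/-- After `τ - k` squarings the matrix approximates the paths with `2 ^ (τ - k)` edges. All path
weights that occur are at most `t ^ 2`, and the errors at most double them, so the scales up to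
`2 * t ^ 2` suffice. -/
theorem mainLoop_spec : ∃ A : ℕ, ∀ {K : Consts} {b H : ℕ} (_ : K.Good b H) {s : State}
    (_ : K.Holds s) (G : WGraph K.n) (_ : G.maxWeight + 1 ≤ K.U)
    (_ : (1 + 4 / (K.R : ℝ)) ^ K.τ ≤ 2) (_ : Approx G 1 1 (s.arr 2))
    (_ : ∀ i < K.n * K.n, s.arr 2 i ≤ K.maxEntry) (_ : ∀ i, s.arr 4 i < K.N),
    Spec mainLoop s (A * ((K.τ + 1) ^ 2 * (K.work * mb H))) fun s' =>
      Approx G K.t ((1 + 4 / (K.R : ℝ)) ^ K.τ) (s'.arr 2) ∧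
      ∀ i < K.n * K.n, s'.arr 2 i ≤ K.maxEntry := by
  obtain ⟨A, hA⟩ := levelProg_spec
  refine ⟨A + 11, ?_⟩
  intro K b H h s hs G hU hR hG hD hV
  have hH := h.H_pos
  have hRpos : (1 : ℝ) ≤ 1 + 4 / (K.R : ℝ) := by
    have : 0 ≤ 4 / (K.R : ℝ) := by positivity
    linarith
  refine (Spec.forDown (A := A * (K.τ + 1) * K.work) (m := K.τ) (H := H) (r := 16) (src := 14)
    (fun k s' => Approx G (2 ^ (K.τ - k)) ((1 + 4 / (K.R : ℝ)) ^ (K.τ - k)) (s'.arr 2) ∧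
      (∀ i < K.n * K.n, s'.arr 2 i ≤ K.maxEntry) ∧ ∀ i, s'.arr 4 i < K.N)
    hs.r14 hs.r15 hs.r2 (by norm_num) rfl rfl (by omega) h.τ_lt
    ⟨by simpa using hG, hD, hV⟩ ?_).conseq ?_ ?_
  · rintro k s' s'' hk hf ⟨j1, j2, j3⟩ rfl
    have hs' := (hs.frame hf (by decide) rfl rfl).setReg (r := 16) (by norm_num) k
    refine (hA h hs' j2 j3).conseq le_rfl ?_
    rintro t - ⟨t1, t2⟩
    refine ⟨?_, fun i hi => (t2 i hi).1, t1⟩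
    have hk1 : K.τ - k = K.τ - (k + 1) + 1 := by omega
    rw [hk1, pow_succ' 2, pow_succ (1 + 4 / (K.R : ℝ))]
    refine j1.square (k := 2 * K.τ + 1) (B := K.B) h.n_lt h.two_le_R (by positivity) ?_
      (fun i hi => (t2 i hi).2.1) fun r hr i hi => (t2 i hi).2.2 r hr
    have h1 : (1 + 4 / (K.R : ℝ)) ^ (K.τ - (k + 1)) ≤ 2 :=
      (pow_le_pow_right₀ hRpos (by omega)).trans hR
    have h2 : G.maxWeight ≤ 2 ^ K.τ := by
      have h3 := h.thr_le
      rw [h.t_eq] at h3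
      have h4 : 1 * K.U ≤ 4 * K.n * K.U := Nat.mul_le_mul_right _ (by have := h.n_pos; omega)
      omega
    have h2' : (G.maxWeight : ℝ) ≤ 2 ^ K.τ := by exact_mod_cast h2
    have h5 : (2 : ℝ) * ((2 ^ (K.τ - (k + 1)) : ℕ) : ℝ) ≤ 2 ^ K.τ := by
      push_cast
      rw [← pow_succ']
      exact pow_le_pow_right₀ (by norm_num) (by omega)
    calc (1 + 4 / (K.R : ℝ)) ^ (K.τ - (k + 1)) *
          (2 * ((2 ^ (K.τ - (k + 1)) : ℕ) : ℝ) * G.maxWeight) ≤ 2 * (2 ^ K.τ * 2 ^ K.τ) := by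
          gcongr
      _ = 2 ^ (2 * K.τ + 1) := by ring
  · have hw : 1 ≤ (K.τ + 1) * K.work := Nat.mul_pos (by omega) (by unfold Consts.work; omega)
    calc (K.τ + 1) * ((A * (K.τ + 1) * K.work + 11) * mb H)
        ≤ (K.τ + 1) * ((A * (K.τ + 1) * K.work + 11 * ((K.τ + 1) * K.work)) * mb H) := by
          gcongr
          omega
      _ = _ := by ring
  · rintro t - ⟨-, h1, h2, -⟩
    rw [Nat.sub_zero, ← h.t_eq] at h1
    exact ⟨h1, h2⟩

/-! ### The output -/

/-- Improve the minimum in register `18` by the entry before the one that register `30` points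
to. -/
def rowBody : Prog :=
  .op .sub 30 30 2 ;; .load 19 2 30 ;;
  .ifz 19 (.const 24 0) (.ifz 18 (.op .add 18 19 15)
    (.op .sub 20 18 19 ;; .ifz 20 (.const 24 0) (.op .add 18 19 15)))

/-- Write the approximation for the vertex in register `16`, where the register `18` holds the
weight of a light path (plus one). -/
def outStore : Prog :=
  .op .sub 18 18 2 ;; .op .sub 20 18 10 ;; .ifz 20 (.const 18 0) (.const 24 0) ;;
  .store 0 16 18 ;; .store 1 16 31

/-- Compute the output for the vertex in register `16`. -/
def outBody : Prog := .const 18 0 ;; .forDown 17 0 rowBody ;; outStore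

/-- Compute the output for all vertices, from the last one to the first one. -/
def outLoop : Prog := (.op .add 30 1 15 ;; .op .sub 31 8 0) ;; .forDown 16 0 outBody

/-- `m` is a nonzero entry of the row `x` that is at most every nonzero entry in the columns
`y ≥ k`, or `m = 0` and there are no nonzero entries in these columns. -/
def RowMin (n : ℕ) (D : ℕ → ℕ) (x k m : ℕ) : Prop :=
  (m ≠ 0 → ∃ y < n, m = D (x * n + y)) ∧
    ∀ y < n, k ≤ y → D (x * n + y) ≠ 0 → m ≠ 0 ∧ m ≤ D (x * n + y)

theorem RowMin.step {n x k m : ℕ} {D : ℕ → ℕ} (h : RowMin n D x (k + 1) m) (hk : k < n) :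
    RowMin n D x k (improve m (D (x * n + k))) := by
  refine ⟨fun h0 => ?_, fun y hy hky hne => ?_⟩
  · rcases improve_cases m (D (x * n + k)) with e | ⟨e, -⟩
    · rw [e] at h0 ⊢
      exact h.1 h0
    · exact ⟨k, hk, e⟩
  · rcases Nat.eq_or_lt_of_le hky with rfl | hlt
    · exact improve_le_right hne
    · obtain ⟨h1, h2⟩ := h.2 y hy hlt hne
      have h3 := improve_le_left (v := D (x * n + k)) h1
      exact ⟨h3.1, h3.2.trans h2⟩

theorem rowBody_spec {K : Consts} {b H : ℕ} (h : K.Good b H) {s : State} (hs : K.Holds s) {p : ℕ}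
    (h30 : s.reg 30 = p + 1) (hp : p < K.n * K.n) (h18 : s.reg 18 ≤ K.maxEntry)
    (hD : s.arr 2 p ≤ K.maxEntry) :
    Spec rowBody s (rowBody.kst * mb H) fun s' => s'.reg 30 = p ∧
      s'.reg 18 = improve (s.reg 18) (s.arr 2 p) := by
  have hH := h.H_pos
  have hM := h.maxEntry_lt
  have hidx := h.index_lt
  refine Spec.line [30, 2, 18, 15] H rfl (by omega) ?_ ?_ ?_
  · simp [h30, hs.r2, hs.r15]; omega
  · simp only [rowBody, Prog.ev, Prog.loads]
    simp [h30, hs.r2]; omega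
  · simp only [rowBody, Prog.ev]
    simp [h30, hs.r2, hs.r15]
    unfold improve
    split_ifs <;> first | rfl | omega

theorem outBody_spec : ∃ A : ℕ, ∀ {K : Consts} {b H : ℕ} (_ : K.Good b H) {s : State}
    (_ : K.Holds s) {x : ℕ} (_ : x < K.n) (_ : s.reg 16 = x) (_ : s.reg 30 = x * K.n + K.n)
    (_ : s.reg 31 = K.t - K.n) (_ : ∀ i < K.n * K.n, s.arr 2 i ≤ K.maxEntry),
    Spec outBody s (((K.n + 1) * A) * mb H) fun s' => s'.reg 30 = x * K.n ∧
      (∀ y, s'.arr 1 y = if y = x then K.t - K.n else s.arr 1 y) ∧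
      ∃ m, RowMin K.n (s.arr 2) x 0 m ∧
        ∀ y, s'.arr 0 y = if y = x then (if m - 1 ≤ 4 * K.n * K.U then 0 else m - 1)
          else s.arr 0 y := by
  refine ⟨Prog.kst (.const 18 0) + ((rowBody.kst + 11) + outStore.kst), ?_⟩
  intro K b H h s hs x hx h16 h30 h31 hD
  have hH := h.H_pos
  have hM := h.maxEntry_lt
  have hidx := h.index_lt
  have ht := h.t_lt
  have hthr := h.thr_le
  have hxn : ∀ k < K.n, x * K.n + k < K.n * K.n := fun k hk => by
    have h1 := Nat.mul_le_mul_right K.n (show x + 1 ≤ K.n from hx)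
    rw [add_mul] at h1
    omega
  have hnn : K.n ≤ K.n * K.n := Nat.le_mul_self _
  refine Spec.mono (Spec.seq (Q := fun s' => s'.reg 18 = 0)
    (Spec.line [] H rfl (by omega) (by simp) (by simp) (by simp)) fun s1 hf1 h1 =>
    Spec.seq (Spec.forDown (A := rowBody.kst) (m := K.n) (H := H) (r := 17) (src := 0)
      (fun k s' => s'.reg 30 = x * K.n + k ∧ s'.reg 18 ≤ K.maxEntry ∧
        RowMin K.n (s.arr 2) x k (s'.reg 18))
      (by rw [hf1.reg 0 rfl, hs.r0]) (by rw [hf1.reg 15 rfl, hs.r15])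
      (by rw [hf1.reg 2 rfl, hs.r2]) (by norm_num) rfl rfl (by omega) (by omega) ?_ ?_)
    fun s2 hf2 ⟨_, q1, q2, q3⟩ => Spec.line [18, 2, 10, 16, 31] H rfl (by omega) ?_ ?_
      (⟨?_, ?_, s2.reg 18, q3, ?_⟩ : _ ∧ _ ∧ _)) ?_
  · refine ⟨by simp [hf1.reg 30 rfl, h30], by simp [h1], ?_⟩
    simp only [State.setReg_reg, h1]
    exact ⟨fun h0 => absurd rfl h0, fun y hy hky => by omega⟩
  · rintro k s' s'' hk hf ⟨j1, j2, j3⟩ rfl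
    have hs' := ((hs.frame hf1 (by decide) rfl rfl).frame hf (by decide) rfl rfl).setReg
      (r := 17) (by norm_num) k
    have e2 : s'.arr 2 = s.arr 2 := by rw [hf.arr 2 rfl, hf1.arr 2 rfl]
    have hle := hD _ (hxn k hk)
    refine (rowBody_spec h hs' (p := x * K.n + k) (by simp [j1]; omega) (hxn k hk)
      (by simpa using j2) (by simpa [e2] using hle)).conseq le_rfl ?_
    rintro t - ⟨t1, t2⟩
    simp [e2] at t2
    refine ⟨t1, ?_, ?_⟩
    · rw [t2]
      rcases improve_cases (s'.reg 18) (s.arr 2 (x * K.n + k)) with e | ⟨e, -⟩ <;>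
        rw [e] <;> assumption
    · rw [t2]
      exact j3.step hk
  · have hs2 := (hs.frame hf1 (by decide) rfl rfl).frame hf2 (by decide) rfl rfl
    simp [hs2.r2, hs2.r10, hf2.reg 16 rfl, hf1.reg 16 rfl, hf2.reg 31 rfl, hf1.reg 31 rfl, h16,
      h31]
    omega
  · simp only [outStore, Prog.ev, Prog.loads]
    simp
  · simp only [outStore, Prog.ev]
    simp [q1]
  · have hs2 := (hs.frame hf1 (by decide) rfl rfl).frame hf2 (by decide) rfl rfl
    simp only [outStore, Prog.ev]
    simp [hf2.reg 16 rfl, hf1.reg 16 rfl, hf2.reg 31 rfl, hf1.reg 31 rfl, h16, h31,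
      hf2.arr 1 rfl, hf1.arr 1 rfl]
  · have hs2 := (hs.frame hf1 (by decide) rfl rfl).frame hf2 (by decide) rfl rfl
    intro y
    simp only [outStore, Prog.ev]
    simp [hf2.reg 16 rfl, hf1.reg 16 rfl, h16, hs2.r2, hs2.r10, hf2.arr 0 rfl, hf1.arr 0 rfl]
    split_ifs <;> first | rfl | omega
  · have h3 : ∀ c : ℕ, c * mb H ≤ (K.n + 1) * (c * mb H) :=
      fun c => Nat.le_mul_of_pos_left _ (by omega)
    refine (add_le_add (h3 _) (add_le_add le_rfl (h3 _))).trans (le_of_eq ?_)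
    ring

theorem outLoop_spec : ∃ A : ℕ, ∀ {K : Consts} {b H : ℕ} (_ : K.Good b H) {s : State}
    (_ : K.Holds s) (_ : ∀ i < K.n * K.n, s.arr 2 i ≤ K.maxEntry),
    Spec outLoop s (A * (K.work * mb H)) fun s' => ∀ x < K.n,
      s'.arr 1 x = K.t - K.n ∧ ∃ m, RowMin K.n (s.arr 2) x 0 m ∧
        s'.arr 0 x = if m - 1 ≤ 4 * K.n * K.U then 0 else m - 1 := by
  obtain ⟨A, hA⟩ := outBody_spec
  set k₁ := Prog.kst (.op .add 30 1 15 ;; .op .sub 31 8 0) with hk₁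
  refine ⟨k₁ + 4 * (A + 11), ?_⟩
  intro K b H h s hs hD
  have hH := h.H_pos
  have hM := h.maxEntry_lt
  have hidx := h.index_lt
  have ht := h.t_lt
  have hnn : K.n ≤ K.n * K.n := Nat.le_mul_self _
  refine (Spec.seq (Q := fun s' => s'.reg 30 = K.n * K.n ∧ s'.reg 31 = K.t - K.n)
    (Spec.line [1, 15, 8, 0] H rfl (by omega) ?_ ?_ ?_) fun s1 hf1 h1 =>
    Spec.forDown (A := (K.n + 1) * A) (m := K.n) (H := H) (r := 16) (src := 0)
      (fun k s' => s'.reg 30 = k * K.n ∧ s'.reg 31 = K.t - K.n ∧ ∀ x < K.n, k ≤ x →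
        s'.arr 1 x = K.t - K.n ∧ ∃ m, RowMin K.n (s.arr 2) x 0 m ∧
        s'.arr 0 x = if m - 1 ≤ 4 * K.n * K.U then 0 else m - 1)
      (by rw [hf1.reg 0 rfl, hs.r0]) (by rw [hf1.reg 15 rfl, hs.r15])
      (by rw [hf1.reg 2 rfl, hs.r2]) (by norm_num) rfl rfl (by omega) (by omega)
      ⟨by simp [h1.1], by simp [h1.2], fun x hx hx' => by omega⟩ ?_).conseq ?_ ?_
  · simp [hs.r1, hs.r15, hs.r8, hs.r0]; omega
  · simp
  · simp [hs.r1, hs.r15, hs.r8, hs.r0]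
  · rintro k s' s'' hk hf ⟨j1, j2, j3⟩ rfl
    have hs' := ((hs.frame hf1 (by decide) rfl rfl).frame hf (by decide) rfl rfl).setReg
      (r := 16) (by norm_num) k
    have e2 : s'.arr 2 = s.arr 2 := by rw [hf.arr 2 rfl, hf1.arr 2 rfl]
    refine (hA h hs' hk (by simp) (by simp [j1, add_mul]) (by simp [j2])
      (by simpa [e2] using hD)).conseq le_rfl ?_
    rintro t hft ⟨t1, t2, m, t3, t4⟩
    simp [e2] at t2 t3 t4
    refine ⟨t1, by rw [hft.reg 31 rfl]; simpa using j2, fun x hx hkx => ?_⟩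
    rw [t2, t4]
    by_cases hxk : x = k
    · subst hxk
      exact ⟨by simp, m, t3, by simp⟩
    · rw [if_neg hxk, if_neg hxk]
      exact j3 x hx (by omega)
  · have hn := h.n_pos
    have hw : 1 ≤ K.work := by unfold Consts.work; omega
    have h3 : (K.n + 1) * (K.n + 1) ≤ 4 * K.work := by unfold Consts.work; nlinarith
    calc k₁ * mb H + (K.n + 1) * (((K.n + 1) * A + 11) * mb H)
        ≤ K.work * (k₁ * mb H) + (K.n + 1) * (((K.n + 1) * A + 11 * (K.n + 1)) * mb H) := by
          refine add_le_add (Nat.le_mul_of_pos_left _ hw) ?_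
          gcongr
          omega
      _ = K.work * (k₁ * mb H) + ((K.n + 1) * (K.n + 1)) * ((A + 11) * mb H) := by ring
      _ ≤ K.work * (k₁ * mb H) + (4 * K.work) * ((A + 11) * mb H) := by gcongr
      _ = _ := by ring
  · rintro t - ⟨-, -, -, h3⟩ x hx
    exact h3 x hx (Nat.zero_le _)

/-! ### Computing the constants -/

/-- Write down the straight-line program for the matrix multiplication, with the given generator `P`
moved out of the way to the registers and arrays from number `64` on. -/
def generate (P : Prog) : Prog := .op .add 64 0 15 ;; P.shift 64

/-- The registers and arrays with numbers below `64` survive, and the straight-line program ends up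
in the array `64`. -/
theorem generate_spec {P : Prog} {n c : ℕ} {gs : List Gate} {s₁ : State}
    (hP : Exec P (natInput n) s₁ c) (hgs : s₁.Describes gs) (G : WGraph n) (ε : ℝ) :
    Spec (generate P) (G.input ε) (1 + n.size + c) fun s =>
      s.reg 0 = n ∧ (∀ r, 0 < r → r < 64 → s.reg r = 0) ∧
      s.arr 0 = (G.input ε).arr 0 ∧ s.arr 1 = (G.input ε).arr 1 ∧
      (∀ a, 1 < a → a < 64 → s.arr a = fun _ => 0) ∧ s.reg 64 = gs.length ∧
      ∀ (k : ℕ) (g : Gate), gs[k]? = some g →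
        (s.arr 64 (3 * k), s.arr 64 (3 * k + 1), s.arr 64 (3 * k + 2)) = g.code := by
  have h0 : (G.input ε).reg 0 = n := rfl
  have h15 : (G.input ε).reg 15 = 0 := rfl
  refine Spec.seq (Q := fun s' => s' = (G.input ε).setReg 64 n)
    ⟨_, _, Exec.op _ _ _ _ _, by simp [Op.cost, h0, h15], by simp [h0, h15]⟩ ?_
  rintro s' - rfl
  obtain ⟨S, hS, hr, ha⟩ := hP.shift 64 ((G.input ε).setReg 64 n)
    (fun r => by
      simp only [State.setReg_reg, natInput]
      split_ifs <;> first | rfl | omega | simp [WGraph.input])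
    (fun a => by
      funext k
      simp [WGraph.input, natInput]
      intro h
      omega)
  have hf := hS.frame
  have fr : ∀ k < 64, S.reg k = ((G.input ε).setReg 64 n).reg k := fun k hk =>
    hf.reg k (Prog.writesReg_shift hk P)
  have fa : ∀ k < 64, S.arr k = (G.input ε).arr k := fun k hk =>
    hf.arr k (Prog.writesArr_shift hk P)
  refine ⟨S, c, hS, le_rfl, ?_, fun r h1 h2 => ?_, fa 0 (by norm_num), fa 1 (by norm_num),
    fun a h1 h2 => ?_, ?_, ?_⟩
  · rw [fr 0 (by norm_num)]; rfl
  · rw [fr r h2, State.setReg_reg, if_neg (by omega)]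
    simp [WGraph.input]; omega
  · rw [fa a h2]
    funext k
    simp [WGraph.input, show a ≠ 0 by omega, show a ≠ 1 by omega]
  · have := hr 0
    rw [← hgs.1]
    exact this
  · have := ha 0
    simp only [add_zero] at this
    rw [this]
    exact hgs.2

/-- The state before the constants are computed: `cell` are the weights and `dig` the digits of
the input. -/
structure Ready (K : Consts) (cell dig : ℕ → ℕ) (s : State) : Prop where
  r0 : s.reg 0 = K.n
  r15 : s.reg 15 = 0
  r64 : s.reg 64 = K.gs.length
  gates : ∀ (k : ℕ) (g : Gate), K.gs[k]? = some g →
    (s.arr 64 (3 * k), s.arr 64 (3 * k + 1), s.arr 64 (3 * k + 2)) = g.code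
  cells : s.arr 0 = cell
  digits : s.arr 1 = dig
  zeros : s.arr 4 = fun _ => 0

theorem Ready.frame {K : Consts} {cell dig : ℕ → ℕ} {p : Prog} {s s' : State}
    (h : Ready K cell dig s) (hf : Frame p s s') (h0 : p.writesReg 0 = false)
    (h15 : p.writesReg 15 = false) (h64 : p.writesReg 64 = false) (a0 : p.writesArr 0 = false)
    (a1 : p.writesArr 1 = false) (a4 : p.writesArr 4 = false) (a64 : p.writesArr 64 = false) :
    Ready K cell dig s' := by
  refine ⟨?_, ?_, ?_, ?_, ?_, ?_, ?_⟩
  · rw [hf.reg 0 h0, h.r0]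
  · rw [hf.reg 15 h15, h.r15]
  · rw [hf.reg 64 h64, h.r64]
  · rw [hf.arr 64 a64]; exact h.gates
  · rw [hf.arr 0 a0, h.cells]
  · rw [hf.arr 1 a1, h.digits]
  · rw [hf.arr 4 a4, h.zeros]

/-- The values of the constants for the input `cell`, `dig`, where `dig j` is the first nonzero
digit. -/
structure Chosen (K : Consts) (b H j : ℕ) (cell dig : ℕ → ℕ) : Prop where
  good : K.Good b H
  U_eq : K.U = 1 + ∑ i ∈ Finset.range (K.n * K.n), cell i
  dig_lt : ∀ i < j, dig i = 0
  dig_eq : dig j = 1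
  τ_eq : K.τ = Nat.clog 2 (64 * (K.n * K.n * K.U * 2 ^ j))
  R_eq : K.R = 32 * (K.τ * 2 ^ j)
  B_eq : K.B = 2 ^ b
  b_eq : b = Nat.clog 2 (K.n + 1)
  L_eq : K.L = Nat.clog 2 (2 * K.R + 1)

theorem two_pow_lt_iff_lt_clog {i x : ℕ} : 2 ^ i < x ↔ i < Nat.clog 2 x :=
  (Nat.lt_clog_iff_pow_lt (by norm_num)).symm

namespace Chosen

variable {K : Consts} {b H j : ℕ} {cell dig : ℕ → ℕ}

theorem U_pos (h : Chosen K b H j cell dig) : 1 ≤ K.U := by rw [h.U_eq]; omega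

theorem le_t (h : Chosen K b H j cell dig) : 64 * (K.n * K.n * K.U * 2 ^ j) ≤ K.t := by
  rw [h.good.t_eq, h.τ_eq]
  exact Nat.le_pow_clog (by norm_num) _

theorem factors_le (h : Chosen K b H j cell dig) :
    2 ^ j ≤ K.n * K.n * K.U * 2 ^ j ∧ K.n * K.n * K.U ≤ K.n * K.n * K.U * 2 ^ j ∧
      K.U ≤ K.n * K.n * K.U ∧ K.n * K.n ≤ K.n * K.n * K.U ∧ K.n ≤ K.n * K.n := by
  have h1 := h.good.n_pos
  have h2 := h.U_pos
  have h3 : 1 ≤ K.n * K.n := Nat.mul_pos h1 h1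
  have h4 : 1 ≤ K.n * K.n * K.U := Nat.mul_pos h3 h2
  exact ⟨Nat.le_mul_of_pos_left _ h4, Nat.le_mul_of_pos_right _ (by positivity),
    Nat.le_mul_of_pos_left _ h3, Nat.le_mul_of_pos_right _ h2, Nat.le_mul_self _⟩

theorem j_le_τ (h : Chosen K b H j cell dig) : j ≤ K.τ := by
  have h1 := h.factors_le
  have h2 := h.le_t
  rw [h.good.t_eq] at h2
  exact (Nat.pow_le_pow_iff_right (a := 2) (by norm_num)).1 (by omega)

theorem b_le_τ (h : Chosen K b H j cell dig) : b ≤ K.τ := by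
  have h1 := h.factors_le
  have h2 := h.le_t
  have h3 : 0 < 2 ^ j := by positivity
  rw [h.b_eq, Nat.clog_le_iff_le_pow (by norm_num), ← h.good.t_eq]
  omega

theorem L_le (h : Chosen K b H j cell dig) : K.L ≤ 2 * K.τ + 7 := by
  rw [h.L_eq, Nat.clog_le_iff_le_pow (by norm_num), h.R_eq]
  have h1 : 2 ^ j ≤ 2 ^ K.τ := Nat.pow_le_pow_right (by norm_num) h.j_le_τ
  have h2 : K.τ ≤ 2 ^ K.τ := Nat.lt_two_pow_self.le
  have h3 : K.τ * 2 ^ j ≤ 2 ^ K.τ * 2 ^ K.τ := Nat.mul_le_mul h2 h1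
  have h4 : 0 < 2 ^ K.τ * 2 ^ K.τ := by positivity
  calc 2 * (32 * (K.τ * 2 ^ j)) + 1 ≤ 2 ^ 7 * (2 ^ K.τ * 2 ^ K.τ) := by omega
    _ = 2 ^ (2 * K.τ + 7) := by ring

end Chosen

/-- Copy the matrix to the array `2` and add up its entries; then compute the power of two in
register `18` whose inverse is the first binary digit of `ε`. -/
def readInput : Prog :=
  (.const 2 1 ;; .const 9 2 ;; .op .mul 1 0 0 ;; .op .add 7 64 15 ;; .const 17 1) ;;
  .forDown 16 1 (.load 18 0 16 ;; .store 2 16 18 ;; .op .add 17 17 18) ;;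
  (.const 18 1 ;; .const 19 0 ;; .load 20 1 19 ;; .op .sub 20 2 20) ;;
  .loop 20 (.op .add 18 18 18 ;; .op .add 19 19 2 ;; .load 20 1 19 ;; .op .sub 20 2 20)

/-- The cost of a loop with `O(τ)` passes. -/
theorem loop_cost_le {m k H τ w c : ℕ} (hm : m ≤ c * (τ + 1)) (hw : 1 ≤ w) (hH : 3 ≤ H) :
    1 + m * (k * mb H + (1 + H)) ≤ ((c + 1) * (k + 2)) * ((τ + 1) * (w * mb H)) := by
  have h1 := le_mb H
  have h2 : mb H ≤ w * mb H := Nat.le_mul_of_pos_left _ hw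
  calc 1 + m * (k * mb H + (1 + H)) ≤ 1 * ((k + 2) * mb H) + c * (τ + 1) * ((k + 2) * mb H) := by
        refine add_le_add (by nlinarith) (Nat.mul_le_mul hm (by nlinarith))
    _ ≤ (τ + 1) * ((k + 2) * mb H) + c * (τ + 1) * ((k + 2) * mb H) := by
        gcongr
        omega
    _ = ((c + 1) * (k + 2)) * ((τ + 1) * mb H) := by ring
    _ ≤ _ := by gcongr

/-- The cost of a program without loops. -/
theorem line_cost_le {k H τ w : ℕ} (hw : 1 ≤ w) :
    k * mb H ≤ k * ((τ + 1) * (w * mb H)) := by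
  gcongr
  exact (Nat.le_mul_of_pos_left _ hw).trans (Nat.le_mul_of_pos_left _ (by omega))

theorem readInput_spec : ∃ A : ℕ, ∀ {K : Consts} {b H j : ℕ} {cell dig : ℕ → ℕ}
    (_ : Chosen K b H j cell dig) {s : State} (_ : Ready K cell dig s),
    Spec readInput s (A * ((K.τ + 1) * (K.work * mb H))) fun s' =>
      s'.reg 1 = K.n * K.n ∧ s'.reg 2 = 1 ∧ s'.reg 7 = K.gs.length ∧ s'.reg 9 = 2 ∧
      s'.reg 17 = K.U ∧ s'.reg 18 = 2 ^ j ∧ ∀ i < K.n * K.n, s'.arr 2 i = cell i := by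
  set k₁ := Prog.kst (.const 2 1 ;; .const 9 2 ;; .op .mul 1 0 0 ;; .op .add 7 64 15 ;; .const 17 1)
    with hk₁
  set k₂ := Prog.kst (.load 18 0 16 ;; .store 2 16 18 ;; .op .add 17 17 18) with hk₂
  set k₃ := Prog.kst (.const 18 1 ;; .const 19 0 ;; .load 20 1 19 ;; .op .sub 20 2 20) with hk₃
  set k₄ := Prog.kst (.op .add 18 18 18 ;; .op .add 19 19 2 ;; .load 20 1 19 ;; .op .sub 20 2 20)
    with hk₄
  refine ⟨k₁ + ((k₂ + 11) + (k₃ + (1 + 1) * (k₄ + 2))), ?_⟩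
  intro K b H j cell dig h s hs
  have hg := h.good
  have hH := hg.H_pos
  have hM := hg.maxEntry_lt
  have hidx := hg.index_lt
  have ht := hg.t_lt
  have hfac := h.factors_le
  have hXt := h.le_t
  have hH8 : 2 ^ 3 ≤ 2 ^ H := Nat.pow_le_pow_right (by norm_num) hH
  have hj1 : j < 2 ^ j := Nat.lt_two_pow_self
  have hw : 1 ≤ K.work := by unfold Consts.work; omega
  have hUsum : ∀ k ≤ K.n * K.n, 1 + ∑ i ∈ Finset.Ico k (K.n * K.n), cell i ≤ K.U := by
    intro k hk
    rw [h.U_eq, Finset.range_eq_Ico]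
    gcongr
    omega
  have hcell : ∀ i < K.n * K.n, cell i ≤ K.U := by
    intro i hi
    rw [h.U_eq]
    have := Finset.single_le_sum (f := cell) (fun _ _ => Nat.zero_le _) (Finset.mem_range.2 hi)
    omega
  have hdig : ∀ i ≤ j, dig i = if i = j then 1 else 0 := by
    intro i hi
    split_ifs with hij
    · rw [hij, h.dig_eq]
    · exact h.dig_lt i (by omega)
  refine (Spec.seq (Q := fun s' => s'.reg 1 = K.n * K.n ∧ s'.reg 2 = 1 ∧ s'.reg 7 = K.gs.length ∧
      s'.reg 9 = 2 ∧ s'.reg 17 = 1)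
    (Spec.line [0, 64, 15] H rfl (by omega) ?_ ?_ ?_) fun s1 hf1 h1 =>
    Spec.seq (Spec.forDown (A := k₂) (m := K.n * K.n) (H := H) (r := 16) (src := 1)
      (fun k s' => s'.reg 17 = 1 + ∑ i ∈ Finset.Ico k (K.n * K.n), cell i ∧
        ∀ i < K.n * K.n, k ≤ i → s'.arr 2 i = cell i)
      h1.1 (by rw [hf1.reg 15 rfl, hs.r15]) h1.2.1 (by norm_num) rfl rfl (by omega) (by omega)
      ⟨by simp [h1], fun i hi hi' => by omega⟩ ?_) fun s2 hf2 h2 =>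
    Spec.seq (Q := fun s' => s'.reg 18 = 2 ^ 0 ∧ s'.reg 19 = 0 ∧ s'.reg 20 = 1 - dig 0)
    (Spec.line [2] H rfl (by omega) ?_ ?_ ?_) fun s3 hf3 h3 =>
    (Spec.loop_const (m := j) (d := k₄ * mb H) (g := 1 + H)
      (fun i s' => i ≤ j ∧ s'.reg 18 = 2 ^ i ∧ s'.reg 19 = i ∧ s'.reg 20 = 1 - dig i)
      ⟨Nat.zero_le _, h3⟩ ?_ ?_).conseq le_rfl ?_).mono ?_
  · simp [hs.r0, hs.r64, hs.r15]; omega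
  · simp
  · simp [hs.r0, hs.r64, hs.r15]
  · rintro k s' s'' hk hf ⟨j1, j2⟩ rfl
    have e0 : s'.arr 0 = cell := by rw [hf.arr 0 rfl, hf1.arr 0 rfl, hs.cells]
    have hc := hcell k hk
    have hU := hUsum (k + 1) hk
    refine Spec.line [16, 17] H rfl (by omega) ?_ ?_ ?_
    · simp [j1]; omega
    · simp [e0]; omega
    · refine ⟨?_, fun i hi hki => ?_⟩
      · simp [j1, e0]
        rw [Finset.sum_eq_sum_Ico_succ_bot hk]
        ring
      · simp [e0]
        split_ifs with hik
        · rw [hik]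
        · exact j2 i hi (by omega)
  · have : s2.reg 2 = 1 := by rw [hf2.reg 2 rfl, h1.2.1]
    simp [this]; omega
  · have : s2.arr 1 = dig := by rw [hf2.arr 1 rfl, hf1.arr 1 rfl, hs.digits]
    simp [this, hdig 0 (Nat.zero_le _)]
    split_ifs <;> omega
  · have e1 : s2.arr 1 = dig := by rw [hf2.arr 1 rfl, hf1.arr 1 rfl, hs.digits]
    have e2 : s2.reg 2 = 1 := by rw [hf2.reg 2 rfl, h1.2.1]
    simp [e1, e2]
  · rintro i s' - ⟨i1, i2, i3, i4⟩ hne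
    refine ⟨?_, ?_⟩
    · rcases Nat.eq_or_lt_of_le i1 with rfl | hlt
      · rw [i4, h.dig_eq] at hne
        exact absurd rfl hne
      · exact hlt
    · have : (s'.reg 20).size ≤ H := by
        rw [Nat.size_le, i4]
        omega
      omega
  · rintro i s' hf ⟨i1, i2, i3, i4⟩ hne hij
    have e1 : s'.arr 1 = dig := by
      rw [hf.arr 1 rfl, hf3.arr 1 rfl, hf2.arr 1 rfl, hf1.arr 1 rfl, hs.digits]
    have e2 : s'.reg 2 = 1 := by rw [hf.reg 2 rfl, hf3.reg 2 rfl, hf2.reg 2 rfl, h1.2.1]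
    have hpow : 2 ^ i ≤ 2 ^ j := Nat.pow_le_pow_right (by norm_num) i1
    have hiH : i < H := (Nat.pow_lt_pow_iff_right (a := 2) (by norm_num)).1 (by omega)
    refine Spec.line [18, 19, 2] H rfl (by omega) ?_ ?_ ?_
    · simp [e2, i2, i3]; omega
    · simp [e1, e2, i3, hdig (i + 1) hij]
      split_ifs <;> omega
    · simp [e1, e2, i2, i3, pow_succ]
      omega
  · rintro s4 hf4 ⟨h0, i, i1, i2, i3, i4⟩
    have hij : i = j := by
      by_contra hne
      rw [i4, h.dig_lt i (by omega)] at h0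
      omega
    subst hij
    refine ⟨?_, ?_, ?_, ?_, ?_, i2, fun k hk => ?_⟩
    · rw [hf4.reg 1 rfl, hf3.reg 1 rfl, hf2.reg 1 rfl, h1.1]
    · rw [hf4.reg 2 rfl, hf3.reg 2 rfl, hf2.reg 2 rfl, h1.2.1]
    · rw [hf4.reg 7 rfl, hf3.reg 7 rfl, hf2.reg 7 rfl, h1.2.2.1]
    · rw [hf4.reg 9 rfl, hf3.reg 9 rfl, hf2.reg 9 rfl, h1.2.2.2.1]
    · rw [hf4.reg 17 rfl, hf3.reg 17 rfl, h2.2.1, h.U_eq, Finset.range_eq_Ico]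
    · rw [hf4.arr 2 rfl, hf3.arr 2 rfl, h2.2.2 k hk (Nat.zero_le _)]
  · have h5 : (K.n * K.n + 1) * ((k₂ + 11) * mb H) ≤
        (k₂ + 11) * ((K.τ + 1) * (K.work * mb H)) := by
      calc (K.n * K.n + 1) * ((k₂ + 11) * mb H) ≤ K.work * ((k₂ + 11) * mb H) := by
            gcongr
            unfold Consts.work
            omega
        _ = (k₂ + 11) * (K.work * mb H) := by ring
        _ ≤ _ := Nat.mul_le_mul_left _ (Nat.le_mul_of_pos_left _ (by omega))
    have h6 := loop_cost_le (m := j) (k := k₄) (c := 1) (τ := K.τ) (w := K.work) (H := H)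
      (by have := h.j_le_τ; omega) hw hH
    refine (add_le_add (line_cost_le (τ := K.τ) hw) (add_le_add h5
      (add_le_add (line_cost_le (τ := K.τ) hw) h6))).trans
      (le_of_eq ?_)
    ring

/-- Compute in register `22` the least power of two that is at least the content of register `23`,
and in register `25` its exponent. -/
def doubleUntil : Prog :=
  (.const 22 1 ;; .const 25 0 ;; .op .sub 24 23 22) ;;
  .loop 24 (.op .add 22 22 22 ;; .op .add 25 25 2 ;; .op .sub 24 23 22)

theorem doubleUntil_spec : ∃ A : ℕ, ∀ {x τ w H : ℕ} {s : State}, s.reg 2 = 1 → s.reg 23 = x →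
    x < 2 ^ H → 2 ^ Nat.clog 2 x < 2 ^ H → Nat.clog 2 x ≤ 7 * (τ + 1) → 1 ≤ w → 3 ≤ H →
    Spec doubleUntil s (A * ((τ + 1) * (w * mb H))) fun s' =>
      s'.reg 22 = 2 ^ Nat.clog 2 x ∧ s'.reg 25 = Nat.clog 2 x := by
  set k₁ := Prog.kst (.const 22 1 ;; .const 25 0 ;; .op .sub 24 23 22) with hk₁
  set k₂ := Prog.kst (.op .add 22 22 22 ;; .op .add 25 25 2 ;; .op .sub 24 23 22) with hk₂
  refine ⟨k₁ + (7 + 1) * (k₂ + 2), ?_⟩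
  intro x τ w H s h2 h23 hx hpow hlog hw hH
  refine (Spec.seq (Q := fun s' => s'.reg 22 = 2 ^ 0 ∧ s'.reg 25 = 0 ∧ s'.reg 24 = x - 2 ^ 0)
    (Spec.line [23] H rfl (by omega) (by simpa [h23] using hx) (by simp) (by simp [h23]))
    fun s1 hf1 h1 => (Spec.loop_const (m := Nat.clog 2 x) (d := k₂ * mb H) (g := 1 + H)
      (fun i s' => i ≤ Nat.clog 2 x ∧ s'.reg 22 = 2 ^ i ∧ s'.reg 25 = i ∧ s'.reg 24 = x - 2 ^ i)
      ⟨Nat.zero_le _, h1⟩ ?_ ?_).conseq le_rfl ?_).mono ?_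
  · rintro i s' - ⟨-, -, -, i4⟩ hne
    refine ⟨two_pow_lt_iff_lt_clog.1 (by omega), ?_⟩
    have : (s'.reg 24).size ≤ H := by
      rw [Nat.size_le, i4]
      exact (Nat.sub_le _ _).trans_lt hx
    omega
  · rintro i s' hf ⟨i1, i2, i3, i4⟩ hne hi
    have e2 : s'.reg 2 = 1 := by rw [hf.reg 2 rfl, hf1.reg 2 rfl, h2]
    have e23 : s'.reg 23 = x := by rw [hf.reg 23 rfl, hf1.reg 23 rfl, h23]
    have h3 : 2 ^ i ≤ 2 ^ Nat.clog 2 x := Nat.pow_le_pow_right (by norm_num) i1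
    have h4 : i < 2 ^ i := Nat.lt_two_pow_self
    refine Spec.line [2, 22, 23, 25] H rfl (by omega) ?_ (by simp) ?_
    · simp only [List.forall_mem_cons, e2, i2, i3, e23]
      exact ⟨by omega, by omega, hx, by omega, by simp⟩
    · refine ⟨hi, ?_⟩
      simp [e2, e23, i2, i3, pow_succ]
      omega
  · rintro s' - ⟨h0, i, i1, i2, i3, i4⟩
    have h5 : ¬ i < Nat.clog 2 x := by
      rw [← two_pow_lt_iff_lt_clog]
      omega
    obtain rfl : i = Nat.clog 2 x := by omega
    exact ⟨i2, i3⟩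
  · refine (add_le_add (line_cost_le (τ := τ) hw) (loop_cost_le hlog hw hH)).trans (le_of_eq ?_)
    ring

namespace Chosen

variable {K : Consts} {b H j : ℕ} {cell dig : ℕ → ℕ}

theorem two_pow_clog_eq (h : Chosen K b H j cell dig) :
    2 ^ Nat.clog 2 (64 * (K.n * K.n * K.U * 2 ^ j)) = K.t := by
  rw [h.good.t_eq, h.τ_eq]

end Chosen

/-- Compute the remaining constants from `U` in register `17` and the power of two in `18`. -/
def prepare : Prog :=
  (.op .mul 21 1 17 ;; .op .mul 21 21 18 ;; .const 22 64 ;; .op .mul 23 22 21) ;;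
  doubleUntil ;;
  (.op .add 8 22 15 ;; .op .add 14 25 15 ;; .const 22 32 ;; .op .mul 3 14 18 ;; .op .mul 3 22 3 ;;
    .op .add 6 3 3 ;; .op .add 23 0 2) ;;
  doubleUntil ;;
  (.op .add 11 22 15 ;; .op .add 4 22 15 ;; .op .add 23 6 2) ;;
  doubleUntil ;;
  (.op .add 5 25 15 ;; .const 26 0 ;; .store 5 26 4 ;; .op .add 24 5 15) ;;
  .loop 24 (.op .mul 4 4 4 ;; .op .add 26 26 2 ;; .op .sub 24 24 2 ;; .store 5 26 4) ;;
  (.op .mul 10 0 17 ;; .op .add 10 10 10 ;; .op .add 10 10 10 ;; .op .add 12 1 1 ;;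
    .op .add 13 1 7)

theorem prepare_spec : ∃ A : ℕ, ∀ {K : Consts} {b H j : ℕ} {cell dig : ℕ → ℕ}
    (_ : Chosen K b H j cell dig) {s : State} (_ : Ready K cell dig s) (_ : s.reg 1 = K.n * K.n)
    (_ : s.reg 2 = 1) (_ : s.reg 7 = K.gs.length) (_ : s.reg 9 = 2) (_ : s.reg 17 = K.U)
    (_ : s.reg 18 = 2 ^ j),
    Spec prepare s (A * ((K.τ + 1) * (K.work * mb H))) K.Holds := by
  obtain ⟨A, hA⟩ := doubleUntil_spec
  set k₁ := Prog.kst (.op .mul 21 1 17 ;; .op .mul 21 21 18 ;; .const 22 64 ;; .op .mul 23 22 21)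
    with hk₁
  set k₂ := Prog.kst (.op .add 8 22 15 ;; .op .add 14 25 15 ;; .const 22 32 ;; .op .mul 3 14 18 ;;
    .op .mul 3 22 3 ;; .op .add 6 3 3 ;; .op .add 23 0 2) with hk₂
  set k₃ := Prog.kst (.op .add 11 22 15 ;; .op .add 4 22 15 ;; .op .add 23 6 2) with hk₃
  set k₄ := Prog.kst (.op .add 5 25 15 ;; .const 26 0 ;; .store 5 26 4 ;; .op .add 24 5 15)
    with hk₄
  set k₅ := Prog.kst (.op .mul 4 4 4 ;; .op .add 26 26 2 ;; .op .sub 24 24 2 ;; .store 5 26 4)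
    with hk₅
  set k₆ := Prog.kst (.op .mul 10 0 17 ;; .op .add 10 10 10 ;; .op .add 10 10 10 ;;
    .op .add 12 1 1 ;; .op .add 13 1 7) with hk₆
  refine ⟨k₁ + (A + (k₂ + (A + (k₃ + (A + (k₄ + ((7 + 1) * (k₅ + 2) + k₆))))))), ?_⟩
  intro K b H j cell dig h s hs r1 r2 r7 r9 r17 r18
  have hg := h.good
  have hH := hg.H_pos
  have hM := hg.maxEntry_lt
  have hidx := hg.index_lt
  have ht := hg.t_lt
  have hfac := h.factors_le
  have hXt := h.le_t
  have hthr := h.two_pow_clog_eq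
  have hBlt := hg.B_lt
  have hw : 1 ≤ K.work := by unfold Consts.work; omega
  have hτ := hg.τ_lt
  have hLlt := hg.L_lt
  have hL := h.L_le
  have hRlt := hg.R_lt
  have hLpow := hg.two_pow_L_lt
  have hbτ := h.b_le_τ
  have hNlt := hg.N_lt
  have hBb := h.B_eq
  refine (Spec.seq (Q := fun s' => s'.reg 23 = 64 * (K.n * K.n * K.U * 2 ^ j))
    (Spec.line [1, 17, 18] H rfl (by omega) ?_ ?_ ?_) fun s1 hf1 h1 =>
    Spec.seq (hA (x := 64 * (K.n * K.n * K.U * 2 ^ j)) (τ := K.τ) (w := K.work) (H := H)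
      (by rw [hf1.reg 2 rfl, r2]) h1 (by omega) (by omega) (by rw [← h.τ_eq]; omega) hw hH)
      fun s2 hf2 h2 =>
    Spec.seq (Q := fun s' => s'.reg 8 = K.t ∧ s'.reg 14 = K.τ ∧ s'.reg 3 = K.R ∧
      s'.reg 6 = 2 * K.R ∧ s'.reg 23 = K.n + 1)
      (Spec.line [22, 15, 25, 18, 0, 2] H rfl (by omega) ?_ ?_ ?_) fun s3 hf3 h3 =>
    Spec.seq (hA (x := K.n + 1) (τ := K.τ) (w := K.work) (H := H)
      (by rw [hf3.reg 2 rfl, hf2.reg 2 rfl, hf1.reg 2 rfl, r2]) h3.2.2.2.2 (by omega)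
      (by rw [← h.b_eq, ← hBb]; exact hBlt) (by rw [← h.b_eq]; omega) hw hH) fun s4 hf4 h4 =>
    Spec.seq (Q := fun s' => s'.reg 11 = K.B ∧ s'.reg 4 = K.B ∧ s'.reg 23 = 2 * K.R + 1)
      (Spec.line [22, 15, 6, 2] H rfl (by omega) ?_ ?_ ?_) fun s5 hf5 h5 =>
    Spec.seq (hA (x := 2 * K.R + 1) (τ := K.τ) (w := K.work) (H := H)
      (by rw [hf5.reg 2 rfl, hf4.reg 2 rfl, hf3.reg 2 rfl, hf2.reg 2 rfl, hf1.reg 2 rfl, r2])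
      h5.2.2 (by omega) (by rw [← h.L_eq]; exact hLpow) (by rw [← h.L_eq]; omega) hw hH)
      fun s6 hf6 h6 =>
    Spec.seq (Q := fun s' => s'.reg 5 = K.L ∧ s'.reg 26 = 0 ∧ s'.reg 24 = K.L ∧
      s'.arr 5 0 = K.B)
      (Spec.line [25, 4, 15] H rfl (by omega) ?_ ?_ ?_) fun s7 hf7 h7 =>
    Spec.seq (Spec.loop_const (m := K.L) (d := k₅ * mb H) (g := 1 + H)
      (fun i s' => s'.reg 24 + i = K.L ∧ s'.reg 26 = i ∧ s'.reg 4 = K.B ^ 2 ^ i ∧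
        ∀ k ≤ i, s'.arr 5 k = K.B ^ 2 ^ k) ?_ ?_ ?_) fun s8 hf8 h8 =>
    Spec.line [0, 1, 7, 17] H rfl (by omega) ?_ ?_ ?_).mono ?_
  · simp only [List.forall_mem_cons, r1, r17, r18]
    exact ⟨by omega, by omega, by omega, by simp⟩
  · simp
  · simp [r1, r17, r18]
  · have e15 : s2.reg 15 = 0 := by rw [hf2.reg 15 rfl, hf1.reg 15 rfl, hs.r15]
    have e18 : s2.reg 18 = 2 ^ j := by rw [hf2.reg 18 rfl, hf1.reg 18 rfl, r18]
    have e0 : s2.reg 0 = K.n := by rw [hf2.reg 0 rfl, hf1.reg 0 rfl, hs.r0]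
    have e2 : s2.reg 2 = 1 := by rw [hf2.reg 2 rfl, hf1.reg 2 rfl, r2]
    have e22 : s2.reg 22 = K.t := by rw [h2.1, hthr]
    have e25 : s2.reg 25 = K.τ := by rw [h2.2, h.τ_eq]
    simp only [List.forall_mem_cons, e15, e18, e0, e2, e22, e25]
    exact ⟨by omega, by omega, by omega, by omega, by omega, by omega, by simp⟩
  · simp
  · have e15 : s2.reg 15 = 0 := by rw [hf2.reg 15 rfl, hf1.reg 15 rfl, hs.r15]
    have e18 : s2.reg 18 = 2 ^ j := by rw [hf2.reg 18 rfl, hf1.reg 18 rfl, r18]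
    have e0 : s2.reg 0 = K.n := by rw [hf2.reg 0 rfl, hf1.reg 0 rfl, hs.r0]
    have e2 : s2.reg 2 = 1 := by rw [hf2.reg 2 rfl, hf1.reg 2 rfl, r2]
    have e22 : s2.reg 22 = K.t := by rw [h2.1, hthr]
    have e25 : s2.reg 25 = K.τ := by rw [h2.2, h.τ_eq]
    simp [e15, e18, e0, e2, e22, e25, h.R_eq, two_mul]
  · have e15 : s4.reg 15 = 0 := by
      rw [hf4.reg 15 rfl, hf3.reg 15 rfl, hf2.reg 15 rfl, hf1.reg 15 rfl, hs.r15]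
    have e2 : s4.reg 2 = 1 := by
      rw [hf4.reg 2 rfl, hf3.reg 2 rfl, hf2.reg 2 rfl, hf1.reg 2 rfl, r2]
    have e6 : s4.reg 6 = 2 * K.R := by rw [hf4.reg 6 rfl, h3.2.2.2.1]
    have e22 : s4.reg 22 = K.B := by rw [h4.1, hBb, h.b_eq]
    simp only [List.forall_mem_cons, e15, e2, e22, e6]
    exact ⟨by omega, by omega, by omega, by omega, by simp⟩
  · simp
  · have e15 : s4.reg 15 = 0 := by
      rw [hf4.reg 15 rfl, hf3.reg 15 rfl, hf2.reg 15 rfl, hf1.reg 15 rfl, hs.r15]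
    have e2 : s4.reg 2 = 1 := by
      rw [hf4.reg 2 rfl, hf3.reg 2 rfl, hf2.reg 2 rfl, hf1.reg 2 rfl, r2]
    have e6 : s4.reg 6 = 2 * K.R := by rw [hf4.reg 6 rfl, h3.2.2.2.1]
    have e22 : s4.reg 22 = K.B := by rw [h4.1, hBb, h.b_eq]
    simp [e15, e2, e6, e22]
  · have e15 : s6.reg 15 = 0 := by
      rw [hf6.reg 15 rfl, hf5.reg 15 rfl, hf4.reg 15 rfl, hf3.reg 15 rfl, hf2.reg 15 rfl,
        hf1.reg 15 rfl, hs.r15]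
    have e4 : s6.reg 4 = K.B := by rw [hf6.reg 4 rfl, h5.2.1]
    have e25 : s6.reg 25 = K.L := by rw [h6.2, h.L_eq]
    simp only [List.forall_mem_cons, e15, e4, e25]
    exact ⟨by omega, by omega, by omega, by simp⟩
  · simp
  · have e15 : s6.reg 15 = 0 := by
      rw [hf6.reg 15 rfl, hf5.reg 15 rfl, hf4.reg 15 rfl, hf3.reg 15 rfl, hf2.reg 15 rfl,
        hf1.reg 15 rfl, hs.r15]
    have e4 : s6.reg 4 = K.B := by rw [hf6.reg 4 rfl, h5.2.1]
    have e25 : s6.reg 25 = K.L := by rw [h6.2, h.L_eq]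
    simp [e15, e4, e25]
  · refine ⟨by rw [h7.2.2.1, add_zero], h7.2.1, ?_, fun k hk => ?_⟩
    · rw [hf7.reg 4 rfl, hf6.reg 4 rfl, h5.2.1, pow_zero, pow_one]
    · rw [Nat.le_zero.1 hk, h7.2.2.2, pow_zero, pow_one]
  · rintro i s' - ⟨i1, -⟩ hne
    have : (s'.reg 24).size ≤ H := by
      rw [Nat.size_le]
      omega
    omega
  · -- After `i` squarings the register `4` holds `B ^ (2 ^ i)`, the next entry of the table.
    rintro i s' hf ⟨i1, i2, i3, i4⟩ hne hi
    have e2 : s'.reg 2 = 1 := by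
      rw [hf.reg 2 rfl, hf7.reg 2 rfl, hf6.reg 2 rfl, hf5.reg 2 rfl, hf4.reg 2 rfl, hf3.reg 2 rfl,
        hf2.reg 2 rfl, hf1.reg 2 rfl, r2]
    have h3 : K.B ^ 2 ^ i ≤ K.B ^ 2 ^ K.L :=
      Nat.pow_le_pow_right hg.one_lt_B.le (Nat.pow_le_pow_right (by norm_num) hi.le)
    refine Spec.line [2, 4, 24, 26] H rfl (by omega) ?_ (by simp) ?_
    · simp only [List.forall_mem_cons, e2, i2, i3]
      exact ⟨by omega, by omega, by omega, by omega, by simp⟩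
    · refine ⟨by simp [e2]; omega, by simp [e2, i2], ?_, fun k hk => ?_⟩
      · simp [i3]
        rw [← pow_add, ← two_mul, ← pow_succ']
      · simp [e2, i2, i3]
        split_ifs with hki
        · rw [hki, ← pow_add, ← two_mul, ← pow_succ']
        · exact i4 k (by omega)
  · have e0 : s8.reg 0 = K.n := by
      rw [hf8.reg 0 rfl, hf7.reg 0 rfl, hf6.reg 0 rfl, hf5.reg 0 rfl, hf4.reg 0 rfl, hf3.reg 0 rfl,
        hf2.reg 0 rfl, hf1.reg 0 rfl, hs.r0]
    have e1 : s8.reg 1 = K.n * K.n := by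
      rw [hf8.reg 1 rfl, hf7.reg 1 rfl, hf6.reg 1 rfl, hf5.reg 1 rfl, hf4.reg 1 rfl, hf3.reg 1 rfl,
        hf2.reg 1 rfl, hf1.reg 1 rfl, r1]
    have e7 : s8.reg 7 = K.gs.length := by
      rw [hf8.reg 7 rfl, hf7.reg 7 rfl, hf6.reg 7 rfl, hf5.reg 7 rfl, hf4.reg 7 rfl, hf3.reg 7 rfl,
        hf2.reg 7 rfl, hf1.reg 7 rfl, r7]
    have e17 : s8.reg 17 = K.U := by
      rw [hf8.reg 17 rfl, hf7.reg 17 rfl, hf6.reg 17 rfl, hf5.reg 17 rfl, hf4.reg 17 rfl,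
        hf3.reg 17 rfl, hf2.reg 17 rfl, hf1.reg 17 rfl, r17]
    simp only [List.forall_mem_cons, e0, e1, e7, e17]
    exact ⟨by omega, by omega, by omega, by omega, by simp⟩
  · simp
  · obtain ⟨g0, i, g1, g2, g3, g4⟩ := h8
    obtain rfl : i = K.L := by omega
    have e0 : s8.reg 0 = K.n := by
      rw [hf8.reg 0 rfl, hf7.reg 0 rfl, hf6.reg 0 rfl, hf5.reg 0 rfl, hf4.reg 0 rfl, hf3.reg 0 rfl,
        hf2.reg 0 rfl, hf1.reg 0 rfl, hs.r0]
    have e1 : s8.reg 1 = K.n * K.n := by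
      rw [hf8.reg 1 rfl, hf7.reg 1 rfl, hf6.reg 1 rfl, hf5.reg 1 rfl, hf4.reg 1 rfl,
        hf3.reg 1 rfl, hf2.reg 1 rfl, hf1.reg 1 rfl, r1]
    have e2 : s8.reg 2 = 1 := by
      rw [hf8.reg 2 rfl, hf7.reg 2 rfl, hf6.reg 2 rfl, hf5.reg 2 rfl, hf4.reg 2 rfl,
        hf3.reg 2 rfl, hf2.reg 2 rfl, hf1.reg 2 rfl, r2]
    have e3 : s8.reg 3 = K.R := by
      rw [hf8.reg 3 rfl, hf7.reg 3 rfl, hf6.reg 3 rfl, hf5.reg 3 rfl, hf4.reg 3 rfl, h3.2.2.1]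
    have e5 : s8.reg 5 = K.L := by
      rw [hf8.reg 5 rfl, h7.1]
    have e6 : s8.reg 6 = 2 * K.R := by
      rw [hf8.reg 6 rfl, hf7.reg 6 rfl, hf6.reg 6 rfl, hf5.reg 6 rfl, hf4.reg 6 rfl, h3.2.2.2.1]
    have e7 : s8.reg 7 = K.gs.length := by
      rw [hf8.reg 7 rfl, hf7.reg 7 rfl, hf6.reg 7 rfl, hf5.reg 7 rfl, hf4.reg 7 rfl,
        hf3.reg 7 rfl, hf2.reg 7 rfl, hf1.reg 7 rfl, r7]
    have e8 : s8.reg 8 = K.t := by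
      rw [hf8.reg 8 rfl, hf7.reg 8 rfl, hf6.reg 8 rfl, hf5.reg 8 rfl, hf4.reg 8 rfl, h3.1]
    have e9 : s8.reg 9 = 2 := by
      rw [hf8.reg 9 rfl, hf7.reg 9 rfl, hf6.reg 9 rfl, hf5.reg 9 rfl, hf4.reg 9 rfl,
        hf3.reg 9 rfl, hf2.reg 9 rfl, hf1.reg 9 rfl, r9]
    have e11 : s8.reg 11 = K.B := by
      rw [hf8.reg 11 rfl, hf7.reg 11 rfl, hf6.reg 11 rfl, h5.1]
    have e14 : s8.reg 14 = K.τ := by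
      rw [hf8.reg 14 rfl, hf7.reg 14 rfl, hf6.reg 14 rfl, hf5.reg 14 rfl, hf4.reg 14 rfl, h3.2.1]
    have e15 : s8.reg 15 = 0 := by
      rw [hf8.reg 15 rfl, hf7.reg 15 rfl, hf6.reg 15 rfl, hf5.reg 15 rfl, hf4.reg 15 rfl,
        hf3.reg 15 rfl, hf2.reg 15 rfl, hf1.reg 15 rfl, hs.r15]
    have e17 : s8.reg 17 = K.U := by
      rw [hf8.reg 17 rfl, hf7.reg 17 rfl, hf6.reg 17 rfl, hf5.reg 17 rfl, hf4.reg 17 rfl,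
        hf3.reg 17 rfl, hf2.reg 17 rfl, hf1.reg 17 rfl, r17]
    have e64 : s8.arr 64 = s.arr 64 := by
      rw [hf8.arr 64 rfl, hf7.arr 64 rfl, hf6.arr 64 rfl, hf5.arr 64 rfl, hf4.arr 64 rfl,
        hf3.arr 64 rfl, hf2.arr 64 rfl, hf1.arr 64 rfl]
    refine ⟨?_, ?_, ?_, ?_, ?_, ?_, ?_, ?_, ?_, ?_, ?_, ?_, ?_, ?_, ?_, ?_, ?_, ?_⟩
    all_goals simp [e0, e1, e2, e3, g3, e5, e6, e7, e8, e9, e11, e14, e15, e17]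
    · ring
    · ring
    · exact g4
    · simpa [e64] using hs.gates
  · refine (add_le_add (line_cost_le (τ := K.τ) hw) (add_le_add le_rfl (add_le_add
      (line_cost_le (τ := K.τ) hw) (add_le_add le_rfl (add_le_add (line_cost_le (τ := K.τ) hw)
      (add_le_add le_rfl (add_le_add (line_cost_le (τ := K.τ) hw) (add_le_add
      (loop_cost_le (m := K.L) (k := k₅) (c := 7) (τ := K.τ) (by omega) hw hH)
      (line_cost_le (τ := K.τ) hw))))))))).trans (le_of_eq ?_)
    ring

/-! ### The algorithm -/

/-- The approximation algorithm, where the program `P` writes down the straight-line programs for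
the matrix multiplication. -/
def algorithm (P : Prog) : Prog :=
  .ifz 0 (.const 0 0) (generate P ;; readInput ;; prepare ;; mainLoop ;; outLoop)

namespace WGraph

variable {n : ℕ} (G : WGraph n) (ε : ℝ)

theorem input_cell (x y : Fin n) :
    (G.input ε).arr 0 (x * n + y) = ((G.wt x y).map (· + 1)).getD 0 := by
  have hlt : (x : ℕ) * n + y < n * n := by
    have h1 : ((x : ℕ) + 1) * n ≤ n * n := Nat.mul_le_mul_right n x.isLt
    have h2 := y.isLt
    rw [add_mul] at h1
    omega
  have hx : Fin.divNat (⟨x * n + y, hlt⟩ : Fin (n * n)) = x := by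
    ext
    simp only [Fin.divNat]
    rw [mul_comm, Nat.mul_add_div (by have := x.pos; omega), Nat.div_eq_of_lt y.isLt, add_zero]
  have hy : Fin.modNat (⟨x * n + y, hlt⟩ : Fin (n * n)) = y := by
    ext
    simp only [Fin.modNat]
    rw [mul_comm, Nat.mul_add_mod, Nat.mod_eq_of_lt y.isLt]
  simp only [input, if_true, dif_pos hlt, hx, hy]

/-- The input matrix is the exact solution for paths of length one. -/
theorem input_approx {D : ℕ → ℕ} (hD : ∀ i < n * n, D i = (G.input ε).arr 0 i) :
    Approx G 1 1 D := by
  have hD' : ∀ x y : Fin n, D (x * n + y) = ((G.wt x y).map (· + 1)).getD 0 := by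
    intro x y
    rw [hD, input_cell]
    have h1 : ((x : ℕ) + 1) * n ≤ n * n := Nat.mul_le_mul_right n x.isLt
    have h2 := y.isLt
    rw [add_mul] at h1
    omega
  constructor
  · intro x y hne
    rw [hD'] at hne ⊢
    rcases h : G.wt x y with _ | a
    · simp [h] at hne
    · exact ⟨a + 0, Path.cons h (Path.nil y), by simp⟩
  · intro x y w p
    cases p with
    | cons h q =>
      cases q with
      | nil => rw [hD', h]; simp

theorem cell_le {i : ℕ} (hi : i < n * n) : (G.input ε).arr 0 i ≤ G.maxWeight + 1 := by
  simp only [input, if_true, dif_pos hi]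
  rcases h : G.wt (Fin.divNat ⟨i, hi⟩) (Fin.modNat ⟨i, hi⟩) with _ | a
  · simp
  · simpa using le_maxWeight h

theorem maxWeight_lt_sum :
    G.maxWeight + 1 ≤ 1 + ∑ i ∈ Finset.range (n * n), (G.input ε).arr 0 i := by
  rw [add_comm, add_le_add_iff_left]
  refine Finset.sup_le fun p _ => ?_
  rcases h : G.wt p.1 p.2 with _ | a
  · simp
  · have h1 := G.input_cell ε p.1 p.2
    have h2 : ((p.1 : ℕ) + 1) * n ≤ n * n := Nat.mul_le_mul_right n p.1.isLt
    have h3 := p.2.isLt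
    rw [add_mul] at h2
    have h4 := Finset.single_le_sum (f := (G.input ε).arr 0) (fun _ _ => Nat.zero_le _)
      (Finset.mem_range.2 (show (p.1 : ℕ) * n + p.2 < n * n by omega))
    rw [h1, h] at h4
    simp at h4 ⊢
    omega

end WGraph

/-- Correctness of the algorithm, and its cost in terms of the constants; `c` is the cost of writing
down the straight-line program. -/
theorem algorithm_spec : ∃ A : ℕ, ∀ {P : Prog} {K : Consts} {b H j c : ℕ} {s₁ : State}
    (_ : Exec P (natInput K.n) s₁ c) (_ : s₁.Describes K.gs) (G : WGraph K.n) {ε : ℝ}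
    (_ : Chosen K b H j ((G.input ε).arr 0) ((G.input ε).arr 1)) (_ : 1 ≤ 2 ^ j * ε),
    Spec (algorithm P) (G.input ε) (c + A * ((K.τ + 1) ^ 2 * (K.work * mb H))) fun s =>
      ∀ x : Fin K.n, s.arr 1 x ≠ 0 ∧ G.mu x ≤ s.output x ∧ s.output x ≤ (1 + ε) * G.mu x := by
  obtain ⟨A₁, h₁⟩ := readInput_spec
  obtain ⟨A₂, h₂⟩ := prepare_spec
  obtain ⟨A₃, h₃⟩ := mainLoop_spec
  obtain ⟨A₄, h₄⟩ := outLoop_spec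
  refine ⟨4 + (A₁ + (A₂ + (A₃ + A₄))), ?_⟩
  intro P K b H j c s₁ hP hgs G ε h hε
  have hg := h.good
  have hn := hg.n_pos
  have h0 : (G.input ε).reg 0 = K.n := rfl
  -- The algorithm works with the accuracy `δ = 2 ^ (-j) ≤ ε`.
  set δ : ℝ := 1 / 2 ^ j with hδ
  have hpow : (0 : ℝ) < 2 ^ j := by positivity
  have hδ0 : 0 < δ := by positivity
  have hδ1 : δ ≤ 1 := by
    rw [hδ, div_le_one hpow]
    exact one_le_pow₀ (by norm_num)
  have hδε : δ ≤ ε := by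
    rw [hδ, div_le_iff₀ hpow, mul_comm]
    exact hε
  have hR : (1 + 4 / (K.R : ℝ)) ^ K.τ ≤ 1 + δ / 4 := by
    refine one_add_pow_le hδ0 hδ1 (le_of_eq ?_)
    rw [h.R_eq, hδ]
    push_cast
    field_simp
  have hU : G.maxWeight + 1 ≤ K.U := by
    rw [h.U_eq]
    exact G.maxWeight_lt_sum ε
  have hcell : ∀ i < K.n * K.n, (G.input ε).arr 0 i ≤ K.maxEntry := by
    intro i hi
    have h1 := G.cell_le ε hi
    have h2 := h.le_t
    have h3 := h.factors_le
    have h4 := hg.t_lt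
    omega
  have hnt : K.n < K.t := by
    have h2 := h.le_t
    have h3 := h.factors_le
    omega
  refine (Spec.ifz (Q := fun s => ∀ x : Fin K.n, s.arr 1 x ≠ 0 ∧ G.mu x ≤ s.output x ∧
    s.output x ≤ (1 + ε) * G.mu x) (fun h => absurd h (by omega)) fun _ =>
    Spec.seq (c' := A₁ * ((K.τ + 1) * (K.work * mb H)) + (A₂ * ((K.τ + 1) * (K.work * mb H)) +
      (A₃ * ((K.τ + 1) ^ 2 * (K.work * mb H)) + A₄ * (K.work * mb H))))
      (generate_spec hP hgs G ε) fun s1 hf1 ⟨e0, er, ea0, ea1, ea, e64, eg⟩ => ?_).mono ?_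
  · have hready : Ready K ((G.input ε).arr 0) ((G.input ε).arr 1) s1 :=
      ⟨e0, er 15 (by norm_num) (by norm_num), e64, eg, ea0, ea1, ea 4 (by norm_num) (by norm_num)⟩
    refine Spec.seq (h₁ h hready) fun s2 hf2 ⟨q1, q2, q7, q9, q17, q18, qa⟩ => ?_
    have hready' := hready.frame hf2 rfl rfl rfl rfl rfl rfl rfl
    refine Spec.seq (h₂ h hready' q1 q2 q7 q9 q17 q18) fun s3 hf3 hK => ?_
    have ha : ∀ i < K.n * K.n, s3.arr 2 i = (G.input ε).arr 0 i := fun i hi => by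
      rw [hf3.arr 2 rfl, qa i hi]
    refine Spec.seq (h₃ hg hK G hU (by linarith) (G.input_approx ε ha)
      (fun i hi => by rw [ha i hi]; exact hcell i hi) fun i => ?_) fun s4 hf4 ⟨hD, hDle⟩ => ?_
    · rw [hf3.arr 4 rfl, hready'.zeros]
      have := hg.one_lt_B
      unfold Consts.N
      positivity
    · refine (h₄ hg (hK.frame hf4 (by decide) rfl rfl) hDle).conseq le_rfl ?_
      rintro s5 - h5 x
      obtain ⟨a1, m, hm, a0⟩ := h5 x x.isLt
      refine ⟨by rw [a1]; omega, ?_⟩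
      have hpath : ∀ y w, G.Path x y K.t w →
          m ≠ 0 ∧ ((m - 1 : ℕ) : ℝ) ≤ (1 + 4 / (K.R : ℝ)) ^ K.τ * w := by
        intro y w p
        obtain ⟨c1, c2⟩ := hD.complete x y w p
        obtain ⟨c3, c4⟩ := hm.2 y y.isLt (Nat.zero_le _) c1
        refine ⟨c3, le_trans ?_ c2⟩
        exact_mod_cast Nat.sub_le_sub_right c4 1
      obtain ⟨y₀, w₀, p₀⟩ := G.exists_path x K.t
      obtain ⟨y, hy, hmy⟩ := hm.1 (hpath y₀ w₀ p₀).1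
      obtain ⟨w, p, hw⟩ := hD.sound x ⟨y, hy⟩ (by
        rw [← hmy]
        exact (hpath y₀ w₀ p₀).1)
      have hmw : w + 1 ≤ m := by
        rw [hmy]
        exact hw
      have ht : 64 * (K.n : ℝ) ^ 2 * K.U ≤ K.t * δ := by
        rw [hδ, mul_one_div, le_div_iff₀ hpow]
        have := h.le_t
        have h' : ((64 * (K.n * K.n * K.U * 2 ^ j) : ℕ) : ℝ) ≤ K.t := by exact_mod_cast this
        push_cast at h'
        linarith
      have := G.mu_approx (x := x) (t := K.t) (m := m - 1) (U := K.U) hδ0 hδ1 hR (by positivity)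
        hU ht ⟨⟨y, hy⟩, w, p, by omega⟩ fun y w p => (hpath y w p).2
      rw [State.output, a0, a1]
      refine ⟨this.1, this.2.trans ?_⟩
      have := G.mu_nonneg x
      gcongr
  · set T := (K.τ + 1) ^ 2 * (K.work * mb H) with hT
    have hH := hg.H_pos
    have hw : 1 ≤ K.work := by unfold Consts.work; omega
    have h1 : mb H ≤ K.work * mb H := Nat.le_mul_of_pos_left _ hw
    have h2 : (K.τ + 1) * (K.work * mb H) ≤ T := by
      rw [hT, sq, mul_assoc]
      exact Nat.le_mul_of_pos_left _ (by omega)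
    have h3 : K.work * mb H ≤ (K.τ + 1) * (K.work * mb H) := Nat.le_mul_of_pos_left _ (by omega)
    have h4 : K.n.size ≤ H := by
      have := hg.n_lt
      have := hg.B_lt
      rw [Nat.size_le]
      omega
    have h5 := le_mb H
    have h6 := Nat.mul_le_mul_left A₁ h2
    have h7 := Nat.mul_le_mul_left A₂ h2
    have h8 := Nat.mul_le_mul_left A₄ (h3.trans h2)
    rw [h0]
    calc _ ≤ 4 * T + c + (A₁ * T + (A₂ * T + (A₃ * T + A₄ * T))) := by omega
      _ = _ := by ring

/-! ### The choice of the constants -/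

/-- The first nonzero binary digit of `ε`. -/
theorem exists_first_digit {ε : ℝ} (h0 : 0 < ε) (h1 : ε ≤ 1) :
    ∃ j : ℕ, (∀ i < j, ⌊2 ^ i * ε⌋₊ % 2 = 0) ∧ ⌊2 ^ j * ε⌋₊ % 2 = 1 ∧ 1 ≤ 2 ^ j * ε ∧
      2 ^ j * ε < 2 := by
  classical
  have hex : ∃ j : ℕ, 1 ≤ 2 ^ j * ε := by
    obtain ⟨j, hj⟩ := pow_unbounded_of_one_lt (1 / ε) (one_lt_two (α := ℝ))
    refine ⟨j, ?_⟩
    rw [div_lt_iff₀ h0] at hj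
    exact hj.le
  have hlt : ∀ i < Nat.find hex, 2 ^ i * ε < 1 := fun i hi => not_le.1 (Nat.find_min hex hi)
  have h2 : 2 ^ Nat.find hex * ε < 2 := by
    rcases hj : Nat.find hex with _ | i
    · simp
      linarith
    · have := hlt i (by omega)
      rw [pow_succ]
      linarith
  refine ⟨Nat.find hex, fun i hi => ?_, ?_, Nat.find_spec hex, h2⟩
  · rw [Nat.floor_eq_zero.2 (hlt i hi)]
  · have h3 : ⌊2 ^ Nat.find hex * ε⌋₊ = 1 := by
      rw [Nat.floor_eq_iff (by positivity)]
      exact ⟨by simpa using Nat.find_spec hex, by norm_num; exact h2⟩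
    rw [h3]

/-- The constants for `n` vertices, the bound `U` for the weights and the accuracy `2 ^ (-j)`. -/
def chooseConsts (n : ℕ) (gs : List Gate) (U j : ℕ) : Consts where
  n := n
  gs := gs
  R := 32 * (Nat.clog 2 (64 * (n * n * U * 2 ^ j)) * 2 ^ j)
  B := 2 ^ Nat.clog 2 (n + 1)
  L := Nat.clog 2 (2 * (32 * (Nat.clog 2 (64 * (n * n * U * 2 ^ j)) * 2 ^ j)) + 1)
  U := U
  t := 2 ^ Nat.clog 2 (64 * (n * n * U * 2 ^ j))
  τ := Nat.clog 2 (64 * (n * n * U * 2 ^ j))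

/-- A bound for the number of bits of all numbers that the algorithm handles. -/
def Consts.bits (K : Consts) : ℕ :=
  Nat.clog 2 (K.n + 1) * 2 ^ K.L + 1 + (2 * (K.n * K.n) + 3 * K.gs.length + 3).size + (4 * K.τ + 8)

theorem chooseConsts_chosen {n U j : ℕ} {gs : List Gate} {cell dig : ℕ → ℕ} (hn : 1 ≤ n)
    (hgs : MultipliesMatrices n gs) (hU : U = 1 + ∑ i ∈ Finset.range (n * n), cell i)
    (hlt : ∀ i < j, dig i = 0) (heq : dig j = 1) :
    Chosen (chooseConsts n gs U j) (Nat.clog 2 (n + 1)) (chooseConsts n gs U j).bits j cell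
      dig := by
  set K := chooseConsts n gs U j with hK
  have hU1 : 1 ≤ U := by omega
  have h1 : 1 ≤ n * n := Nat.mul_pos hn hn
  have h2 : 1 ≤ n * n * U := Nat.mul_pos h1 hU1
  have h3 : 1 ≤ 2 ^ j := Nat.one_le_two_pow
  have h4 : n * n * U ≤ n * n * U * 2 ^ j := Nat.le_mul_of_pos_right _ h3
  have h5 : 2 ^ j ≤ n * n * U * 2 ^ j := Nat.le_mul_of_pos_left _ h2
  have h6 : n * U ≤ n * n * U := Nat.mul_le_mul_right _ (Nat.le_mul_self n)
  have ht : K.t = 2 ^ K.τ := rfl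
  have hX : 64 * (n * n * U * 2 ^ j) ≤ 2 ^ K.τ := Nat.le_pow_clog (by norm_num) _
  have hR : K.R = 32 * (K.τ * 2 ^ j) := rfl
  have hτ : 1 ≤ K.τ := by
    by_contra h0
    have h0 : K.τ = 0 := by omega
    rw [h0] at hX
    omega
  have hR32 : 32 * 1 ≤ K.R := by
    rw [hR]
    exact Nat.mul_le_mul_left _ (Nat.mul_pos hτ h3)
  refine ⟨⟨hn, hgs, ?_, le_rfl, ?_, by omega, ?_, ht, ?_, ?_, ?_, ?_⟩, hU, hlt, heq, rfl, rfl, rfl,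
    rfl, rfl⟩
  · exact Nat.lt_of_succ_le (Nat.le_pow_clog (by norm_num) _)
  · exact Nat.clog_pos (by norm_num) (by omega)
  · exact Nat.lt_of_succ_le (Nat.le_pow_clog (by norm_num) _)
  · rw [ht]
    change 4 * n * U ≤ _
    rw [mul_assoc]
    omega
  · unfold Consts.bits
    change _ ≤ Nat.clog 2 (n + 1) * 2 ^ K.L + 1 + _ + _
    omega
  · refine (Nat.lt_size_self _).trans_le (Nat.pow_le_pow_right (by norm_num) ?_)
    unfold Consts.bits
    omega
  · have h7 : K.τ * 2 ^ j ≤ 2 ^ K.τ * 2 ^ K.τ :=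
      Nat.mul_le_mul Nat.lt_two_pow_self.le (by omega)
    calc 4 * K.R * K.t ^ 2 + 2 ≤ 4 * (32 * (2 ^ K.τ * 2 ^ K.τ)) * (2 ^ K.τ) ^ 2 + 2 := by
          rw [hR, ht]
          gcongr
      _ = 2 ^ (4 * K.τ + 7) + 2 := by ring
      _ < 2 ^ (4 * K.τ + 7) + 2 ^ (4 * K.τ + 7) := by
          have : 2 ^ 7 ≤ 2 ^ (4 * K.τ + 7) := Nat.pow_le_pow_right (by norm_num) (by omega)
          omega
      _ = 2 ^ (4 * K.τ + 8) := by ring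
      _ ≤ 2 ^ K.bits := Nat.pow_le_pow_right (by norm_num) (by unfold Consts.bits; omega)

/-! ### The running time -/

theorem size_le_log {x : ℕ} (hx : 1 ≤ x) : (x.size : ℝ) ≤ 1 + 2 * Real.log x := by
  have h1 : 2 ^ (x.size - 1) ≤ x := Nat.lt_size.1 (by have := Nat.size_pos.2 hx; omega)
  have h2 : ((2 : ℝ) ^ (x.size - 1)) ≤ x := by exact_mod_cast h1
  have h3 := Real.log_le_log (by positivity) h2
  rw [Real.log_pow] at h3
  have h4 : (x.size : ℝ) ≤ (x.size - 1 : ℕ) + 1 := by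
    exact_mod_cast (by omega : x.size ≤ x.size - 1 + 1)
  nlinarith [Real.log_two_gt_d9]

theorem clog_le_log {x : ℕ} (hx : 2 ≤ x) : (Nat.clog 2 x : ℝ) ≤ 1 + 2 * Real.log x := by
  have h1 : 2 ^ (Nat.clog 2 x - 1) ≤ x := (Nat.pow_pred_clog_lt_self (by norm_num) hx).le
  have h2 : ((2 : ℝ) ^ (Nat.clog 2 x - 1)) ≤ x := by exact_mod_cast h1
  have h3 := Real.log_le_log (by positivity) h2
  rw [Real.log_pow] at h3
  have h4 : (Nat.clog 2 x : ℝ) ≤ (Nat.clog 2 x - 1 : ℕ) + 1 := by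
    exact_mod_cast (by omega : Nat.clog 2 x ≤ Nat.clog 2 x - 1 + 1)
  nlinarith [Real.log_two_gt_d9]

/-- The exponent of matrix multiplication is at least `2`, because the product has `n²` entries. -/
theorem two_le_of_length_le {S : ℕ → List Gate} {C ω : ℝ}
    (h : ∀ n : ℕ, 1 ≤ n → MultipliesMatrices n (S n) ∧ ((S n).length : ℝ) ≤ C * (n : ℝ) ^ ω) :
    2 ≤ ω := by
  by_contra hlt
  push Not at hlt
  have ht := (tendsto_rpow_atTop (show 0 < 2 - ω by linarith)).comp
    (tendsto_natCast_atTop_atTop (R := ℝ))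
  obtain ⟨n, hn1, hn⟩ := ((ht.eventually_gt_atTop C).and (Filter.eventually_ge_atTop 1)).exists
  have hpos : (0 : ℝ) < n := by exact_mod_cast hn
  have h1 : ((n * n : ℕ) : ℝ) ≤ (S n).length := by exact_mod_cast (h n hn).1.le_length hn
  have h2 := h1.trans (h n hn).2
  have h3 : ((n * n : ℕ) : ℝ) = (n : ℝ) ^ (2 - ω) * (n : ℝ) ^ ω := by
    rw [← Real.rpow_add hpos]
    simp [sq]
  have h4 : (0 : ℝ) < (n : ℝ) ^ ω := by positivity
  rw [h3] at h2
  have := le_of_mul_le_mul_right h2 h4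
  simp at hn1
  linarith

theorem log_three_gt_one : 1 < Real.log 3 := by
  rw [Real.lt_log_iff_exp_lt (by norm_num)]
  exact Real.exp_one_lt_d9.trans (by norm_num)

/-- The basic inequalities between the logarithms in the time bound. -/
theorem log_facts {N W : ℕ} {ε : ℝ} (hN : 3 ≤ N) (hW : 1 ≤ W) (h0 : 0 < ε) (h1 : ε ≤ 1) :
    1 < Real.log N ∧ Real.log N ≤ Real.log (N * W / ε) ∧
    Real.log (N * W / ε) ≤ Real.log (N * W / ε) / ε ∧
    0 < Real.log (Real.log 3) ∧
    Real.log (Real.log 3) ≤ Real.log (Real.log (N * W / ε) / ε) ∧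
    Real.log (Real.log N) ≤ Real.log (Real.log (N * W / ε) / ε) := by
  have hN' : (3 : ℝ) ≤ N := by exact_mod_cast hN
  have hW' : (1 : ℝ) ≤ W := by exact_mod_cast hW
  have a1 : Real.log 3 ≤ Real.log N := Real.log_le_log (by norm_num) hN'
  have a0 := log_three_gt_one
  have a2 : Real.log N ≤ Real.log (N * W / ε) := by
    refine Real.log_le_log (by linarith) ?_
    rw [le_div_iff₀ h0]
    nlinarith
  have a3 : Real.log (N * W / ε) ≤ Real.log (N * W / ε) / ε := by
    rw [le_div_iff₀ h0]
    nlinarith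
  exact ⟨by linarith, a2, a3, Real.log_pos a0, Real.log_le_log (by linarith) (by linarith),
    Real.log_le_log (by linarith) (by linarith)⟩

section

variable {n N U W j : ℕ} {gs : List Gate} {ε : ℝ}

/-- The path length is polynomial in `n * W / ε`. -/
theorem log_threshold_le (hn : 1 ≤ n) (hnN : n ≤ N) (hN : 3 ≤ N) (hW : 1 ≤ W) (h0 : 0 < ε)
    (h1 : ε ≤ 1) (hU1 : 1 ≤ U) (hU : U ≤ 3 * (N * N * W)) (hj : 2 ^ j * ε < 2) :
    Real.log (64 * (n * n * U * 2 ^ j) : ℕ) ≤ 10 * Real.log (N * W / ε) := by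
  have hN' : (3 : ℝ) ≤ N := by exact_mod_cast hN
  have hW' : (1 : ℝ) ≤ W := by exact_mod_cast hW
  have hn' : (1 : ℝ) ≤ n := by exact_mod_cast hn
  have hU1' : (1 : ℝ) ≤ U := by exact_mod_cast hU1
  have hU' : (U : ℝ) ≤ 3 * (N * N * W) := by exact_mod_cast hU
  have hnN' : (n : ℝ) ≤ N := by exact_mod_cast hnN
  have hj' : (2 : ℝ) ^ j ≤ 2 / ε := by
    rw [le_div_iff₀ h0]
    exact hj.le
  have hpos : (0 : ℝ) < 64 * (n * n * U * 2 ^ j) := by positivity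
  have hWε : 1 ≤ W / ε := by
    rw [le_div_iff₀ h0]
    linarith
  rw [← Nat.cast_ofNat (R := ℝ) (n := 10), ← Real.log_pow]
  push_cast
  refine Real.log_le_log hpos ?_
  calc (64 : ℝ) * (n * n * U * 2 ^ j) ≤ 64 * (N * N * (3 * (N * N * W)) * (2 / ε)) := by gcongr
    _ = 384 * N ^ 4 * (W / ε) ^ 1 := by ring
    _ ≤ N ^ 6 * N ^ 4 * (W / ε) ^ 10 := by
        gcongr
        · calc (384 : ℝ) ≤ 3 ^ 6 := by norm_num
            _ ≤ N ^ 6 := by gcongr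
        · norm_num
    _ = (N * W / ε) ^ 10 := by ring

/-- The number of squarings is `O(log (n * W / ε))`, the modulus is `B` to the power of
`O(log (n * W / ε) / ε)`, and `B` has `O(log n)` bits. -/
theorem chooseConsts_bounds (hn : 1 ≤ n) (hnN : n ≤ N) (hN : 3 ≤ N) (hW : 1 ≤ W) (h0 : 0 < ε)
    (h1 : ε ≤ 1) (hU1 : 1 ≤ U) (hU : U ≤ 3 * (N * N * W)) (hj : 2 ^ j * ε < 2) :
    ((chooseConsts n gs U j).τ : ℝ) + 1 ≤ 22 * Real.log (N * W / ε) ∧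
    ((2 ^ (chooseConsts n gs U j).L : ℕ) : ℝ) ≤ 6720 * (Real.log (N * W / ε) / ε) ∧
    (Nat.clog 2 (n + 1) : ℝ) ≤ 5 * Real.log N := by
  obtain ⟨f1, f2, f3, -⟩ := log_facts hN hW h0 h1
  have hx : 2 ≤ 64 * (n * n * U * 2 ^ j) := by
    have : 0 < n * n * U * 2 ^ j := by positivity
    omega
  have h2 := (clog_le_log hx).trans
    (add_le_add le_rfl (mul_le_mul_of_nonneg_left
      (log_threshold_le hn hnN hN hW h0 h1 hU1 hU hj) zero_le_two))
  set K := chooseConsts n gs U j with hK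
  set l := Real.log (N * W / ε) with hl
  have hτ : (K.τ : ℝ) ≤ 21 * l := by
    have : (K.τ : ℝ) ≤ 1 + 2 * (10 * l) := h2
    linarith
  refine ⟨by linarith, ?_, ?_⟩
  · have hj' : (2 : ℝ) ^ j ≤ 2 / ε := by
      rw [le_div_iff₀ h0]
      exact hj.le
    have hτ1 : 1 ≤ K.τ := Nat.clog_pos (by norm_num) hx
    have hR1 : 1 ≤ K.τ * 2 ^ j := Nat.mul_pos hτ1 (by positivity)
    have h2R : 2 ≤ 2 * (32 * (K.τ * 2 ^ j)) + 1 := by omega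
    have h3 : 2 ^ K.L ≤ 160 * (K.τ * 2 ^ j) := by
      have h4 : 2 ^ (K.L - 1) < 2 * (32 * (K.τ * 2 ^ j)) + 1 :=
        Nat.pow_pred_clog_lt_self (by norm_num) h2R
      have h5 : 0 < K.L := Nat.clog_pos (by norm_num) h2R
      have h6 : 2 ^ K.L = 2 * 2 ^ (K.L - 1) := by
        rw [← pow_succ', Nat.sub_add_cancel h5]
      omega
    have h4 : ((2 ^ K.L : ℕ) : ℝ) ≤ 160 * (K.τ * 2 ^ j) := by exact_mod_cast h3
    calc ((2 ^ K.L : ℕ) : ℝ) ≤ 160 * (K.τ * 2 ^ j) := h4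
      _ ≤ 160 * (21 * l * (2 / ε)) := by
          gcongr
          linarith
      _ = _ := by ring
  · have h3 := clog_le_log (x := n + 1) (by omega)
    have h4 : Real.log ((n + 1 : ℕ) : ℝ) ≤ 2 * Real.log N := by
      have h5 : ((n + 1 : ℕ) : ℝ) ≤ (N : ℝ) ^ 2 := by
        exact_mod_cast (show n + 1 ≤ N ^ 2 by nlinarith)
      have h6 := Real.log_le_log (by positivity) h5
      rwa [Real.log_pow] at h6
    linarith

/-- All numbers that the algorithm handles have `O((log (nW / ε) / ε) * log n)` bits. -/
theorem bits_le {C ω : ℝ} (hC : 1 ≤ C) (hω : 2 ≤ ω) : ∃ D : ℝ, 1 ≤ D ∧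
    ∀ {n N U W j : ℕ} {gs : List Gate} {ε : ℝ} (_ : 1 ≤ n) (_ : n ≤ N) (_ : 3 ≤ N) (_ : 1 ≤ W)
      (_ : 0 < ε) (_ : ε ≤ 1) (_ : 1 ≤ U) (_ : U ≤ 3 * (N * N * W)) (_ : 2 ^ j * ε < 2)
      (_ : (gs.length : ℝ) ≤ C * (N : ℝ) ^ ω),
      ((chooseConsts n gs U j).bits : ℝ) ≤ D * (Real.log (N * W / ε) / ε * Real.log N) := by
  have hlog : 0 ≤ Real.log (8 * C) := Real.log_nonneg (by linarith)
  -- The summands come from the modulus, from the numbers of cells and gates, and from the entries.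
  refine ⟨33600 + (1 + 2 * (Real.log (8 * C) + ω)) + 97, by linarith, ?_⟩
  intro n N U W j gs ε hn hnN hN hW h0 h1 hU1 hU hj hgs
  obtain ⟨f1, f2, f3, -⟩ := log_facts hN hW h0 h1
  obtain ⟨g1, g2, g3⟩ := chooseConsts_bounds (gs := gs) hn hnN hN hW h0 h1 hU1 hU hj
  set K := chooseConsts n gs U j with hK
  set l := Real.log (N * W / ε) with hl
  set q := Real.log (N : ℝ) with hq
  have hN' : (3 : ℝ) ≤ N := by exact_mod_cast hN
  have hsize : ((2 * (n * n) + 3 * gs.length + 3).size : ℝ) ≤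
      (1 + 2 * (Real.log (8 * C) + ω)) * q := by
    have h2 := size_le_log (x := 2 * (n * n) + 3 * gs.length + 3) (by omega)
    have h3 : ((2 * (n * n) + 3 * gs.length + 3 : ℕ) : ℝ) ≤ 8 * C * (N : ℝ) ^ ω := by
      have h4 : (1 : ℝ) ≤ (N : ℝ) ^ ω := Real.one_le_rpow (by linarith) (by linarith)
      have h5 : (n : ℝ) * n ≤ (N : ℝ) ^ ω := by
        calc (n : ℝ) * n ≤ N * N := by gcongr
          _ = (N : ℝ) ^ (2 : ℝ) := by rw [Real.rpow_two, sq]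
          _ ≤ (N : ℝ) ^ ω := Real.rpow_le_rpow_of_exponent_le (by linarith) hω
      have h6 : (N : ℝ) ^ ω ≤ C * (N : ℝ) ^ ω := le_mul_of_one_le_left (by positivity) hC
      push_cast
      linarith
    have h4 := Real.log_le_log (by positivity) h3
    rw [Real.log_mul (by positivity) (by positivity), Real.log_rpow (by linarith)] at h4
    have h5 : Real.log (8 * C) ≤ Real.log (8 * C) * q := le_mul_of_one_le_right hlog f1.le
    linarith
  have hbits : (K.bits : ℝ) = (Nat.clog 2 (n + 1) : ℝ) * ((2 ^ K.L : ℕ) : ℝ) + 1 +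
      ((2 * (n * n) + 3 * gs.length + 3).size : ℝ) + (4 * (K.τ : ℝ) + 8) := by
    rw [Consts.bits]
    push_cast
    rfl
  have hm1 : 1 ≤ l / ε := by linarith
  have hm2 : l ≤ l / ε * q := f3.trans (le_mul_of_one_le_right (by linarith) f1.le)
  have hm3 : q ≤ l / ε * q := le_mul_of_one_le_left (by linarith) hm1
  have hm4 : (Nat.clog 2 (n + 1) : ℝ) * ((2 ^ K.L : ℕ) : ℝ) ≤ 33600 * (l / ε * q) := by
    calc _ ≤ 5 * q * (6720 * (l / ε)) := by gcongr
      _ = _ := by ring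
  have hm5 : (1 + 2 * (Real.log (8 * C) + ω)) * q ≤
      (1 + 2 * (Real.log (8 * C) + ω)) * (l / ε * q) := by gcongr
  rw [hbits, add_mul, add_mul]
  linarith

end

theorem mainTerm_pos {N W : ℕ} {ε ω : ℝ} (hN : 3 ≤ N) (hW : 1 ≤ W) (h0 : 0 < ε)
    (h1 : ε ≤ 1) : 0 < mainTerm ω N W ε := by
  obtain ⟨f1, f2, f3, -⟩ := log_facts hN hW h0 h1
  have hN' : (0 : ℝ) < N := by exact_mod_cast (by omega : 0 < N)
  have : 0 < Real.log (N * W / ε) := by linarith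
  unfold mainTerm
  positivity

/-- The number of operations of the algorithm, weighted with their cost, is within the bound. -/
theorem cost_le {C ω : ℝ} (hC : 1 ≤ C) (hω : 2 ≤ ω) : ∃ D : ℝ, 0 ≤ D ∧
    ∀ {n N U W j : ℕ} {gs : List Gate} {ε : ℝ} (_ : 1 ≤ n) (_ : n ≤ N) (_ : 3 ≤ N) (_ : 1 ≤ W)
      (_ : 0 < ε) (_ : ε ≤ 1) (_ : 1 ≤ U) (_ : U ≤ 3 * (N * N * W)) (_ : 2 ^ j * ε < 2)
      (_ : (gs.length : ℝ) ≤ C * (N : ℝ) ^ ω),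
      ((((chooseConsts n gs U j).τ + 1) ^ 2 * ((chooseConsts n gs U j).work *
        mb (chooseConsts n gs U j).bits) : ℕ) : ℝ) ≤ D * timeBound ω N W ε := by
  obtain ⟨D, hD, hbits⟩ := bits_le hC hω
  set lam := Real.log (Real.log 3) with hlam
  have hlogD := Real.log_nonneg hD
  -- `log (log 3)` is a lower bound for `log (log (nW / ε) / ε)`, which absorbs additive constants.
  set E := (1 + 2 * Real.log D) / lam + 4 with hE
  have hlam0 : 0 < lam := Real.log_pos log_three_gt_one
  refine ⟨22 ^ 2 * (3 * C * (D * E ^ 2)), by positivity, ?_⟩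
  intro n N U W j gs ε hn hnN hN hW h0 h1 hU1 hU hj hgs
  obtain ⟨f1, f2, f3, f4, f5, f6⟩ := log_facts hN hW h0 h1
  obtain ⟨g1, -, -⟩ := chooseConsts_bounds (gs := gs) hn hnN hN hW h0 h1 hU1 hU hj
  have hb := hbits hn hnN hN hW h0 h1 hU1 hU hj hgs
  set K := chooseConsts n gs U j with hK
  set l := Real.log (N * W / ε) with hl
  set q := Real.log (N : ℝ) with hq
  set Λ := Real.log (l / ε) with hΛ
  have hN' : (3 : ℝ) ≤ N := by exact_mod_cast hN
  have hle : 0 < l / ε := by linarith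
  have hwork : (K.work : ℝ) ≤ 3 * C * (N : ℝ) ^ ω := by
    have h4 : (1 : ℝ) ≤ (N : ℝ) ^ ω := Real.one_le_rpow (by linarith) (by linarith)
    have h5 : (n : ℝ) * n ≤ (N : ℝ) ^ ω := by
      calc (n : ℝ) * n ≤ N * N := by gcongr
        _ = (N : ℝ) ^ (2 : ℝ) := by rw [Real.rpow_two, sq]
        _ ≤ (N : ℝ) ^ ω := Real.rpow_le_rpow_of_exponent_le (by linarith) hω
    have h6 : (N : ℝ) ^ ω ≤ C * (N : ℝ) ^ ω := le_mul_of_one_le_left (by positivity) hC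
    have h7 : (K.work : ℝ) = n * n + gs.length + 1 := by
      unfold Consts.work
      push_cast
      rfl
    rw [h7]
    linarith
  have hpos : 1 ≤ K.bits := by
    unfold Consts.bits
    omega
  have hsize : (K.bits.size : ℝ) ≤ E * Λ := by
    have h2 := size_le_log hpos
    have h3 := Real.log_le_log (by exact_mod_cast hpos) hb
    rw [Real.log_mul (by positivity) (by positivity), Real.log_mul (by positivity) (by positivity)]
      at h3
    have h4 : 1 + 2 * Real.log D ≤ (1 + 2 * Real.log D) / lam * Λ := by
      rw [div_mul_eq_mul_div, le_div_iff₀ hlam0]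
      gcongr
    rw [hE, add_mul]
    linarith
  push_cast
  unfold timeBound mb
  push_cast
  calc ((K.τ : ℝ) + 1) ^ 2 * (K.work * (K.bits * (K.bits.size : ℝ) ^ 2))
      ≤ (22 * l) ^ 2 * ((3 * C * (N : ℝ) ^ ω) * ((D * (l / ε * q)) * (E * Λ) ^ 2)) := by gcongr
    _ = _ := by ring

/-- The logarithmic factors of the time bound are polynomial in the logarithm of the main term. -/
theorem timeBound_le {N W : ℕ} {ε ω : ℝ} (hω : 2 ≤ ω) (hN : 3 ≤ N) (hW : 1 ≤ W) (h0 : 0 < ε)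
    (h1 : ε ≤ 1) :
    timeBound ω N W ε ≤ mainTerm ω N W ε * Real.log (mainTerm ω N W ε) ^ 3 := by
  obtain ⟨f1, f2, f3, f4, f5, f6⟩ := log_facts hN hW h0 h1
  have hmain := mainTerm_pos (ω := ω) hN hW h0 h1
  have hN' : (3 : ℝ) ≤ N := by exact_mod_cast hN
  set l := Real.log (N * W / ε) with hl
  have h2 : (N : ℝ) ≤ (N : ℝ) ^ ω := Real.self_le_rpow_of_one_le (by linarith) (by linarith)
  have hl1 : 1 ≤ l := by linarith
  have hε1 : 1 ≤ 1 / ε := by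
    rw [le_div_iff₀ h0]
    linarith
  have e : mainTerm ω N W ε = (N : ℝ) ^ ω * (1 / ε) * l ^ 3 := by
    unfold mainTerm
    ring
  have h3 : (N : ℝ) ≤ mainTerm ω N W ε := by
    rw [e]
    calc (N : ℝ) = N * 1 * 1 ^ 3 := by ring
      _ ≤ _ := by gcongr
  have h4 : l / ε ≤ mainTerm ω N W ε := by
    rw [e]
    calc l / ε = 1 * (1 / ε) * l ^ 1 := by ring
      _ ≤ (N : ℝ) ^ ω * (1 / ε) * l ^ 3 := by
        gcongr
        · linarith
        · norm_num
  have h5 := Real.log_le_log (by linarith) h3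
  have h6 := Real.log_le_log (by linarith) h4
  have h7 : timeBound ω N W ε = mainTerm ω N W ε * (Real.log (l / ε) ^ 2 * Real.log N) := by
    unfold timeBound mainTerm
    ring
  rw [h7]
  gcongr
  calc Real.log (l / ε) ^ 2 * Real.log N
      ≤ Real.log (mainTerm ω N W ε) ^ 2 * Real.log (mainTerm ω N W ε) := by
        gcongr
        linarith
    _ = _ := by ring

/-- The time for writing down the straight-line program is within the bound. -/
theorem rpow_mul_log_le {ω : ℝ} (hω : 2 ≤ ω) : ∃ D : ℝ, 0 ≤ D ∧ ∀ {N W : ℕ} {ε : ℝ} (_ : 3 ≤ N)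
    (_ : 1 ≤ W) (_ : 0 < ε) (_ : ε ≤ 1), (N : ℝ) ^ ω * Real.log N ≤ D * timeBound ω N W ε ∧
      1 ≤ D * timeBound ω N W ε := by
  have hlam0 := Real.log_pos log_three_gt_one
  refine ⟨1 / Real.log (Real.log 3) ^ 2, by positivity, ?_⟩
  intro N W ε hN hW h0 h1
  obtain ⟨f1, f2, f3, f4, f5, f6⟩ := log_facts hN hW h0 h1
  have hN' : (3 : ℝ) ≤ N := by exact_mod_cast hN
  set l := Real.log (N * W / ε) with hl
  have hl1 : 1 ≤ l := by linarith
  have hε1 : 1 ≤ 1 / ε := by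
    rw [le_div_iff₀ h0]
    linarith
  have h2 : (1 : ℝ) ≤ (N : ℝ) ^ ω := Real.one_le_rpow (by linarith) (by linarith)
  have h3 : (N : ℝ) ^ ω * Real.log N ≤
      1 / Real.log (Real.log 3) ^ 2 * timeBound ω N W ε := by
    unfold timeBound
    rw [one_div_mul_eq_div, le_div_iff₀ (by positivity)]
    calc (N : ℝ) ^ ω * Real.log N * Real.log (Real.log 3) ^ 2
        = (N : ℝ) ^ ω * 1 * 1 ^ 3 * Real.log (Real.log 3) ^ 2 * Real.log N := by ring
      _ ≤ (N : ℝ) ^ ω * (1 / ε) * l ^ 3 * Real.log (l / ε) ^ 2 * Real.log N := by gcongr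
      _ = _ := by ring
  exact ⟨h3, le_trans (by nlinarith) h3⟩

end CycleMean

theorem mainTheorem2 (ω : ℝ) (hω : CycleMean.MatMulExponent ω) :
    ∃ (P : CycleMean.Prog) (C : ℝ) (k : ℕ),
      ∀ (n : ℕ) (G : CycleMean.WGraph n) (ε : ℝ), 0 < ε → ε ≤ 1 →
        ∃ (s : CycleMean.State) (c : ℕ), CycleMean.Exec P (G.input ε) s c ∧
          (∀ x : Fin n, s.arr 1 x ≠ 0 ∧
            G.mu x ≤ s.output x ∧ s.output x ≤ (1 + ε) * G.mu x) ∧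
          (c : ℝ) ≤ C * CycleMean.timeBound ω (max n 3) (max G.maxWeight 1) ε ∧
          (c : ℝ) ≤ C * (CycleMean.mainTerm ω (max n 3) (max G.maxWeight 1) ε *
            Real.log (CycleMean.mainTerm ω (max n 3) (max G.maxWeight 1) ε) ^ k) := by
  open CycleMean in
  obtain ⟨P, S, C₀, hS⟩ := hω
  have hω2 : 2 ≤ ω := two_le_of_length_le fun n hn => ⟨(hS n hn).1, (hS n hn).2.1⟩
  set C := max C₀ 1 with hC
  have hC1 : 1 ≤ C := le_max_right _ _
  obtain ⟨A, hA⟩ := algorithm_spec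
  obtain ⟨D₁, hD₁, h₁⟩ := cost_le hC1 hω2
  obtain ⟨D₂, hD₂, h₂⟩ := rpow_mul_log_le hω2
  -- The constant accounts for the generator of the straight-line programs, for the rest of the
  -- algorithm, and (if `n = 0`) for the test of `n`.
  have key : ∀ (n : ℕ) (G : WGraph n) (ε : ℝ), 0 < ε → ε ≤ 1 →
      ∃ (s : State) (c : ℕ), Exec (algorithm P) (G.input ε) s c ∧
        (∀ x : Fin n, s.arr 1 x ≠ 0 ∧ G.mu x ≤ s.output x ∧ s.output x ≤ (1 + ε) * G.mu x) ∧
        (c : ℝ) ≤ (2 * (C * D₂) + A * D₁ + 2 * D₂) *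
          timeBound ω (max n 3) (max G.maxWeight 1) ε := by
    intro n G ε h0 h1
    have hN : 3 ≤ max n 3 := le_max_right _ _
    have hW : 1 ≤ max G.maxWeight 1 := le_max_right _ _
    obtain ⟨b1, b2⟩ := h₂ (N := max n 3) (W := max G.maxWeight 1) hN hW h0 h1
    have hT : 0 ≤ timeBound ω (max n 3) (max G.maxWeight 1) ε := by
      by_contra hneg
      nlinarith
    rcases Nat.eq_zero_or_pos n with rfl | hn
    · -- Without vertices nothing is to be done.
      refine ⟨_, _, Exec.ifz_zero rfl (Exec.const 0 0 _), fun x => x.elim0, ?_⟩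
      have : 0 ≤ (2 * (C * D₂) + A * D₁) *
        timeBound ω (max 0 3) (max G.maxWeight 1) ε := by positivity
      norm_num
      norm_num at b2 this
      linarith
    · obtain ⟨hmul, hlen, s₁, c₁, hP, hdesc, hc⟩ := hS n hn
      obtain ⟨j, j1, j2, j3, j4⟩ := exists_first_digit h0 h1
      obtain ⟨U, hU⟩ : ∃ U, U = 1 + ∑ i ∈ Finset.range (n * n), (G.input ε).arr 0 i := ⟨_, rfl⟩
      have hch := chooseConsts_chosen (j := j) (dig := (G.input ε).arr 1) hn hmul hU
        (fun i hi => by simpa [WGraph.input] using j1 i hi) (by simpa [WGraph.input] using j2)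
      obtain ⟨s, c, e1, e2, e3⟩ := hA (K := chooseConsts n (S n) U j) hP hdesc G hch j3
      have hUle : U ≤ 3 * (max n 3 * max n 3 * max G.maxWeight 1) := by
        have hsum : ∑ i ∈ Finset.range (n * n), (G.input ε).arr 0 i ≤
            n * n * (G.maxWeight + 1) := by
          refine (Finset.sum_le_card_nsmul _ _ (G.maxWeight + 1) fun i hi =>
            G.cell_le ε (Finset.mem_range.1 hi)).trans (le_of_eq ?_)
          simp
        have h4 : n * n * (G.maxWeight + 1) ≤
            max n 3 * max n 3 * (2 * max G.maxWeight 1) := by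
          gcongr <;> omega
        have h5 : 0 < max n 3 * max n 3 * max G.maxWeight 1 := by positivity
        rw [hU]
        linarith
      have hpow : (n : ℝ) ^ ω ≤ ((max n 3 : ℕ) : ℝ) ^ ω := by
        gcongr
        exact le_max_left _ _
      have hlen' : ((S n).length : ℝ) ≤ C * ((max n 3 : ℕ) : ℝ) ^ ω :=
        hlen.trans (mul_le_mul (le_max_left _ _) hpow (by positivity) (by linarith))
      have b3 := h₁ (gs := S n) hn (le_max_left n 3) hN hW h0 h1 (by omega) hUle j4 hlen'
      have hc' : (c₁ : ℝ) ≤ 2 * (C * D₂) * timeBound ω (max n 3) (max G.maxWeight 1) ε := by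
        have hn1 : (1 : ℝ) ≤ n := by exact_mod_cast hn
        have h4 : Real.log n ≤ Real.log (max n 3 : ℕ) :=
          Real.log_le_log (by linarith) (by exact_mod_cast le_max_left n 3)
        have h5 := (log_facts hN hW h0 h1).1
        have h6 := Real.log_nonneg hn1
        calc (c₁ : ℝ) ≤ C₀ * (n : ℝ) ^ ω * (1 + Real.log n) := hc
          _ ≤ C * ((max n 3 : ℕ) : ℝ) ^ ω * (2 * Real.log (max n 3 : ℕ)) := by
              refine mul_le_mul (mul_le_mul (le_max_left _ _) hpow (by positivity) (by linarith))
                (by linarith) (by linarith) (by positivity)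
          _ = 2 * C * (((max n 3 : ℕ) : ℝ) ^ ω * Real.log (max n 3 : ℕ)) := by ring
          _ ≤ 2 * C * (D₂ * timeBound ω (max n 3) (max G.maxWeight 1) ε) := by gcongr
          _ = _ := by ring
      refine ⟨s, c, e1, e3, ?_⟩
      have e2' : (c : ℝ) ≤ ((c₁ + A * (((chooseConsts n (S n) U j).τ + 1) ^ 2 *
        ((chooseConsts n (S n) U j).work * mb (chooseConsts n (S n) U j).bits)) : ℕ) : ℝ) := by
        exact_mod_cast e2
      rw [Nat.cast_add, Nat.cast_mul A] at e2'
      have h7 := mul_le_mul_of_nonneg_left b3 (Nat.cast_nonneg (α := ℝ) A)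
      have h8 : 0 ≤ 2 * D₂ * timeBound ω (max n 3) (max G.maxWeight 1) ε := by positivity
      linarith
  refine ⟨algorithm P, 2 * (C * D₂) + A * D₁ + 2 * D₂, 3, fun n G ε h0 h1 => ?_⟩
  obtain ⟨s, c, e1, e2, e3⟩ := key n G ε h0 h1
  refine ⟨s, c, e1, e2, e3, e3.trans ?_⟩
  have := timeBound_le (N := max n 3) (W := max G.maxWeight 1) hω2 (le_max_right _ _)
    (le_max_right _ _) h0 h1
  gcongr
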